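/- **Setting.** Let $\mathbb K=\mathbb R$ or $\mathbb C$, let $B,\bar B$ be Banach spaces over $\mathbb K$, let $G:B\to\bar B$ be analytic near $0$ with $G[0]=0$, and let $k\ge 1$. For $z_1,z_2,\dots\in B$ put $T^n[z_1,\dots,z_n]=\frac{d^n}{d\varepsilon^n}\big|_{\varepsilon=0}G\big[\varepsilon z_1+\dots+\frac1{n!}\varepsilon^nz_n\big]$, and let $X_n$ (or $X_n(G)$) be the set of $[z_1,\dots,z_n]$ with $T^1=\dots=T^n=0$. For fixed $[\bar z_1,\dots,\bar z_k]$ let $\bar X_n\subset X_n$ be the subset with $z_i=\bar z_i$ for $1\le i\le k$. Let $A_j$ be the coefficient of $\varepsilon^j$ in $G'[\varepsilon\bar z_1+\dots+\frac1{k!}\varepsilon^k\bar z_k]$. *The iteration.* Start with $N_0=B$, $R_0^c=\bar B$. For $m=0,\dots,k$ define $S_{m+1}:N_m\to R_m^c$ by $$S_{m+1}n=\tfrac{(2m)!}{m!}\,P_{R_m^c}\Big(\sum_{j=0}^{m}A_jv_{m-j}\Big),\qquad v_0=n,$$ where $v_1,v_2,\dots$ are chosen such that $\sum_{j=0}^iA_jv_{i-j}=0$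 for $0\le i<m$ (the value does not depend on the choice), and $P_{R_m^c}$ is the projection along $\bar B=R_1\oplus\dots\oplus R_m\oplus R_m^c$. Put $N_{m+1}=\ker S_{m+1}$, $R_{m+1}=\operatorname{ran}S_{m+1}$, and suppose that $S_{m+1}$ is bounded and $N_m=N_{m+1}^c\oplus N_{m+1}$, $R_m^c=R_{m+1}\oplus R_{m+1}^c$ with closed subspaces $N_{m+1}^c,R_{m+1},R_{m+1}^c$. The tuple $[\bar z_1,\dots,\bar z_k]$ is *regular of degree $k$* (with this decomposition) if $\bar X_{2k}\ne\emptyset$ and the sum operator $[S_1\cdots S_{k+1}]:N_0\times\dots\times N_k\to\bar B$, $(n_0,\dots,n_k)\mapsto S_1n_0+\dots+S_{k+1}n_k$, is surjective. *Solution family.* Write $\bar n=(n_1,\dots,n_{k+1})\in N_1\times\dots\times N_{k+1}$. Given isomorphisms $\hat M,\hat L\in GL[B^{k+1},B^{k+1}]$ and $\hat I\in B^{k+1}$, a *solution family of $G$ with leading coefficients $[\bar z_1,\dots,\bar z_k]$ and data $(\hat I,\hat M,\hat L)$* consists of functions $z_j(\varepsilon,\bar n)\in B$, $k<j\le 2k+1$,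 and $n_i^c(\varepsilon,\bar n)\in N_i^c$ such that, for each $r>0$, there is $\varepsilon_0>0$ such that they are smooth for $|\varepsilon|<\varepsilon_0$, $\|\bar n\|<r$, and there 1. $G[z(\varepsilon,\bar n)]=0$ for $z(\varepsilon,\bar n)=\sum_{j=1}^k\frac{\varepsilon^j}{j!}\bar z_j+\sum_{j=k+1}^{2k+1}\frac{\varepsilon^j}{j!}z_j(\varepsilon,\bar n)$; 2. $[\bar z_1,\dots,\bar z_k,z_{k+1},\dots,z_{2k}](\varepsilon,\bar n)\in\bar X_{2k}$ and $[\bar z_1,\dots,\bar z_k,z_{k+1},\dots,z_{2k+1}](0,\bar n)\in\bar X_{2k+1}$; 3. $(z_{2k+1},\dots,z_{k+1})(\varepsilon,\bar n)=\hat I+\hat M\big[(n_1^c,\dots,n_{k+1}^c)(\varepsilon,\bar n)+\hat L\,\bar n\big]$ and $(n_1^c,\dots,n_{k+1}^c)(0,\bar n)=0$. It *satisfies the determinant formula* if, whenever $N^c=N_1^c\oplus\dots\oplus N_{k+1}^c$ is finite-dimensional, $\dim\bar B=\dim N^c$ and, with respect to any bases, there is $c\neq0$ such that $\det\big(G'[z(\varepsilon,\bar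 n)]|_{N^c}\big)=c\,\varepsilon^\chi+O(|\varepsilon|^{\chi+1})$ uniformly for $\bar n$ bounded, where $\chi=1\cdot\dim N_2^c+\dots+k\cdot\dim N_{k+1}^c$. **Corollary 1 (Stability).** Let $[\bar z_1,\dots,\bar z_k]$ be regular of degree $k$ for $G$. Then there are $\hat M,\hat L\in GL[B^{k+1},B^{k+1}]$, $\hat I_0\in B^{k+1}$ and a solution family $z(\varepsilon,\bar n)$ of $G$ with leading coefficients $[\bar z_1,\dots,\bar z_k]$ and data $(\hat I_0,\hat M,\hat L)$, satisfying the determinant formula, such that: (i) For every $H:B\to\bar B$ analytic near $0$ with $H[z]=O(|z|^{2k+1})$, the tuple $[\bar z_1,\dots,\bar z_k]$ is regular of degree $k$ for $G+H$ with the same subspaces and the same operators $S_1,\dots,S_{k+1}$, the set $\bar X_{2k}$ is the same for $G+H$ and $G$, and $G+H$ has a solution family with the same leading coefficients $\bar z_1,\dots,\bar z_k$, with the same $\hat M,\hat L$ and some $\hat I\in B^{k+1}$, satisfying the determinant formula with the same $\chi$. So only $z_{k+1}(\varepsilon,\bar n),\dots,z_{2k+1}(\varepsilon,\bar n)$ may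 change. (ii) For every $H:B\to\bar B$ analytic near $0$ with $H[z]=O(|z|^{2k})$, the family persists for $G+cH$, $c\in\mathbb K$, $|c|$ small: there are $c_0>0$, a smooth $\zeta:\{|c|<c_0\}\to B$ with $\zeta(0)=\bar z_k$, and functions $z_j(c,\varepsilon,\bar n)$, $1\le j\le 2k+1$, such that for each $r>0$ there is $\varepsilon_0>0$ such that for $|c|<c_0$, $|\varepsilon|<\varepsilon_0$, $\|\bar n\|<r$ they are smooth in $(c,\varepsilon,\bar n)$; $z_j=\bar z_j$ for $j<k$ and $z_k=\zeta(c)$; $(G+cH)\big[\sum_{j=1}^{2k+1}\frac{\varepsilon^j}{j!}z_j(c,\varepsilon,\bar n)\big]=0$; $[z_1,\dots,z_{2k}](c,\varepsilon,\bar n)\in X_{2k}(G+cH)$ and $[z_1,\dots,z_{2k+1}](c,0,\bar n)\in X_{2k+1}(G+cH)$; and for $c=0$ they are the coefficients of the family $z(\varepsilon,\bar n)$ of $G$. (iii) Perturbations of order $l\le 2k-1$ may destroy the solution curves: for each $k\ge1$ there are an analytic $G_*:\mathbb K^2\to\mathbb K$ with $G_*[0]=0$, a tuple $[\bar z_1,\dots,\bar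 z_k]$ that is regular of degree $k$ for $G_*$, and a neighbourhood $U$ of $\bar z_1$, such that for each $0\le l\le2k-1$ there is an analytic $H$ with $H[z]=O(|z|^l)$, $H[z]\ne O(|z|^{l+1})$, for which, for every $c\in\mathbb K\setminus\{0\}$ (however small), the equation $G_*[z]+cH[z]=0$ has no smooth solution curve $z(\varepsilon)$ with $z(0)=0$ and $z'(0)\in U$. -/

import Mathlib

open Filter Topology Metric Asymptotics
open scoped Nat ContDiff

noncomputable section

namespace UndeterminedCoefficients

variable {𝕜 : Type*} [RCLike 𝕜]
  {B : Type*} [NormedAddCommGroup B] [NormedSpace 𝕜 B]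
  {F : Type*} [NormedAddCommGroup F] [NormedSpace 𝕜 F]

/-- The polynomial curve `ε z₁ + (1/2!) ε² z₂ + ⋯ + (1/n!) εⁿ zₙ`. Tuples `[z₁, …, zₙ]` are given
by sequences `z : ℕ → B` of which only the entries with index `1, …, n` are used. -/
def curve (n : ℕ) (z : ℕ → B) (ε : 𝕜) : B :=
  ∑ i ∈ Finset.Icc 1 n, (ε ^ i / (i ! : 𝕜)) • z i

/-- The coefficient `Tⁿ[z₁, …, zₙ]`, i.e. the `n`-th derivative at `ε = 0` of
`G[ε z₁ + ⋯ + (1/n!) εⁿ zₙ]`. -/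
def T (𝕜 : Type*) [RCLike 𝕜] [NormedSpace 𝕜 B] [NormedSpace 𝕜 F]
    (G : B → F) (n : ℕ) (z : ℕ → B) : F :=
  iteratedDeriv n (fun ε : 𝕜 => G (curve n z ε)) 0

/-- `X_n`: the solutions `[z₁, …, zₙ]` of `T¹ = ⋯ = Tⁿ = 0`. -/
def X (𝕜 : Type*) [RCLike 𝕜] [NormedSpace 𝕜 B] [NormedSpace 𝕜 F]
    (G : B → F) (n : ℕ) : Set (ℕ → B) :=
  {z | ∀ m, 1 ≤ m → m ≤ n → T 𝕜 G m z = 0}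

/-- `X̄_n`: the elements of `X_n` with leading coefficients `[z̄₁, …, z̄ₖ]`. -/
def Xbar (𝕜 : Type*) [RCLike 𝕜] [NormedSpace 𝕜 B] [NormedSpace 𝕜 F]
    (G : B → F) (k : ℕ) (zbar : ℕ → B) (n : ℕ) : Set (ℕ → B) :=
  {z | z ∈ X 𝕜 G n ∧ ∀ i, 1 ≤ i → i ≤ k → z i = zbar i}

/-- The coefficient `A_j` of `εʲ` in the expansion of the linearization `G'[·]` along
`ε z̄₁ + ⋯ + (1/k!) εᵏ z̄ₖ`; for `j ≤ k` it depends on `z̄₁, …, z̄_j` and on the derivatives of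
order at most `j + 1` of `G` at `0` only: `A₀ = G'[0]`, `A₁ = G''[0] z̄₁`,
`A₂ = (G''[0] z̄₂ + G'''[0] z̄₁²) / 2`. -/
def linCoeff (𝕜 : Type*) [RCLike 𝕜] [NormedSpace 𝕜 B] [NormedSpace 𝕜 F]
    (G : B → F) (k : ℕ) (zbar : ℕ → B) (j : ℕ) : B →L[𝕜] F :=
  (j ! : 𝕜)⁻¹ • iteratedDeriv j (fun ε : 𝕜 => fderiv 𝕜 G (curve k zbar ε)) 0

/-- The coefficient of `εᵐ` in the product of `∑ A_j εʲ` and `∑ v_j εʲ`. -/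
def prodCoeff (A : ℕ → B →L[𝕜] F) (m : ℕ) (v : ℕ → B) : F :=
  ∑ j ∈ Finset.range (m + 1), A j (v (m - j))

/-- `v` is a lift of order `m` of `v 0`: the product of `∑ A_j εʲ` and `∑ v_j εʲ` is
`O(|ε|ᵐ)`. -/
def IsLift (A : ℕ → B →L[𝕜] F) (m : ℕ) (v : ℕ → B) : Prop :=
  ∀ i < m, prodCoeff A i v = 0

/-- The subspaces and operators that the iteration produces; `S m : N_m → R_m^c` is the operator
`S_{m+1}`. What they have to satisfy is `IterationData.IsIteration`. -/
structure IterationData (𝕜 : Type*) [RCLike 𝕜]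
    (B : Type*) [NormedAddCommGroup B] [NormedSpace 𝕜 B]
    (F : Type*) [NormedAddCommGroup F] [NormedSpace 𝕜 F] where
  N : ℕ → Submodule 𝕜 B
  Nc : ℕ → Submodule 𝕜 B
  R : ℕ → Submodule 𝕜 F
  Rc : ℕ → Submodule 𝕜 F
  S : ∀ m : ℕ, N m →L[𝕜] Rc m

namespace IterationData

/-- `R₁ ⊕ ⋯ ⊕ R_m`. -/
def RSum (D : IterationData 𝕜 B F) (m : ℕ) : Submodule 𝕜 F :=
  ⨆ i : Fin m, D.R (i + 1)

/-- `N^c = N₁^c ⊕ ⋯ ⊕ N_{k+1}^c`. -/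
def NcSum (D : IterationData 𝕜 B F) (k : ℕ) : Submodule 𝕜 B :=
  ⨆ i : Fin (k + 1), D.Nc (i + 1)

/-- The state of the iteration with operators `S₁, …, S_{k+1}`, filtration
`B = N₀ ⊃ N₁ ⊃ ⋯ ⊃ N_{k+1}` and decompositions `B = N₁^c ⊕ ⋯ ⊕ N_{k+1}^c ⊕ N_{k+1}`,
`B̄ = R₁ ⊕ ⋯ ⊕ R_{k+1} ⊕ R_{k+1}^c` into closed subspaces.

The field `S_spec` says that
`S_{m+1} n = ((2m)!/m!) P_{R_m^c} (A_m n + A_{m-1} v₁ + ⋯ + A₁ v_{m-1})`, where `v₁, …, v_{m-1}`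
extend `v₀ = n` to a lift of order `m`, and `P_{R_m^c}` is the projection along
`B̄ = R₁ ⊕ ⋯ ⊕ R_m ⊕ R_m^c` (it also removes `A₀ v_m`, an element of `R₁`, if `1 ≤ m`).
The value does not depend on the lift, see `S_eq_of_isLift`. For `m = 0, 1, 2` the formula reads
`S₁ = G'[0]`, `S₂ = P_{R₁^c} 2 G''[0] z̄₁` and
`S₃ = P_{R₂^c} (6 G''[0] z̄₂ + 6 G'''[0] z̄₁² - 12 G''[0] z̄₁ S₁⁻¹ P_{R₁} G''[0] z̄₁)`. -/
structure IsIteration (D : IterationData 𝕜 B F) (A : ℕ → B →L[𝕜] F) (k : ℕ) : Prop where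
  N_zero : D.N 0 = ⊤
  Rc_zero : D.Rc 0 = ⊤
  S_spec : ∀ m ≤ k, ∀ n : D.N m, ∃ v : ℕ → B, v 0 = n ∧ IsLift A m v ∧
    (((2 * m)! : 𝕜) / (m ! : 𝕜)) • prodCoeff A m v - (D.S m n : F) ∈ D.RSum m
  N_succ : ∀ m ≤ k,
    D.N (m + 1) = (LinearMap.ker (D.S m : D.N m →ₗ[𝕜] D.Rc m)).map (D.N m).subtype
  R_succ : ∀ m ≤ k,
    D.R (m + 1) = (LinearMap.range (D.S m : D.N m →ₗ[𝕜] D.Rc m)).map (D.Rc m).subtype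
  N_disjoint : ∀ m ≤ k, Disjoint (D.Nc (m + 1)) (D.N (m + 1))
  N_sup : ∀ m ≤ k, D.Nc (m + 1) ⊔ D.N (m + 1) = D.N m
  R_disjoint : ∀ m ≤ k, Disjoint (D.R (m + 1)) (D.Rc (m + 1))
  R_sup : ∀ m ≤ k, D.R (m + 1) ⊔ D.Rc (m + 1) = D.Rc m
  Nc_closed : ∀ m ≤ k, IsClosed (D.Nc (m + 1) : Set B)
  R_closed : ∀ m ≤ k, IsClosed (D.R (m + 1) : Set F)
  Rc_closed : ∀ m ≤ k, IsClosed (D.Rc (m + 1) : Set F)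

/-- The sum operator `[S₁ ⋯ S_{k+1}] : N₀ × ⋯ × N_k → B̄`. -/
def sumOp (D : IterationData 𝕜 B F) (k : ℕ) : (∀ i : Fin (k + 1), D.N i) →L[𝕜] F :=
  ∑ i : Fin (k + 1), (D.Rc i).subtypeL ∘L D.S i ∘L ContinuousLinearMap.proj i

/-- The parameters `n̄ = (n₁, …, n_{k+1}) ∈ N₁ × ⋯ × N_{k+1}`. -/
abbrev Param (D : IterationData 𝕜 B F) (k : ℕ) : Type _ :=
  ∀ i : Fin (k + 1), D.N (i + 1)

/-- The dependent variables `(n₁^c, …, n_{k+1}^c) ∈ N₁^c × ⋯ × N_{k+1}^c`. -/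
abbrev CoParam (D : IterationData 𝕜 B F) (k : ℕ) : Type _ :=
  ∀ i : Fin (k + 1), D.Nc (i + 1)

theorem IsIteration.disjoint_RSum {D : IterationData 𝕜 B F} {A : ℕ → B →L[𝕜] F} {k : ℕ}
    (hD : D.IsIteration A k) : ∀ m ≤ k + 1, Disjoint (D.RSum m) (D.Rc m) := by
  intro m
  induction m with
  | zero =>
    intro _
    rw [RSum, iSup_of_empty]
    exact disjoint_bot_left
  | succ m ih =>
    intro hm
    have h1 := ih (by omega)
    have h2 := hD.R_disjoint m (by omega)
    have h3 := hD.R_sup m (by omega)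
    have h4 : D.RSum (m + 1) = D.RSum m ⊔ D.R (m + 1) := by
      apply le_antisymm
      · refine iSup_le fun i => ?_
        rcases Nat.lt_succ_iff_lt_or_eq.mp i.2 with h | h
        · exact le_sup_of_le_left (le_iSup (fun i : Fin m => D.R (i + 1)) ⟨i, h⟩)
        · rw [h]; exact le_sup_right
      · refine sup_le (iSup_le fun i => ?_) ?_
        · exact le_iSup (fun i : Fin (m + 1) => D.R (i + 1)) i.castSucc
        · exact le_iSup (fun i : Fin (m + 1) => D.R (i + 1)) (Fin.last m)
    rw [h4, Submodule.disjoint_def]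
    intro x hx hxc
    obtain ⟨a, ha, b, hb, rfl⟩ := Submodule.mem_sup.mp hx
    have hb' : b ∈ D.Rc m := h3 ▸ Submodule.mem_sup_left hb
    have hx' : a + b ∈ D.Rc m := h3 ▸ Submodule.mem_sup_right hxc
    have ha' : a ∈ D.Rc m := by simpa using sub_mem hx' hb'
    have ha0 : a = 0 := Submodule.disjoint_def.mp h1 a ha ha'
    subst ha0
    simp only [zero_add] at hxc ⊢
    exact Submodule.disjoint_def.mp h2 b hb hxc

/-- A sequence that is a lift of order `m` starts in `N_m`, and `S_{m+1}` may be computed from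
any lift. -/
theorem IsIteration.S_eq_of_isLift {D : IterationData 𝕜 B F} {A : ℕ → B →L[𝕜] F} {k : ℕ}
    (hD : D.IsIteration A k) : ∀ m ≤ k, ∀ v : ℕ → B, IsLift A m v →
      ∃ h : v 0 ∈ D.N m,
        (((2 * m)! : 𝕜) / (m ! : 𝕜)) • prodCoeff A m v - (D.S m ⟨v 0, h⟩ : F) ∈ D.RSum m := by
  have hRle : ∀ m, D.RSum m ≤ D.RSum (m + 1) := fun m =>
    iSup_le fun i => le_iSup (fun i : Fin (m + 1) => D.R (i + 1)) i.castSucc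
  have hc : ∀ m : ℕ, (((2 * m)! : 𝕜) / (m ! : 𝕜)) ≠ 0 := fun m =>
    div_ne_zero (Nat.cast_ne_zero.mpr (Nat.factorial_ne_zero _))
      (Nat.cast_ne_zero.mpr (Nat.factorial_ne_zero _))
  intro m
  induction m with
  | zero =>
    intro _ v _
    have h0 : v 0 ∈ D.N 0 := by rw [hD.N_zero]; trivial
    refine ⟨h0, ?_⟩
    obtain ⟨w, hw0, -, hw⟩ := hD.S_spec 0 (by omega) ⟨v 0, h0⟩
    have : prodCoeff A 0 v = prodCoeff A 0 w := by simp [prodCoeff, hw0]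
    rw [this]; exact hw
  | succ m ih =>
    intro hm v hv
    have hN : v 0 ∈ D.N (m + 1) := by
      obtain ⟨h, h'⟩ := ih (by omega) v fun i hi => hv i (by omega)
      rw [hv m (by omega), smul_zero, zero_sub, neg_mem_iff] at h'
      have h0 := Submodule.disjoint_def.mp (hD.disjoint_RSum m (by omega)) _ h'
        (D.S m ⟨v 0, h⟩).2
      rw [hD.N_succ m (by omega)]
      exact ⟨⟨v 0, h⟩, by simpa using h0, rfl⟩
    refine ⟨hN, ?_⟩
    obtain ⟨w, hw0, hwl, hw⟩ := hD.S_spec (m + 1) hm ⟨v 0, hN⟩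
    have hd0 : v 0 - w 0 = 0 := by rw [hw0]; simp
    have hshift : ∀ i, prodCoeff A (i + 1) v - prodCoeff A (i + 1) w
        = prodCoeff A i fun j => v (j + 1) - w (j + 1) := by
      intro i
      have e : prodCoeff A (i + 1) v - prodCoeff A (i + 1) w
          = ∑ j ∈ Finset.range (i + 1 + 1), A j (v (i + 1 - j) - w (i + 1 - j)) := by
        simp only [prodCoeff, map_sub, Finset.sum_sub_distrib]
      rw [e, Finset.sum_range_succ, Nat.sub_self, hd0, map_zero, add_zero, prodCoeff]
      refine Finset.sum_congr rfl fun j hj => ?_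
      have : i + 1 - j = i - j + 1 := by have := Finset.mem_range.mp hj; omega
      rw [this]
    obtain ⟨h, h'⟩ := ih (by omega) (fun j => v (j + 1) - w (j + 1)) fun i hi => by
      rw [← hshift i, hv (i + 1) (by omega), hwl (i + 1) (by omega), sub_zero]
    rw [← hshift m] at h'
    have hS : (D.S m ⟨v (0 + 1) - w (0 + 1), h⟩ : F) ∈ D.RSum (m + 1) :=
      le_iSup (fun i : Fin (m + 1) => D.R (i + 1)) (Fin.last m) (by
        show _ ∈ D.R (m + 1)
        rw [hD.R_succ m (by omega)]
        exact ⟨_, ⟨_, rfl⟩, rfl⟩)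
    have h1 := add_mem (hRle m h') hS
    rw [sub_add_cancel] at h1
    have h2 := (Submodule.smul_mem_iff _ (hc m)).mp h1
    have h3 := add_mem hw (Submodule.smul_mem _ (((2 * (m + 1))! : 𝕜) / ((m + 1)! : 𝕜)) h2)
    convert h3 using 1
    rw [smul_sub]
    abel

end IterationData

/-- `[z̄₁, …, z̄ₖ]` is regular of degree `k` with associated decomposition `D`: the iteration with
data `D` can be performed, `[z̄₁, …, z̄ₖ]` are the leading coefficients of an element of `X_{2k}`,
and the sum operator is surjective. -/
structure IsRegularWith (G : B → F) (k : ℕ) (zbar : ℕ → B) (D : IterationData 𝕜 B F) : Prop where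
  iteration : D.IsIteration (linCoeff 𝕜 G k zbar) k
  solvable : (Xbar 𝕜 G k zbar (2 * k)).Nonempty
  surjective : Function.Surjective (D.sumOp k)

/-- The function `Z`, with values `(z₁, …, z_{2k+1})(ε, n̄)`, gives the coefficients of a smooth
family of solution curves `z(ε, n̄) = ∑_{i ≤ 2k+1} (1/i!) εⁱ z_i(ε, n̄)` of `G[z] = 0`, with leading
coefficients `[z̄₁, …, z̄ₖ]`, defined for `n̄` in arbitrary bounded sets and `ε` small, and with
`(z_{2k+1}, …, z_{k+1}) = I + M (n^c(ε, n̄) + L n̄)`, `n^c(0, n̄) = 0`. -/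
structure IsSolutionFamily (G : B → F) (k : ℕ) (zbar : ℕ → B) (D : IterationData 𝕜 B F)
    (I : Fin (k + 1) → B) (M L : (Fin (k + 1) → B) ≃L[𝕜] (Fin (k + 1) → B))
    (nc : 𝕜 → D.Param k → D.CoParam k) (Z : 𝕜 → D.Param k → ℕ → B) : Prop where
  base : ∀ nbar, nc 0 nbar = 0 ∧ Z 0 nbar ∈ Xbar 𝕜 G k zbar (2 * k + 1)
  family : ∀ r > 0, ∃ ε₀ > 0,
    ContDiffOn 𝕜 ∞ (fun p : 𝕜 × D.Param k => nc p.1 p.2) (ball 0 ε₀ ×ˢ ball 0 r) ∧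
    (∀ j ∈ Finset.Icc 1 (2 * k + 1),
      ContDiffOn 𝕜 ∞ (fun p : 𝕜 × D.Param k => Z p.1 p.2 j) (ball 0 ε₀ ×ˢ ball 0 r)) ∧
    ∀ ε ∈ ball (0 : 𝕜) ε₀, ∀ nbar ∈ ball (0 : D.Param k) r,
      G (curve (2 * k + 1) (Z ε nbar) ε) = 0 ∧
      Z ε nbar ∈ Xbar 𝕜 G k zbar (2 * k) ∧
      ∀ i : Fin (k + 1), Z ε nbar (2 * k + 1 - i) =
        (I + M ((fun q => (nc ε nbar q : B)) + L fun q => (nbar q : B))) i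

/-- If `N^c` has finite dimension, then so has `B̄`, the dimensions agree, and (with respect to
any bases) the determinant of `G'[z(ε, n̄)] : N^c → B̄` is `c ε^χ + O(|ε|^{χ+1})` with `c ≠ 0` and
`χ = 1 · dim N₂^c + ⋯ + k · dim N_{k+1}^c`, for `z(ε, n̄)` with coefficients `Z ε n̄`. -/
def HasDetExpansion (G : B → F) (k : ℕ) (D : IterationData 𝕜 B F)
    (Z : 𝕜 → D.Param k → ℕ → B) : Prop :=
  FiniteDimensional 𝕜 (D.NcSum k) →
    FiniteDimensional 𝕜 F ∧ Module.finrank 𝕜 (D.NcSum k) = Module.finrank 𝕜 F ∧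
    ∀ (d : ℕ) (b : Module.Basis (Fin d) 𝕜 (D.NcSum k)) (b' : Module.Basis (Fin d) 𝕜 F),
      ∃ c : 𝕜, c ≠ 0 ∧ ∀ r > 0, ∃ ε₀ > 0, ∃ C : ℝ,
        ∀ ε ∈ ball (0 : 𝕜) ε₀, ∀ nbar ∈ ball (0 : D.Param k) r,
          ‖(LinearMap.toMatrix b b'
              ((fderiv 𝕜 G (curve (2 * k + 1) (Z ε nbar) ε) : B →ₗ[𝕜] F) ∘ₗ
                (D.NcSum k).subtype)).det
            - c * ε ^ (∑ i ∈ Finset.range (k + 1), i * Module.finrank 𝕜 (D.Nc (i + 1)))‖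
          ≤ C * ‖ε‖ ^ ((∑ i ∈ Finset.range (k + 1), i * Module.finrank 𝕜 (D.Nc (i + 1))) + 1)

/-- The family `Z₀` of solution curves of `G[z] = 0` persists as a family `Z c` of solution curves
of `G[z] + c H[z] = 0` for all sufficiently small `c`: it depends smoothly on `(c, ε, n̄)`, agrees
with `Z₀` for `c = 0`, keeps the coefficients `z̄₁, …, z̄_{k-1}`, and has a constant `k`-th
coefficient `ζ(c)` with `ζ(0) = z̄ₖ`. -/
def Persists (G H : B → F) (k : ℕ) (zbar : ℕ → B) (D : IterationData 𝕜 B F)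
    (Z₀ : 𝕜 → D.Param k → ℕ → B) : Prop :=
  ∃ c₀ > 0, ∃ (ζ : 𝕜 → B) (Z : 𝕜 → 𝕜 → D.Param k → ℕ → B),
    ζ 0 = zbar k ∧ ContDiffOn 𝕜 ∞ ζ (ball 0 c₀) ∧
    ∀ r > 0, ∃ ε₀ > 0,
      (∀ j ∈ Finset.Icc 1 (2 * k + 1),
        ContDiffOn 𝕜 ∞ (fun p : 𝕜 × 𝕜 × D.Param k => Z p.1 p.2.1 p.2.2 j)
          (ball 0 c₀ ×ˢ ball 0 ε₀ ×ˢ ball 0 r)) ∧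
      (∀ c ∈ ball (0 : 𝕜) c₀, ∀ ε ∈ ball (0 : 𝕜) ε₀, ∀ nbar ∈ ball (0 : D.Param k) r,
        G (curve (2 * k + 1) (Z c ε nbar) ε) + c • H (curve (2 * k + 1) (Z c ε nbar) ε) = 0 ∧
        Z c ε nbar ∈ Xbar 𝕜 (fun z => G z + c • H z) k (Function.update zbar k (ζ c)) (2 * k) ∧
        Z c 0 nbar ∈
          Xbar 𝕜 (fun z => G z + c • H z) k (Function.update zbar k (ζ c)) (2 * k + 1)) ∧
      ∀ ε ∈ ball (0 : 𝕜) ε₀, ∀ nbar ∈ ball (0 : D.Param k) r,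
        ∀ j ∈ Finset.Icc 1 (2 * k + 1), Z 0 ε nbar j = Z₀ ε nbar j

/-- All curves starting at the origin in a direction from `U` are destroyed: there is no smooth
solution curve `z(ε)` of `G[z] = 0` with `z(0) = 0` and `z'(0) ∈ U`. -/
def NoSolutionCurve (𝕜 : Type*) [RCLike 𝕜] [NormedSpace 𝕜 B]
    (G : B → F) (U : Set B) : Prop :=
  ∀ z : 𝕜 → B, ContDiffAt 𝕜 ∞ z 0 → z 0 = 0 → deriv z 0 ∈ U → ¬ ∀ᶠ ε in 𝓝 0, G (z ε) = 0

end UndeterminedCoefficients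

end

/-!
The proof rests on lifts. Every step of the iteration can be made by operators that depend linearly
and boundedly on the starting element: there is an operator polynomial `Λ(ε)` on `B^{k+1}`, built
from lifts of the elements of the `N_i`, such that `A(ε) = ∑ A_j εʲ` satisfies
`A(ε) Λ(ε) (y + n) = εᵏ Ψ y + O(ε^{k+1})` for `y ∈ N₁^c × ⋯ × N_{k+1}^c` and
`n ∈ N₁ × ⋯ × N_{k+1}`. The leading operator `Ψ : N₁^c × ⋯ × N_{k+1}^c → B̄` is triangular with
respect to `R₁ ⊕ ⋯ ⊕ R_{k+1}`, with `S_{i+1}` restricted to `N_{i+1}^c` on the diagonal, up to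
nonzero factors; surjectivity of the sum operator makes it an isomorphism
(`IterationData.nonempty_liftSystem`).

Solutions of `G + c H = 0` are sought along `z(ε) + εᵏ Λ(ε) y(c) + ε^{k+1} Λ(ε) (y + n)`, where `z`
is an element of `X̄_{2k+1}` for `G`. Expressions of order `εᵐ` are analytic multiples of `εᵐ`
(`exists_analyticAt_eq_pow_smul`). The equation for `y(c)`, divided by `ε^{2k}` and taken at
`ε = 0`, has the derivative `Ψ` at `c = 0` and is solved by the implicit function theorem
(`exists_perturbed_base`); the corresponding term changes only coefficients from `z_k` on, and
it vanishes for `c = 0`. The full equation, divided by `ε^{2k+1}`, is then `Ψ_c y + ε q = 0` with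
an analytic `q` and invertible `Ψ_c`, after the solution of `Ψ_c y + ⋯ = 0` for `ε = 0`, affine in
`n`, has been split off. For bounded `n` this is a uniform contraction (`exists_contraction`), with
a smooth fixed point (`exists_contDiffAt_fixedPoint`). Since the solution in the unit ball is unique,
the families for different bounds of `n` fit together, and for `c = 0` they do not depend on `H`.
The coefficients `z_{2k+1}, …, z_{k+1}` depend on `y + n` through a triangular operator with
identities on the diagonal, up to factorials, which is `M̂`.

A perturbation of order `2k + 1` does not change `A_0, …, A_k`, hence leaves the iteration, the lifts
and `M̂` the same, and the construction applies to `G + H`.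

On `N^c`, the operator `Λ(ε)` is the composition of the scaling by `ε^{k-i}` on `N_{i+1}^c` and a
lift that is the identity for `ε = 0`. As `G' Λ(ε) = εᵏ (Ψ + O(ε))` along the solution curves,
comparison of determinants gives the exponent `∑ (k - (k - i)) dim N_{i+1}^c` and the coefficient
`det Ψ` (`det_mul_eq`, `exists_det_expansion`).

Perturbations of lower order destroy the solution curves of `y² - x^{2k} = 0`: for a suitable
perturbation, a unit times `y²` equals a unit times an odd power of `x` along a solution curve with
`x'(0) ≠ 0`, and an odd power has no smooth square root (`not_eventually_sq_mul_eq`).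
-/

open Filter Topology Metric Asymptotics
open scoped Nat ContDiff

noncomputable section

set_option linter.unusedSectionVars false

/-! ### Division of analytic functions by powers of `ε` -/

namespace UndeterminedCoefficients

section Division

variable {𝕜 : Type*} [RCLike 𝕜] {V : Type*} [NormedAddCommGroup V] [NormedSpace 𝕜 V]
  {W : Type*} [NormedAddCommGroup W] [NormedSpace 𝕜 W] [CompleteSpace W]

/-- The linear map `(s, x) ↦ (t s, x)`. -/
def scaleFst (𝕜 : Type*) [RCLike 𝕜] (V : Type*) [NormedAddCommGroup V] [NormedSpace 𝕜 V] (t : ℝ) :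
    𝕜 × V →L[𝕜] 𝕜 × V :=
  ((t : 𝕜) • ContinuousLinearMap.id 𝕜 𝕜).prodMap (ContinuousLinearMap.id 𝕜 V)

theorem scaleFst_apply (t : ℝ) (v : 𝕜 × V) : scaleFst 𝕜 V t v = ((t : 𝕜) * v.1, v.2) := rfl

theorem continuous_scaleFst : Continuous (scaleFst 𝕜 V) := by
  have : scaleFst 𝕜 V = fun t : ℝ => (t : 𝕜) • (ContinuousLinearMap.inl 𝕜 𝕜 V ∘L
      ContinuousLinearMap.fst 𝕜 𝕜 V) + ContinuousLinearMap.inr 𝕜 𝕜 V ∘L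
      ContinuousLinearMap.snd 𝕜 𝕜 V := by
    ext t v <;> simp [scaleFst_apply]
  rw [this]
  fun_prop

theorem norm_scaleFst_apply_le {t : ℝ} (ht : t ∈ Set.Icc (0 : ℝ) 1) (v : 𝕜 × V) :
    ‖scaleFst 𝕜 V t v‖ ≤ ‖v‖ := by
  rw [scaleFst_apply, Prod.norm_def]
  refine max_le ?_ (norm_snd_le v)
  simp only [norm_mul, RCLike.norm_ofReal, abs_of_nonneg ht.1]
  exact (mul_le_of_le_one_left (norm_nonneg _) ht.2).trans (norm_fst_le v)

/-- Averaging an analytic function over the segment `t ↦ (t s, x)` gives an analytic function: its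
power series is `∑ ∫₀¹ pₙ((t s, x), …, (t s, x)) dt`. -/
theorem analyticAt_integral_scaleFst {g : 𝕜 × V → W} [NormedSpace ℝ W] [IsScalarTower ℝ 𝕜 W]
    (hg : AnalyticAt 𝕜 g 0) :
    AnalyticAt 𝕜 (fun v => ∫ t in (0 : ℝ)..1, g (scaleFst 𝕜 V t v)) 0 := by
  obtain ⟨p, r, hp⟩ := hg
  obtain ⟨ρ, hρ0, hρ⟩ := ENNReal.lt_iff_exists_nnreal_btwn.mp hp.r_pos
  have hρ0' : 0 < ρ := by simpa using hρ0
  obtain ⟨C, hC, hpC⟩ := p.norm_mul_pow_le_of_lt_radius (hρ.trans_le hp.r_le)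
  have : SMulCommClass 𝕜 ℝ W := by
    constructor
    intro a b w
    rw [← smul_one_smul 𝕜 b w, ← smul_one_smul 𝕜 b (a • w), smul_smul, smul_smul, mul_comm]
  set P : ∀ n : ℕ, ℝ → ContinuousMultilinearMap 𝕜 (fun _ : Fin n => 𝕜 × V) W := fun n t =>
    (p n).compContinuousLinearMap (fun _ => scaleFst 𝕜 V t) with hP
  have hPc : ∀ n, Continuous (P n) := by
    intro n
    have h1 : Continuous fun t : ℝ =>
        ContinuousMultilinearMap.compContinuousLinearMapContinuousMultilinear 𝕜
          (fun _ : Fin n => 𝕜 × V) (fun _ : Fin n => 𝕜 × V) W (fun _ => scaleFst 𝕜 V t) := by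
      refine (ContinuousMultilinearMap.cont _).comp ?_
      exact continuous_pi fun _ => continuous_scaleFst
    exact h1.clm_apply continuous_const
  have hPb : ∀ n, ∀ t ∈ Set.Icc (0 : ℝ) 1, ‖P n t‖ ≤ ‖p n‖ := by
    intro n t ht
    refine ContinuousMultilinearMap.opNorm_le_bound (norm_nonneg _) fun m => ?_
    refine ((p n).le_opNorm _).trans ?_
    gcongr with i
    exact norm_scaleFst_apply_le ht _
  let q : FormalMultilinearSeries 𝕜 (𝕜 × V) W := fun n => ∫ t in (0 : ℝ)..1, P n t
  have hqb : ∀ n, ‖q n‖ ≤ ‖p n‖ := by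
    intro n
    have := intervalIntegral.norm_integral_le_of_norm_le_const (a := (0 : ℝ)) (b := 1)
      (f := P n) (C := ‖p n‖) (fun t ht => hPb n t (by
        rw [Set.uIoc_of_le zero_le_one] at ht; exact ⟨ht.1.le, ht.2⟩))
    simpa using this
  refine ⟨q, ρ, ?_, by exact_mod_cast hρ0', ?_⟩
  · exact q.le_radius_of_bound C fun n =>
      (mul_le_mul_of_nonneg_right (hqb n) (by positivity)).trans (hpC n)
  · intro y hy
    have hy' : ‖y‖ < ρ := by simpa [← coe_nnnorm] using hy
    have hqy : ∀ n, (q n fun _ => y) = ∫ t in (0 : ℝ)..1, p n fun _ => scaleFst 𝕜 V t y := by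
      intro n
      have := (ContinuousMultilinearMap.apply 𝕜 (fun _ : Fin n => 𝕜 × V) W
        (fun _ => y)).intervalIntegral_comp_comm (μ := MeasureTheory.volume) (a := (0 : ℝ)) (b := 1)
        ((hPc n).intervalIntegrable _ _)
      exact this.symm
    simp only [hqy, zero_add]
    refine intervalIntegral.hasSum_integral_of_dominated_convergence
      (fun n _ => C * (‖y‖ / ρ) ^ n) (fun n => ?_) (fun n => ?_) ?_ ?_ ?_
    · refine Continuous.aestronglyMeasurable ?_
      exact (p n).cont.comp (continuous_pi fun _ => continuous_scaleFst.clm_apply continuous_const)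
    · refine Eventually.of_forall fun t ht => ?_
      rw [Set.uIoc_of_le zero_le_one] at ht
      refine ((p n).le_opNorm _).trans ?_
      have h1 := norm_scaleFst_apply_le (V := V) (𝕜 := 𝕜) ⟨ht.1.le, ht.2⟩ y
      calc ‖p n‖ * ∏ _i : Fin n, ‖scaleFst 𝕜 V t y‖ ≤ ‖p n‖ * ‖y‖ ^ n := by
            simp only [Finset.prod_const, Finset.card_univ, Fintype.card_fin]
            gcongr
        _ = ‖p n‖ * ρ ^ n * (‖y‖ / ρ) ^ n := by
            rw [div_pow]; field_simp
        _ ≤ _ := by gcongr; exact hpC n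
    · refine Eventually.of_forall fun t _ => ?_
      exact (summable_geometric_of_lt_one (by positivity)
        ((div_lt_one (by exact_mod_cast hρ0')).mpr hy')).mul_left C
    · exact intervalIntegrable_const
    · refine Eventually.of_forall fun t ht => ?_
      rw [Set.uIoc_of_le zero_le_one] at ht
      have h1 := norm_scaleFst_apply_le (V := V) (𝕜 := 𝕜) ⟨ht.1.le, ht.2⟩ y
      have := hp.hasSum (y := scaleFst 𝕜 V t y) (by
        refine Metric.eball_subset_eball hρ.le ?_
        simpa [← coe_nnnorm] using h1.trans_lt hy')
      simpa using this

/-- Hadamard's lemma in the analytic category: the quotient is `∫₀¹ ∂f/∂ε (t ε, x) dt`. -/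
theorem exists_analyticAt_sub_eq_smul {f : 𝕜 × V → W} (hf : AnalyticAt 𝕜 f 0) :
    ∃ ψ : 𝕜 × V → W, AnalyticAt 𝕜 ψ 0 ∧
      ∀ᶠ v in 𝓝 (0 : 𝕜 × V), f v - f (0, v.2) = v.1 • ψ v := by
  let _ : NormedSpace ℝ W := NormedSpace.restrictScalars ℝ 𝕜 W
  have : IsScalarTower ℝ 𝕜 W := RestrictScalars.isScalarTower ℝ 𝕜 W
  set g : 𝕜 × V → W := fun v => fderiv 𝕜 f v (1, 0) with hgdef
  have hg : AnalyticAt 𝕜 g 0 :=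
    ((ContinuousLinearMap.apply 𝕜 W ((1, 0) : 𝕜 × V)).analyticAt _).comp hf.fderiv
  refine ⟨_, analyticAt_integral_scaleFst hg, ?_⟩
  obtain ⟨δ, hδ, hball⟩ := Metric.eventually_nhds_iff_ball.mp
    (hf.eventually_analyticAt.and hg.eventually_analyticAt)
  filter_upwards [Metric.ball_mem_nhds _ hδ] with v hv
  have hmem : ∀ t ∈ Set.Icc (0 : ℝ) 1, scaleFst 𝕜 V t v ∈ ball (0 : 𝕜 × V) δ := by
    intro t ht
    rw [mem_ball_zero_iff] at hv ⊢
    exact (norm_scaleFst_apply_le ht v).trans_lt hv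
  have h1 : ∀ t ∈ Set.uIcc (0 : ℝ) 1,
      HasDerivAt (fun t : ℝ => f (scaleFst 𝕜 V t v)) (v.1 • g (scaleFst 𝕜 V t v)) t := by
    intro t ht
    rw [Set.uIcc_of_le zero_le_one] at ht
    have hd := (hball _ (hmem t ht)).1.differentiableAt.hasFDerivAt
    have hs : HasDerivAt (fun s : 𝕜 => ((s * v.1, v.2) : 𝕜 × V)) ((v.1, 0) : 𝕜 × V) (t : 𝕜) := by
      refine HasDerivAt.prodMk ?_ (hasDerivAt_const _ _)
      simpa using (hasDerivAt_id (t : 𝕜)).mul_const v.1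
    have hc := HasFDerivAt.comp_hasDerivAt (t : 𝕜) (f := fun s : 𝕜 => ((s * v.1, v.2) : 𝕜 × V))
      (by simpa only [scaleFst_apply] using hd) hs
    have hv1 : ((v.1, 0) : 𝕜 × V) = v.1 • ((1, 0) : 𝕜 × V) := by simp
    rw [hv1, map_smul] at hc
    have h2 := HasDerivAt.scomp_of_eq t (h := fun t : ℝ => (t : 𝕜)) (h' := (1 : 𝕜)) hc
      (by simpa using (RCLike.ofRealCLM (K := 𝕜)).hasDerivAt (x := t)) rfl
    simpa [scaleFst_apply, Function.comp_def, hgdef] using h2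
  have hcont : ContinuousOn (fun t : ℝ => g (scaleFst 𝕜 V t v)) (Set.uIcc 0 1) := by
    intro t ht
    rw [Set.uIcc_of_le zero_le_one] at ht
    have h3 : ContinuousAt (fun t : ℝ => scaleFst 𝕜 V t v) t :=
      (continuous_scaleFst.clm_apply continuous_const).continuousAt
    exact (ContinuousAt.comp (f := fun t : ℝ => scaleFst 𝕜 V t v)
      (hball _ (hmem t ht)).2.continuousAt h3).continuousWithinAt
  have h4 := intervalIntegral.integral_eq_sub_of_hasDerivAt h1
    (hcont.const_smul v.1).intervalIntegrable
  rw [intervalIntegral.integral_smul] at h4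
  rw [h4]
  simp [scaleFst_apply]

/-- An analytic function of `(ε, x)` that is `O(|ε|ᵐ)` for each `x` near `0` is divisible by
`εᵐ`. -/
theorem exists_analyticAt_eq_pow_smul {f : 𝕜 × V → W} (hf : AnalyticAt 𝕜 f 0) (m : ℕ)
    (h : ∀ᶠ x in 𝓝 (0 : V), (fun ε : 𝕜 => f (ε, x)) =O[𝓝 0] fun ε => ε ^ m) :
    ∃ ψ : 𝕜 × V → W, AnalyticAt 𝕜 ψ 0 ∧ ∀ᶠ v in 𝓝 (0 : 𝕜 × V), f v = v.1 ^ m • ψ v := by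
  induction m with
  | zero => exact ⟨f, hf, by simp⟩
  | succ m ih =>
    obtain ⟨ψ, hψ, hfψ⟩ := ih (h.mono fun x hx => hx.trans
      (IsBigO.of_bound 1 (by
        filter_upwards [Metric.ball_mem_nhds (0 : 𝕜) one_pos] with ε hε
        rw [mem_ball_zero_iff] at hε
        rw [pow_succ, norm_mul, one_mul]
        exact mul_le_of_le_one_right (norm_nonneg _) hε.le)))
    obtain ⟨χ, hχ, hψχ⟩ := exists_analyticAt_sub_eq_smul hψ
    have h0 : ∀ᶠ x in 𝓝 (0 : V), ψ (0, x) = 0 := by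
      have e1 : ∀ᶠ x in 𝓝 (0 : V), ∀ᶠ ε in 𝓝 (0 : 𝕜), f (ε, x) = ε ^ m • ψ (ε, x) := by
        have : 𝓝 (0 : 𝕜 × V) = 𝓝 (0 : 𝕜) ×ˢ 𝓝 (0 : V) := nhds_prod_eq
        rw [this] at hfψ
        exact (Filter.eventually_swap_iff.mp hfψ).curry
      have e2 : ∀ᶠ x in 𝓝 (0 : V), ContinuousAt ψ (0, x) := by
        have : Tendsto (fun x : V => ((0 : 𝕜), x)) (𝓝 0) (𝓝 0) := by
          have h5 : Continuous fun x : V => ((0 : 𝕜), x) := by fun_prop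
          exact h5.tendsto' 0 0 rfl
        exact (this.eventually hψ.eventually_analyticAt).mono fun x hx => hx.continuousAt
      filter_upwards [h, e1, e2] with x hx hx1 hx2
      have t1 : Tendsto (fun ε : 𝕜 => ψ (ε, x)) (𝓝[≠] 0) (𝓝 (ψ (0, x))) := by
        have : ContinuousAt (fun ε : 𝕜 => ψ (ε, x)) 0 :=
          ContinuousAt.comp (f := fun ε : 𝕜 => (ε, x)) hx2 (by fun_prop)
        exact this.tendsto.mono_left nhdsWithin_le_nhds
      refine tendsto_nhds_unique t1 ?_
      obtain ⟨C, hC⟩ := hx.bound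
      refine squeeze_zero_norm' (a := fun ε : 𝕜 => C * ‖ε‖) ?_ ?_
      · filter_upwards [self_mem_nhdsWithin, nhdsWithin_le_nhds hC, nhdsWithin_le_nhds hx1]
          with ε hε h1 h2
        rw [h2, norm_smul, norm_pow, norm_pow, pow_succ] at h1
        have : 0 < ‖ε‖ ^ m := pow_pos (norm_pos_iff.mpr hε) m
        refine le_of_mul_le_mul_left ?_ this
        linarith
      · have : Tendsto (fun ε : 𝕜 => C * ‖ε‖) (𝓝 0) (𝓝 (C * ‖(0 : 𝕜)‖)) :=
          (Continuous.tendsto (by fun_prop) 0)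
        simpa using this.mono_left nhdsWithin_le_nhds
    refine ⟨χ, hχ, ?_⟩
    have h0' : ∀ᶠ v in 𝓝 (0 : 𝕜 × V), ψ (0, v.2) = 0 :=
      (continuous_snd.tendsto' (0 : 𝕜 × V) 0 rfl).eventually h0
    filter_upwards [hfψ, hψχ, h0'] with v h1 h2 h3
    rw [h3, sub_zero] at h2
    rw [h1, h2, smul_smul, pow_succ]

end Division
end UndeterminedCoefficients

/-! ### Order of vanishing along polynomial curves -/

namespace UndeterminedCoefficients

section OneVariable

variable {𝕜 : Type*} [RCLike 𝕜] {W : Type*} [NormedAddCommGroup W] [NormedSpace 𝕜 W]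

theorem isBigO_pow_pow {m n : ℕ} (h : m ≤ n) :
    (fun ε : 𝕜 => ε ^ n) =O[𝓝 0] fun ε => ε ^ m := by
  refine IsBigO.of_bound 1 ?_
  filter_upwards [Metric.ball_mem_nhds (0 : 𝕜) one_pos] with ε hε
  rw [mem_ball_zero_iff] at hε
  rw [norm_pow, norm_pow, one_mul]
  exact pow_le_pow_of_le_one (norm_nonneg _) hε.le h

theorem isBigO_pow_smul (m : ℕ) {f : 𝕜 → W} (hf : ContinuousAt f 0) :
    (fun ε : 𝕜 => ε ^ m • f ε) =O[𝓝 0] fun ε => ε ^ m := by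
  simpa using (isBigO_refl (fun ε : 𝕜 => ε ^ m) (𝓝 0)).smul (hf.isBigO_one 𝕜)

/-- For an analytic function of one variable, the order of vanishing in terms of derivatives. -/
theorem isBigO_pow_iff_iteratedDeriv_eq_zero [CompleteSpace W] {f : 𝕜 → W}
    (hf : AnalyticAt 𝕜 f 0) (m : ℕ) :
    (f =O[𝓝 0] fun ε => ε ^ m) ↔ ∀ i < m, iteratedDeriv i f 0 = 0 := by
  rw [← natCast_le_analyticOrderAt_iff_iteratedDeriv_eq_zero hf, natCast_le_analyticOrderAt hf]
  constructor
  · intro h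
    have hf' : AnalyticAt 𝕜 (fun v : 𝕜 × 𝕜 => f v.1) 0 :=
      AnalyticAt.fun_comp (f := Prod.fst) hf analyticAt_fst
    obtain ⟨ψ, hψ, hfψ⟩ := exists_analyticAt_eq_pow_smul hf' m (Eventually.of_forall fun _ => h)
    refine ⟨fun ε => ψ (ε, 0), ?_, ?_⟩
    · exact AnalyticAt.fun_comp (f := fun ε : 𝕜 => (ε, (0 : 𝕜))) hψ
        (analyticAt_id.prod analyticAt_const)
    · have : Tendsto (fun ε : 𝕜 => (ε, (0 : 𝕜))) (𝓝 0) (𝓝 0) :=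
        Continuous.tendsto' (by fun_prop) _ _ rfl
      simpa using this.eventually hfψ
  · rintro ⟨g, hg, hfg⟩
    refine (isBigO_pow_smul m hg.continuousAt).congr' ?_ EventuallyEq.rfl
    filter_upwards [hfg] with ε h
    simpa using h.symm

theorem analyticAt_sum_pow_smul (n : ℕ) (a : ℕ → W) :
    AnalyticAt 𝕜 (fun ε : 𝕜 => ∑ j ∈ Finset.range n, ε ^ j • a j) 0 := by
  refine Finset.analyticAt_fun_sum _ fun j _ => ?_
  exact (analyticAt_id.pow j).smul analyticAt_const

theorem iteratedDeriv_sum_pow_smul [CompleteSpace W] (n : ℕ) (a : ℕ → W) (i : ℕ) :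
    iteratedDeriv i (fun ε : 𝕜 => ∑ j ∈ Finset.range n, ε ^ j • a j) 0
      = if i < n then (i ! : 𝕜) • a i else 0 := by
  induction n with
  | zero => simp
  | succ n ih =>
    simp only [Finset.sum_range_succ]
    rw [iteratedDeriv_fun_add (analyticAt_sum_pow_smul n a).contDiffAt (by fun_prop), ih,
      iteratedDeriv_smul_const (by fun_prop), iteratedDeriv_fun_pow_zero]
    rcases lt_trichotomy i n with h | h | h
    · rw [if_pos h, if_pos (Nat.lt_succ_of_lt h), if_neg h.ne]; simp
    · subst h; simp
    · rw [if_neg h.not_gt, if_neg h.ne', if_neg (by omega)]; simp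

theorem isBigO_sub_sum_iff [CompleteSpace W] {f : 𝕜 → W} (hf : AnalyticAt 𝕜 f 0) (n : ℕ)
    (a : ℕ → W) :
    ((fun ε => f ε - ∑ j ∈ Finset.range n, ε ^ j • a j) =O[𝓝 0] fun ε => ε ^ n) ↔
      ∀ j < n, (j ! : 𝕜)⁻¹ • iteratedDeriv j f 0 = a j := by
  rw [isBigO_pow_iff_iteratedDeriv_eq_zero (hf.fun_sub (analyticAt_sum_pow_smul n a))]
  refine forall₂_congr fun j hj => ?_
  rw [iteratedDeriv_fun_sub hf.contDiffAt (analyticAt_sum_pow_smul n a).contDiffAt,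
    iteratedDeriv_sum_pow_smul, if_pos hj, sub_eq_zero,
    inv_smul_eq_iff₀ (Nat.cast_ne_zero.mpr j.factorial_ne_zero)]

end OneVariable

section Analytic

variable {𝕜 : Type*} [RCLike 𝕜]
  {B : Type*} [NormedAddCommGroup B] [NormedSpace 𝕜 B]
  {F : Type*} [NormedAddCommGroup F] [NormedSpace 𝕜 F]

theorem AnalyticAt.isBigO_comp_sub_comp [CompleteSpace F] {f : B → F} {x : B}
    (hf : AnalyticAt 𝕜 f x)
    {α : Type*} {l : Filter α} {u v : α → B} (hu : Tendsto u l (𝓝 x)) (hv : Tendsto v l (𝓝 x)) :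
    (fun a => f (u a) - f (v a)) =O[l] fun a => u a - v a :=
  hf.hasStrictFDerivAt.isBigO_sub.comp_tendsto (hu.prodMk_nhds hv)

theorem curve_eq_sum (n : ℕ) (z : ℕ → B) (ε : 𝕜) :
    curve n z ε = ∑ i ∈ Finset.Icc 1 n, ε ^ i • ((i ! : 𝕜)⁻¹ • z i) := by
  simp only [curve, smul_smul, div_eq_mul_inv]

theorem analyticAt_curve (n : ℕ) (z : ℕ → B) (ε : 𝕜) :
    AnalyticAt 𝕜 (fun ε : 𝕜 => curve n z ε) ε := by
  simp only [curve_eq_sum]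
  refine Finset.analyticAt_fun_sum _ fun j _ => ?_
  exact (analyticAt_id.pow j).smul analyticAt_const

theorem curve_zero (n : ℕ) (z : ℕ → B) : curve n z (0 : 𝕜) = 0 := by
  refine Finset.sum_eq_zero fun i hi => ?_
  have : i ≠ 0 := by have := (Finset.mem_Icc.mp hi).1; omega
  simp [this]

theorem tendsto_curve (n : ℕ) (z : ℕ → B) :
    Tendsto (fun ε : 𝕜 => curve n z ε) (𝓝 0) (𝓝 0) := by
  simpa [curve_zero] using (analyticAt_curve n z (0 : 𝕜)).continuousAt.tendsto

theorem isBigO_sum_pow_smul (s : Finset ℕ) (m : ℕ) (hs : ∀ i ∈ s, m ≤ i) (a : ℕ → B) :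
    (fun ε : 𝕜 => ∑ i ∈ s, ε ^ i • a i) =O[𝓝 0] fun ε => ε ^ m :=
  IsBigO.fun_sum fun i hi => (isBigO_pow_smul i (f := fun _ => a i) continuousAt_const).trans
    (isBigO_pow_pow (hs i hi))

theorem isBigO_curve (n : ℕ) (z : ℕ → B) :
    (fun ε : 𝕜 => curve n z ε) =O[𝓝 0] fun ε => ε := by
  simpa [curve_eq_sum] using isBigO_sum_pow_smul (𝕜 := 𝕜) (Finset.Icc 1 n) 1
    (fun i hi => (Finset.mem_Icc.mp hi).1) fun i => (i ! : 𝕜)⁻¹ • z i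

theorem isBigO_curve_sub_curve {m n N : ℕ} (hm : m ≤ n) (hN : m ≤ N) {z z' : ℕ → B}
    (h : ∀ i, 1 ≤ i → i ≤ m → z i = z' i) :
    (fun ε : 𝕜 => curve N z ε - curve n z' ε) =O[𝓝 0] fun ε => ε ^ (m + 1) := by
  have key : ∀ (n : ℕ) (z : ℕ → B), m ≤ n → ∀ ε : 𝕜, curve n z ε
      = curve m z ε + ∑ i ∈ Finset.Icc (m + 1) n, ε ^ i • ((i ! : 𝕜)⁻¹ • z i) := by
    intro n z hn ε
    rw [curve_eq_sum, curve_eq_sum, ← Finset.sum_union]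
    · congr 1
      ext i; simp only [Finset.mem_Icc, Finset.mem_union]; omega
    · rw [Finset.disjoint_left]; intro i; simp only [Finset.mem_Icc]; omega
  have hmm : ∀ ε : 𝕜, curve m z ε = curve m z' ε := fun ε =>
    Finset.sum_congr rfl fun i hi => by
      rw [h i (Finset.mem_Icc.mp hi).1 (Finset.mem_Icc.mp hi).2]
  have e : ∀ ε : 𝕜, curve N z ε - curve n z' ε
      = (∑ i ∈ Finset.Icc (m + 1) N, ε ^ i • ((i ! : 𝕜)⁻¹ • z i))
        - ∑ i ∈ Finset.Icc (m + 1) n, ε ^ i • ((i ! : 𝕜)⁻¹ • z' i) := by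
    intro ε
    rw [key N z hN, key n z' hm, hmm]; abel
  simp only [e]
  exact (isBigO_sum_pow_smul _ _ (fun i hi => (Finset.mem_Icc.mp hi).1) _).sub
    (isBigO_sum_pow_smul _ _ (fun i hi => (Finset.mem_Icc.mp hi).1) _)

theorem analyticAt_comp_curve {G : B → F} (hG : AnalyticAt 𝕜 G 0) (n : ℕ) (z : ℕ → B) :
    AnalyticAt 𝕜 (fun ε : 𝕜 => G (curve n z ε)) 0 :=
  AnalyticAt.fun_comp (f := fun ε : 𝕜 => curve n z ε) (by rw [curve_zero]; exact hG)
    (analyticAt_curve n z 0)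

/-- A tuple belongs to `X_n` iff `G` vanishes to order `n` along its curve; further coefficients
do not matter. -/
theorem mem_X_iff [CompleteSpace F] {G : B → F} (hG : AnalyticAt 𝕜 G 0) (hG0 : G 0 = 0) {n N : ℕ}
    (hnN : n ≤ N) (z : ℕ → B) :
    z ∈ X 𝕜 G n ↔ (fun ε : 𝕜 => G (curve N z ε)) =O[𝓝 0] fun ε => ε ^ (n + 1) := by
  rw [isBigO_pow_iff_iteratedDeriv_eq_zero (analyticAt_comp_curve hG N z)]
  have hT : ∀ m ≤ n, T 𝕜 G m z = iteratedDeriv m (fun ε : 𝕜 => G (curve N z ε)) 0 := by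
    intro m hm
    have hO : (fun ε : 𝕜 => G (curve m z ε) - G (curve N z ε)) =O[𝓝 0] fun ε => ε ^ (m + 1) :=
      (AnalyticAt.isBigO_comp_sub_comp hG (tendsto_curve m z) (tendsto_curve N z)).trans
        (isBigO_curve_sub_curve (by omega) (by omega) fun _ _ _ => rfl)
    have h1 := (isBigO_pow_iff_iteratedDeriv_eq_zero
      ((analyticAt_comp_curve hG m z).fun_sub (analyticAt_comp_curve hG N z)) (m + 1)).mp hO m
      (by omega)
    rw [iteratedDeriv_fun_sub (analyticAt_comp_curve hG m z).contDiffAt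
      (analyticAt_comp_curve hG N z).contDiffAt, sub_eq_zero] at h1
    exact h1
  constructor
  · intro h i hi
    rcases Nat.eq_zero_or_pos i with rfl | hi0
    · simp [curve_zero, hG0]
    · rw [← hT i (by omega)]; exact h i hi0 (by omega)
  · intro h m _ hm
    rw [hT m hm]; exact h m (by omega)

theorem isBigO_fderiv_curve_sub_sum [CompleteSpace F] {G : B → F} (hG : AnalyticAt 𝕜 G 0) (k : ℕ)
    (zbar : ℕ → B) (n : ℕ) :
    (fun ε : 𝕜 => fderiv 𝕜 G (curve k zbar ε)
      - ∑ j ∈ Finset.range n, ε ^ j • linCoeff 𝕜 G k zbar j) =O[𝓝 0] fun ε => ε ^ n :=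
  (isBigO_sub_sum_iff (analyticAt_comp_curve hG.fderiv k zbar) n _).mpr fun _ _ => rfl

/-- The operators `A_j`, `j < n`, are determined by any polynomial that approximates `G'` along the
curve up to `O(εⁿ)`. -/
theorem linCoeff_eq_of_isBigO [CompleteSpace F] {G : B → F} (hG : AnalyticAt 𝕜 G 0) {k : ℕ}
    {zbar : ℕ → B} {n : ℕ} {a : ℕ → B →L[𝕜] F}
    (h : (fun ε : 𝕜 => fderiv 𝕜 G (curve k zbar ε)
      - ∑ j ∈ Finset.range n, ε ^ j • a j) =O[𝓝 0] fun ε => ε ^ n) :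
    ∀ j < n, linCoeff 𝕜 G k zbar j = a j :=
  (isBigO_sub_sum_iff (analyticAt_comp_curve hG.fderiv k zbar) n _).mp h

omit [NormedSpace 𝕜 B] [NormedSpace 𝕜 F] in
theorem isBigO_norm_pow_comp {H : B → F} {m : ℕ} (hH : H =O[𝓝 0] fun z => ‖z‖ ^ m)
    {u : 𝕜 → B} (hu : Tendsto u (𝓝 0) (𝓝 0)) (hu' : u =O[𝓝 0] fun ε => ε) :
    (fun ε => H (u ε)) =O[𝓝 0] fun ε => ε ^ m :=
  (hH.comp_tendsto hu).trans (hu'.norm_left.pow m)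

/-- The derivative of an analytic function of order `m + 1` is of order `m`: the function
`H[s x] / s^{m+1}` is analytic in `(s, x)` near `(0, 0)`, and `H'[s x] = sᵐ ∂ₓ(H[s x] / s^{m+1})`. -/
theorem isBigO_fderiv [CompleteSpace F] {H : B → F} (hH : AnalyticAt 𝕜 H 0) {m : ℕ}
    (hO : H =O[𝓝 0] fun z => ‖z‖ ^ (m + 1)) : fderiv 𝕜 H =O[𝓝 0] fun z => ‖z‖ ^ m := by
  have ha : AnalyticAt 𝕜 (fun v : 𝕜 × B => H (v.1 • v.2)) 0 :=
    AnalyticAt.fun_comp (f := fun v : 𝕜 × B => v.1 • v.2) (by simpa using hH)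
      (analyticAt_fst.smul analyticAt_snd)
  obtain ⟨ψ, hψ, hfψ⟩ := exists_analyticAt_eq_pow_smul ha (m + 1) (Eventually.of_forall fun x => by
    refine isBigO_norm_pow_comp hO (u := fun ε : 𝕜 => ε • x)
      (Continuous.tendsto' (by fun_prop) _ _ (by simp)) ?_
    simpa using isBigO_pow_smul 1 (f := fun _ : 𝕜 => x) continuousAt_const)
  have hψ' : AnalyticAt 𝕜 (fun v => fderiv 𝕜 ψ v ∘L ContinuousLinearMap.inr 𝕜 𝕜 B) 0 :=
    ((ContinuousLinearMap.compL 𝕜 B (𝕜 × B) F).flip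
      (ContinuousLinearMap.inr 𝕜 𝕜 B)).analyticAt _ |>.comp hψ.fderiv
  obtain ⟨C, hC⟩ := (hψ'.continuousAt.isBigO_one 𝕜).bound
  obtain ⟨δ, hδ, hb⟩ := Metric.eventually_nhds_iff_ball.mp
    ((hfψ.eventually_nhds.and hψ.eventually_analyticAt).and hC)
  obtain ⟨δ', hδ', hb'⟩ := Metric.eventually_nhds_iff_ball.mp hH.eventually_analyticAt
  set ρ := δ / 2 with hρ
  have hρ0 : 0 < ρ := by positivity
  have key : ∀ z : B, z ≠ 0 → ‖z‖ < ρ ^ 2 → ‖z‖ < δ' →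
      ‖fderiv 𝕜 H z‖ ≤ (C / ρ ^ m) * ‖z‖ ^ m := by
    intro z hz hzδ hzδ'
    have hz0 : 0 < ‖z‖ := norm_pos_iff.mpr hz
    set s : 𝕜 := ((‖z‖ / ρ : ℝ) : 𝕜) with hs
    have hs0 : s ≠ 0 := by
      rw [hs]; exact RCLike.ofReal_ne_zero.mpr (by positivity)
    have hsn : ‖s‖ = ‖z‖ / ρ := by
      rw [hs, RCLike.norm_ofReal, abs_of_nonneg (by positivity)]
    have hx : s • (s⁻¹ • z) = z := smul_inv_smul₀ hs0 z
    have hxn : ‖s⁻¹ • z‖ = ρ := by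
      rw [norm_smul, norm_inv, hsn]; field_simp
    have hmem : (s, s⁻¹ • z) ∈ ball (0 : 𝕜 × B) δ := by
      rw [mem_ball_zero_iff, Prod.norm_def, hxn, hsn, max_lt_iff]
      refine ⟨?_, by rw [hρ]; linarith⟩
      rw [div_lt_iff₀ hρ0]
      nlinarith
    obtain ⟨⟨h1, h2⟩, h3⟩ := hb _ hmem
    set x := s⁻¹ • z with hxdef
    have hinc : HasFDerivAt (fun y : B => ((s, y) : 𝕜 × B)) (ContinuousLinearMap.inr 𝕜 𝕜 B) x :=
      (hasFDerivAt_const s x).prodMk (hasFDerivAt_id x)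
    have d1 : HasFDerivAt (fun y : B => H (s • y)) (s • fderiv 𝕜 H z) x := by
      have hHz : HasFDerivAt H (fderiv 𝕜 H z) (s • x) := by
        rw [hx]
        exact (hb' z (by simpa using hzδ')).differentiableAt.hasFDerivAt
      refine (hHz.comp x ((hasFDerivAt_id x).const_smul s)).congr_fderiv ?_
      ext y; simp
    have d2 : HasFDerivAt (fun y : B => s ^ (m + 1) • ψ (s, y))
        (s ^ (m + 1) • (fderiv 𝕜 ψ (s, x) ∘L ContinuousLinearMap.inr 𝕜 𝕜 B)) x :=
      ((h2.differentiableAt.hasFDerivAt).comp x hinc).const_smul _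
    have e : (fun y : B => H (s • y)) =ᶠ[𝓝 x] fun y => s ^ (m + 1) • ψ (s, y) := by
      have ht : Tendsto (fun y : B => ((s, y) : 𝕜 × B)) (𝓝 x) (𝓝 (s, x)) := hinc.continuousAt
      exact ht.eventually h1
    have e2 := d1.unique (d2.congr_of_eventuallyEq e)
    have e3 : fderiv 𝕜 H z
        = s ^ m • (fderiv 𝕜 ψ (s, x) ∘L ContinuousLinearMap.inr 𝕜 𝕜 B) := by
      rw [pow_succ', mul_smul] at e2
      exact smul_right_injective _ hs0 e2
    rw [e3, norm_smul, norm_pow, hsn, div_pow]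
    simp only [norm_one, mul_one] at h3
    calc ‖z‖ ^ m / ρ ^ m * _ ≤ ‖z‖ ^ m / ρ ^ m * C := by gcongr
      _ = _ := by ring
  have hne : ∀ᶠ z in 𝓝[≠] (0 : B), ‖fderiv 𝕜 H z‖ ≤ (C / ρ ^ m) * ‖z‖ ^ m := by
    have h5 : ∀ᶠ z in 𝓝 (0 : B), ‖z‖ < min (ρ ^ 2) δ' := by
      filter_upwards [Metric.ball_mem_nhds (0 : B) (ε := min (ρ ^ 2) δ') (by positivity)] with z hz
      exact mem_ball_zero_iff.mp hz
    filter_upwards [self_mem_nhdsWithin, nhdsWithin_le_nhds h5] with z hz hz'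
    exact key z hz (hz'.trans_le (min_le_left _ _)) (hz'.trans_le (min_le_right _ _))
  refine IsBigO.of_bound (C / ρ ^ m) ?_
  by_cases hbot : (𝓝[≠] (0 : B)) = ⊥
  · -- `B` is trivial
    have hsub : ∀ z : B, z = 0 := by
      intro z
      by_contra hz
      have : NeBot (𝓝[≠] (0 : B)) := by
        have : Nontrivial B := ⟨z, 0, hz⟩
        exact Module.punctured_nhds_neBot 𝕜 B 0
      exact this.ne hbot
    have : Subsingleton B := ⟨fun a b => by rw [hsub a, hsub b]⟩
    have h0 : ∀ z, fderiv 𝕜 H z = 0 := fun z => by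
      ext y; rw [hsub y]; simp
    refine Eventually.of_forall fun z => ?_
    rw [h0, norm_zero]
    have : 0 ≤ C := by
      have := hC.self_of_nhds
      simp only [norm_one, mul_one] at this
      exact (norm_nonneg _).trans this
    positivity
  · have hbot' : NeBot (𝓝[≠] (0 : B)) := ⟨hbot⟩
    have h0 : ‖fderiv 𝕜 H 0‖ ≤ (C / ρ ^ m) * ‖‖(0 : B)‖ ^ m‖ := by
      have t1 : Tendsto (fun z => ‖fderiv 𝕜 H z‖) (𝓝[≠] 0) (𝓝 ‖fderiv 𝕜 H 0‖) :=
        hH.fderiv.continuousAt.norm.tendsto.mono_left nhdsWithin_le_nhds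
      have t2 : Tendsto (fun z : B => (C / ρ ^ m) * ‖‖z‖ ^ m‖) (𝓝[≠] 0)
          (𝓝 ((C / ρ ^ m) * ‖‖(0 : B)‖ ^ m‖)) :=
        (Continuous.tendsto (by fun_prop) 0).mono_left nhdsWithin_le_nhds
      refine le_of_tendsto_of_tendsto t1 t2 ?_
      filter_upwards [hne] with z hz
      simpa using hz
    have hne' := eventually_nhdsWithin_iff.mp hne
    filter_upwards [hne'] with z hz
    rcases eq_or_ne z 0 with rfl | h
    · exact h0
    · simpa using hz h

/-- Second order Taylor expansion of `G + c H`, with a remainder that is analytic in all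
variables. -/
theorem exists_analyticAt_quadratic_remainder [CompleteSpace F] {G H : B → F}
    (hG : AnalyticAt 𝕜 G 0) (hH : AnalyticAt 𝕜 H 0) :
    ∃ L : 𝕜 × (𝕜 × B × B) → F, AnalyticAt 𝕜 L 0 ∧ ∀ᶠ v in 𝓝 (0 : 𝕜 × (𝕜 × B × B)),
      G (v.2.2.1 + v.1 • v.2.2.2) + v.2.1 • H (v.2.2.1 + v.1 • v.2.2.2)
        - (G v.2.2.1 + v.2.1 • H v.2.2.1)
        - v.1 • ((fderiv 𝕜 G v.2.2.1 + v.2.1 • fderiv 𝕜 H v.2.2.1) v.2.2.2)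
        = v.1 ^ 2 • L v := by
  have ha : ContDiffAt 𝕜 ω (fun v : 𝕜 × (𝕜 × B × B) => v.2.2.1) 0 := by fun_prop
  have hau : ContDiffAt 𝕜 ω (fun v : 𝕜 × (𝕜 × B × B) => v.2.2.1 + v.1 • v.2.2.2) 0 := by fun_prop
  have comp2 : ∀ {g : B → F}, AnalyticAt 𝕜 g 0 →
      ContDiffAt 𝕜 ω (fun v : 𝕜 × (𝕜 × B × B) => g (v.2.2.1 + v.1 • v.2.2.2)) 0 :=
    fun hg => ContDiffAt.fun_comp (f := fun v : 𝕜 × (𝕜 × B × B) => v.2.2.1 + v.1 • v.2.2.2) _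
      (by simpa using hg.contDiffAt) hau
  have comp1 : ∀ {g : B → F}, AnalyticAt 𝕜 g 0 →
      ContDiffAt 𝕜 ω (fun v : 𝕜 × (𝕜 × B × B) => g v.2.2.1) 0 :=
    fun hg => ContDiffAt.fun_comp (f := fun v : 𝕜 × (𝕜 × B × B) => v.2.2.1) _ hg.contDiffAt ha
  have comp3 : ∀ {g : B → F}, AnalyticAt 𝕜 g 0 →
      ContDiffAt 𝕜 ω (fun v : 𝕜 × (𝕜 × B × B) => fderiv 𝕜 g v.2.2.1) 0 :=
    fun hg => ContDiffAt.fun_comp (f := fun v : 𝕜 × (𝕜 × B × B) => v.2.2.1) _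
      hg.fderiv.contDiffAt ha
  refine exists_analyticAt_eq_pow_smul (V := 𝕜 × B × B) ?_ 2 ?_
  · have h1 := comp1 hG
    have h2 := comp1 hH
    have h3 := comp2 hG
    have h4 := comp2 hH
    have h5 := comp3 hG
    have h6 := comp3 hH
    have hs : ContDiffAt 𝕜 ω (fun v : 𝕜 × (𝕜 × B × B) => v.1) 0 := by fun_prop
    have hc : ContDiffAt 𝕜 ω (fun v : 𝕜 × (𝕜 × B × B) => v.2.1) 0 := by fun_prop
    have hu : ContDiffAt 𝕜 ω (fun v : 𝕜 × (𝕜 × B × B) => v.2.2.2) 0 := by fun_prop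
    exact (((h3.add (hc.smul h4)).sub (h1.add (hc.smul h2))).sub
      (hs.smul ((h5.add (hc.smul h6)).clm_apply hu))).analyticAt
  · have ht : Tendsto (fun x : 𝕜 × B × B => x.2.1) (𝓝 0) (𝓝 0) :=
      Continuous.tendsto' (by fun_prop) _ _ rfl
    filter_upwards [ht.eventually (hG.eventually_analyticAt.and hH.eventually_analyticAt)]
      with x hx
    obtain ⟨hGx, hHx⟩ := hx
    have hline : ContDiffAt 𝕜 ω (fun s : 𝕜 => x.2.1 + s • x.2.2) 0 := by fun_prop
    have h1 : ContDiffAt 𝕜 ω (fun s : 𝕜 => G (x.2.1 + s • x.2.2)) 0 :=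
      ContDiffAt.fun_comp (f := fun s : 𝕜 => x.2.1 + s • x.2.2) _
        (by simpa using hGx.contDiffAt) hline
    have h2 : ContDiffAt 𝕜 ω (fun s : 𝕜 => H (x.2.1 + s • x.2.2)) 0 :=
      ContDiffAt.fun_comp (f := fun s : 𝕜 => x.2.1 + s • x.2.2) _
        (by simpa using hHx.contDiffAt) hline
    have h3 : AnalyticAt 𝕜 (fun s : 𝕜 => G (x.2.1 + s • x.2.2) + x.1 • H (x.2.1 + s • x.2.2)
        - (G x.2.1 + x.1 • H x.2.1)
        - s • ((fderiv 𝕜 G x.2.1 + x.1 • fderiv 𝕜 H x.2.1) x.2.2)) 0 :=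
      (((h1.add (contDiffAt_const.smul h2)).sub contDiffAt_const).sub
        (contDiffAt_id.smul contDiffAt_const)).analyticAt
    rw [isBigO_pow_iff_iteratedDeriv_eq_zero h3]
    have hdl : HasDerivAt (fun s : 𝕜 => x.2.1 + s • x.2.2) x.2.2 0 := by
      simpa using ((hasDerivAt_id (0 : 𝕜)).smul_const x.2.2).const_add x.2.1
    have hd : ∀ {g : B → F}, AnalyticAt 𝕜 g x.2.1 →
        HasDerivAt (fun s : 𝕜 => g (x.2.1 + s • x.2.2)) (fderiv 𝕜 g x.2.1 x.2.2) 0 := by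
      intro g hg
      exact HasFDerivAt.comp_hasDerivAt_of_eq (0 : 𝕜) hg.differentiableAt.hasFDerivAt hdl (by simp)
    intro i hi
    interval_cases i
    · simp
    · rw [iteratedDeriv_one]
      have := (((hd hGx).add ((hd hHx).const_smul x.1)).sub_const
        (G x.2.1 + x.1 • H x.2.1)).sub ((hasDerivAt_id (0 : 𝕜)).smul_const
          ((fderiv 𝕜 G x.2.1 + x.1 • fderiv 𝕜 H x.2.1) x.2.2))
      refine HasDerivAt.deriv (this.congr_deriv ?_)
      simp

end Analytic
end UndeterminedCoefficients

/-! ### Fixed points depending smoothly on parameters -/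

namespace UndeterminedCoefficients

section FixedPoint

variable {𝕜 : Type*} [RCLike 𝕜]
  {P : Type*} [NormedAddCommGroup P] [NormedSpace 𝕜 P] [CompleteSpace P]
  {E : Type*} [NormedAddCommGroup E] [NormedSpace 𝕜 E] [CompleteSpace E]

omit [CompleteSpace P] in
/-- The bound by `1 / 2` keeps the iteration in the closed ball of radius `1 / 2`, so that the
contraction principle applies although the unit ball is not complete. -/
theorem exists_unique_fixedPoint {g : E → E} (hb : ∀ y ∈ ball (0 : E) 1, ‖g y‖ ≤ 1 / 2)
    (hl : ∀ y ∈ ball (0 : E) 1, ∀ y' ∈ ball (0 : E) 1, ‖g y - g y'‖ ≤ 1 / 2 * ‖y - y'‖) :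
    ∃ y₀ ∈ ball (0 : E) 1, ∀ y ∈ ball (0 : E) 1, g y = y ↔ y = y₀ := by
  have hsub : closedBall (0 : E) (1 / 2) ⊆ ball 0 1 := closedBall_subset_ball (by norm_num)
  have hmaps : Set.MapsTo g (closedBall 0 (1 / 2)) (closedBall 0 (1 / 2)) := fun y hy => by
    simpa using hb y (hsub hy)
  have hcontr : ContractingWith (1 / 2) (hmaps.restrict g _ _) := by
    refine ⟨by rw [← NNReal.coe_lt_coe]; norm_num,
      LipschitzWith.of_dist_le_mul fun y y' => ?_⟩
    have := hl y (hsub y.2) y' (hsub y'.2)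
    simpa [Subtype.dist_eq, dist_eq_norm] using this
  obtain ⟨y₀, hy₀, hfix, -, -⟩ := ContractingWith.exists_fixedPoint'
    (isClosed_closedBall.isComplete) hmaps hcontr (x := 0) (by simp) (edist_ne_top _ _)
  refine ⟨y₀, hsub hy₀, fun y hy => ⟨fun h => ?_, fun h => h ▸ hfix⟩⟩
  have := hl y hy y₀ (hsub hy₀)
  rw [h, hfix] at this
  have h0 : ‖y - y₀‖ = 0 := by linarith [norm_nonneg (y - y₀)]
  exact sub_eq_zero.mp (norm_eq_zero.mp h0)

/-- A uniformly contracting family of smooth maps of the unit ball has a smooth family of fixed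
points. -/
theorem exists_contDiffAt_fixedPoint {Ω : Set P} (hΩ : IsOpen Ω) {g : P × E → E}
    (hg : ∀ x ∈ Ω, ∀ y ∈ ball (0 : E) 1, ContDiffAt 𝕜 ∞ g (x, y))
    (hb : ∀ x ∈ Ω, ∀ y ∈ ball (0 : E) 1, ‖g (x, y)‖ ≤ 1 / 2)
    (hl : ∀ x ∈ Ω, ∀ y ∈ ball (0 : E) 1, ∀ y' ∈ ball (0 : E) 1,
      ‖g (x, y) - g (x, y')‖ ≤ 1 / 2 * ‖y - y'‖) :
    ∃ Y : P → E, ∀ x ∈ Ω, ContDiffAt 𝕜 ∞ Y x ∧ Y x ∈ ball (0 : E) 1 ∧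
      ∀ y ∈ ball (0 : E) 1, g (x, y) = y ↔ y = Y x := by
  have h1 : ∀ x : P, ∃ y₀ : E, x ∈ Ω →
      y₀ ∈ ball (0 : E) 1 ∧ ∀ y ∈ ball (0 : E) 1, g (x, y) = y ↔ y = y₀ := by
    intro x
    by_cases hx : x ∈ Ω
    · obtain ⟨y₀, h⟩ := exists_unique_fixedPoint (hb x hx) (hl x hx)
      exact ⟨y₀, fun _ => h⟩
    · exact ⟨0, fun h => absurd h hx⟩
  choose Y hY using h1
  refine ⟨Y, fun x hx => ⟨?_, hY x hx⟩⟩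
  obtain ⟨hYb, hYu⟩ := hY x hx
  have hfix : g (x, Y x) = Y x := (hYu _ hYb).mpr rfl
  set f : P × E → E := fun u => u.2 - g u with hf
  have hgc : ContDiffAt 𝕜 ∞ g (x, Y x) := hg x hx _ hYb
  have hfc : ContDiffAt 𝕜 ∞ f (x, Y x) := contDiffAt_snd.sub hgc
  have hgd : HasFDerivAt g (fderiv 𝕜 g (x, Y x)) (x, Y x) :=
    (hgc.differentiableAt (by simp)).hasFDerivAt
  set T := fderiv 𝕜 g (x, Y x) ∘L ContinuousLinearMap.inr 𝕜 P E with hT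
  have hTn : ‖T‖ ≤ 1 / 2 := by
    have hd : HasFDerivAt (fun y => g (x, y)) T (Y x) :=
      hgd.comp (Y x) ((hasFDerivAt_const x _).prodMk (hasFDerivAt_id _))
    have := hd.le_of_lipschitzOn (s := ball 0 1) (isOpen_ball.mem_nhds hYb) (C := 1 / 2)
      (LipschitzOnWith.of_dist_le_mul fun y hy y' hy' => by
        simpa [dist_eq_norm] using hl x hx y hy y' hy')
    simpa using this
  have hfd : fderiv 𝕜 f (x, Y x) ∘L ContinuousLinearMap.inr 𝕜 P E = 1 - T := by
    have : HasFDerivAt f (ContinuousLinearMap.snd 𝕜 P E - fderiv 𝕜 g (x, Y x)) (x, Y x) :=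
      hasFDerivAt_snd.sub hgd
    rw [this.fderiv]
    ext y; simp [hT]
  have hinv : (fderiv 𝕜 f (x, Y x) ∘L ContinuousLinearMap.inr 𝕜 P E).IsInvertible := by
    rw [hfd]
    exact ⟨ContinuousLinearEquiv.ofUnit (Units.oneSub T (by linarith)), rfl⟩
  have hfu : f (x, Y x) = 0 := by rw [hf]; simp [hfix]
  set ψ := hfc.implicitFunction (by simp) hinv
  have hψc : ContDiffAt 𝕜 ∞ ψ x := hfc.contDiffAt_implicitFunction (by simp) hinv
  have hψx : ψ x = Y x := hfc.implicitFunction_apply_self (by simp) hinv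
  refine hψc.congr_of_eventuallyEq ?_
  have e1 := hfc.eventually_apply_implicitFunction (by simp) hinv
  have e2 : ∀ᶠ x' in 𝓝 x, ψ x' ∈ ball (0 : E) 1 :=
    hψc.continuousAt.eventually_mem (by rw [hψx]; exact isOpen_ball.mem_nhds hYb)
  filter_upwards [e1, e2, hΩ.mem_nhds hx] with x' h1 h2 h3
  refine (((hY x' h3).2 _ h2).mp ?_).symm
  rw [hfu] at h1
  exact (sub_eq_zero.mp h1).symm

end FixedPoint
end UndeterminedCoefficients

/-! ### Lifts, and the isomorphism given by their leading coefficients -/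

namespace UndeterminedCoefficients

variable {𝕜 : Type*} [RCLike 𝕜]
  {B : Type*} [NormedAddCommGroup B] [NormedSpace 𝕜 B]
  {F : Type*} [NormedAddCommGroup F] [NormedSpace 𝕜 F]

section ProdCoeff

variable (A : ℕ → B →L[𝕜] F)

theorem prodCoeff_add (m : ℕ) (v w : ℕ → B) :
    prodCoeff A m (fun j => v j + w j) = prodCoeff A m v + prodCoeff A m w := by
  simp only [prodCoeff, map_add, Finset.sum_add_distrib]

theorem prodCoeff_sub (m : ℕ) (v w : ℕ → B) :
    prodCoeff A m (fun j => v j - w j) = prodCoeff A m v - prodCoeff A m w := by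
  simp only [prodCoeff, map_sub, Finset.sum_sub_distrib]

theorem prodCoeff_sum {ι : Type*} (s : Finset ι) (m : ℕ) (v : ι → ℕ → B) :
    prodCoeff A m (fun j => ∑ i ∈ s, v i j) = ∑ i ∈ s, prodCoeff A m (v i) := by
  simp only [prodCoeff, map_sum]
  rw [Finset.sum_comm]

/-- Multiplication of `∑ v_j εʲ` by `εˢ` shifts the coefficients of the product. -/
theorem prodCoeff_shift (s l : ℕ) (v : ℕ → B) :
    prodCoeff A l (fun j => if s ≤ j then v (j - s) else 0)
      = if s ≤ l then prodCoeff A (l - s) v else 0 := by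
  unfold prodCoeff
  split_ifs with h
  · rw [← Finset.sum_subset (s₁ := Finset.range (l - s + 1))]
    · refine Finset.sum_congr rfl fun j hj => ?_
      rw [Finset.mem_range] at hj
      beta_reduce
      rw [if_pos (by omega), show l - j - s = l - s - j by omega]
    · exact Finset.range_subset_range.mpr (by omega)
    · intro j hj' hj
      rw [Finset.mem_range] at hj hj'
      beta_reduce
      rw [if_neg (by omega), map_zero]
  · refine Finset.sum_eq_zero fun j _ => ?_
    beta_reduce
    rw [if_neg (by omega), map_zero]

/-- `prodCoeff` as a bounded operator in the value of a sequence of operators. -/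
def prodCoeffCLM (m : ℕ) (U : ℕ → B →L[𝕜] B) : B →L[𝕜] F :=
  ∑ j ∈ Finset.range (m + 1), A j ∘L U (m - j)

theorem prodCoeffCLM_apply (m : ℕ) (U : ℕ → B →L[𝕜] B) (b : B) :
    prodCoeffCLM A m U b = prodCoeff A m (fun j => U j b) := by
  simp [prodCoeffCLM, prodCoeff]

end ProdCoeff

namespace IterationData

variable {D : IterationData 𝕜 B F} {A : ℕ → B →L[𝕜] F} {k : ℕ}

theorem IsIteration.isClosed_N (hD : D.IsIteration A k) :
    ∀ m ≤ k + 1, IsClosed (D.N m : Set B) := by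
  intro m
  induction m with
  | zero => intro _; rw [hD.N_zero]; exact isClosed_univ
  | succ m ih =>
    intro hm
    rw [hD.N_succ m (by omega)]
    have h1 : IsClosed ((LinearMap.ker (D.S m : D.N m →ₗ[𝕜] D.Rc m) : Submodule 𝕜 (D.N m)) :
        Set (D.N m)) := (D.S m).isClosed_ker
    exact (ih (by omega)).isClosedEmbedding_subtypeVal.isClosedMap _ h1

theorem IsIteration.isClosed_Rc (hD : D.IsIteration A k) :
    ∀ m ≤ k + 1, IsClosed (D.Rc m : Set F) := by
  intro m hm
  rcases m with _ | m
  · rw [hD.Rc_zero]; exact isClosed_univ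
  · exact hD.Rc_closed m (by omega)

theorem IsIteration.N_succ_le (hD : D.IsIteration A k) {m : ℕ} (hm : m ≤ k) :
    D.N (m + 1) ≤ D.N m := (hD.N_sup m hm) ▸ le_sup_right

theorem IsIteration.Nc_succ_le (hD : D.IsIteration A k) {m : ℕ} (hm : m ≤ k) :
    D.Nc (m + 1) ≤ D.N m := (hD.N_sup m hm) ▸ le_sup_left

theorem IsIteration.Rc_succ_le (hD : D.IsIteration A k) {m : ℕ} (hm : m ≤ k) :
    D.Rc (m + 1) ≤ D.Rc m := (hD.R_sup m hm) ▸ le_sup_right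

theorem RSum_mono (D : IterationData 𝕜 B F) {m n : ℕ} (h : m ≤ n) : D.RSum m ≤ D.RSum n :=
  iSup_le fun i => le_iSup (fun i : Fin n => D.R (i + 1)) ⟨i, i.2.trans_le h⟩

theorem R_le_RSum (D : IterationData 𝕜 B F) {m n : ℕ} (h : m < n) : D.R (m + 1) ≤ D.RSum n :=
  le_iSup (fun i : Fin n => D.R (i + 1)) ⟨m, h⟩

theorem Nc_le_NcSum (D : IterationData 𝕜 B F) {m k : ℕ} (h : m ≤ k) : D.Nc (m + 1) ≤ D.NcSum k :=
  le_iSup (fun i : Fin (k + 1) => D.Nc (i + 1)) ⟨m, by omega⟩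

theorem IsIteration.S_mem_R (hD : D.IsIteration A k) {m : ℕ} (hm : m ≤ k) (n : D.N m) :
    (D.S m n : F) ∈ D.R (m + 1) := by
  rw [hD.R_succ m hm]
  exact ⟨_, ⟨n, rfl⟩, rfl⟩

theorem factorial_div_factorial_ne_zero (m : ℕ) : (((2 * m)! : 𝕜) / (m ! : 𝕜)) ≠ 0 :=
  div_ne_zero (Nat.cast_ne_zero.mpr (Nat.factorial_ne_zero _))
    (Nat.cast_ne_zero.mpr (Nat.factorial_ne_zero _))

/-- The leading coefficient of the product of `∑ A_j εʲ` and a lift lies in `R₁ ⊕ ⋯ ⊕ R_{m+1}`;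
modulo `R₁ ⊕ ⋯ ⊕ R_m` it is given by `S_{m+1}`. -/
theorem IsIteration.exists_prodCoeff_eq (hD : D.IsIteration A k) {m : ℕ} (hm : m ≤ k) {v : ℕ → B}
    (hv : IsLift A m v) (hN : v 0 ∈ D.N m) :
    ∃ ρ ∈ D.RSum m, prodCoeff A m v
      = (((2 * m)! : 𝕜) / (m ! : 𝕜))⁻¹ • (D.S m ⟨v 0, hN⟩ : F) + ρ := by
  obtain ⟨h, h'⟩ := hD.S_eq_of_isLift m hm v hv
  refine ⟨_, Submodule.smul_mem _ (((2 * m)! : 𝕜) / (m ! : 𝕜))⁻¹ h', ?_⟩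
  rw [smul_sub, inv_smul_smul₀ (factorial_div_factorial_ne_zero m)]
  abel

theorem IsIteration.mem_N_succ_iff (hD : D.IsIteration A k) {m : ℕ} (hm : m ≤ k) {n : B}
    (hn : n ∈ D.N m) : n ∈ D.N (m + 1) ↔ D.S m ⟨n, hn⟩ = 0 := by
  rw [hD.N_succ m hm]
  constructor
  · rintro ⟨x, hx, rfl⟩
    exact hx
  · intro h
    exact ⟨⟨n, hn⟩, h, rfl⟩

/-- Operators `b ↦ b + ε U_{m,1} b + ε² U_{m,2} b + ⋯` that lift the elements of `N_m` to
order `m`, with higher coefficients in `N^c`, for the orders `m ≤ M`. -/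
structure IsLifting (D : IterationData 𝕜 B F) (A : ℕ → B →L[𝕜] F) (k M : ℕ)
    (U : ℕ → ℕ → B →L[𝕜] B) : Prop where
  zero : ∀ m ≤ M, ∀ b, U m 0 b = b
  isLift : ∀ m ≤ M, ∀ n ∈ D.N m, IsLift A m (fun j => U m j n)
  mem : ∀ m ≤ M, ∀ j, 1 ≤ j → ∀ b, U m j b ∈ D.NcSum k

/-- The sum of the leading coefficients of the products of `∑ A_j εʲ` and the lifts of `y i`. -/
def leadSum (A : ℕ → B →L[𝕜] F) (U : ℕ → ℕ → B →L[𝕜] B) (m : ℕ) (y : ℕ → B) : F :=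
  ∑ i ∈ Finset.range m, prodCoeffCLM A i (U i) (y i)

theorem leadSum_mem (hD : D.IsIteration A k) {M : ℕ} {U : ℕ → ℕ → B →L[𝕜] B}
    (hU : IsLifting D A k M U) {m : ℕ} (hm : m ≤ M + 1) (hmk : m ≤ k + 1) {y : ℕ → B}
    (hy : ∀ i < m, y i ∈ D.N i) : leadSum A U m y ∈ D.RSum m := by
  refine Submodule.sum_mem _ fun i hi => ?_
  rw [Finset.mem_range] at hi
  rw [prodCoeffCLM_apply]
  have h0 : U i 0 (y i) ∈ D.N i := by rw [hU.zero i (by omega)]; exact hy i hi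
  obtain ⟨ρ, hρ, h⟩ := hD.exists_prodCoeff_eq (by omega) (hU.isLift i (by omega) _ (hy i hi)) h0
  rw [h]
  exact add_mem (Submodule.smul_mem _ _ (D.R_le_RSum hi (hD.S_mem_R (by omega) _)))
    (D.RSum_mono hi.le hρ)

/-- By induction, removing the last component: modulo `R₁ ⊕ ⋯ ⊕ R_m`, the sum reduces to `S_{m+1}` applied to the
last component, and `S_{m+1}` is injective on `N_{m+1}^c`. -/
theorem leadSum_injective (hD : D.IsIteration A k) {M : ℕ} {U : ℕ → ℕ → B →L[𝕜] B}
    (hU : IsLifting D A k M U) : ∀ m ≤ M + 1, m ≤ k + 1 → ∀ y : ℕ → B,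
      (∀ i < m, y i ∈ D.Nc (i + 1)) → ∀ r ∈ D.Rc m, leadSum A U m y + r = 0 →
      (∀ i < m, y i = 0) ∧ r = 0 := by
  intro m
  induction m with
  | zero =>
    intro _ _ y _ r _ h
    exact ⟨fun i hi => absurd hi (Nat.not_lt_zero i), by simpa [leadSum] using h⟩
  | succ m ih =>
    intro hm hmk y hy r hr h
    have hyN : ∀ i < m + 1, y i ∈ D.N i := fun i hi => hD.Nc_succ_le (by omega) (hy i hi)
    have hl := leadSum_mem hD hU (m := m) (by omega) (by omega) (fun i hi => hyN i (by omega))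
    have h0 : U m 0 (y m) ∈ D.N m := by rw [hU.zero m (by omega)]; exact hyN m (by omega)
    obtain ⟨ρ, hρ, hS⟩ := hD.exists_prodCoeff_eq (by omega)
      (hU.isLift m (by omega) _ (hyN m (by omega))) h0
    have e : leadSum A U (m + 1) y = leadSum A U m y + prodCoeff A m (fun j => U m j (y m)) := by
      rw [leadSum, Finset.sum_range_succ, prodCoeffCLM_apply]; rfl
    set s : F := (((2 * m)! : 𝕜) / (m ! : 𝕜))⁻¹ • (D.S m ⟨U m 0 (y m), h0⟩ : F) with hs
    have hsR : s ∈ D.R (m + 1) := Submodule.smul_mem _ _ (hD.S_mem_R (by omega) _)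
    have hR : D.R (m + 1) ≤ D.Rc m := (hD.R_sup m (by omega)) ▸ le_sup_left
    have hsr : s + r = 0 := by
      refine Submodule.disjoint_def.mp (hD.disjoint_RSum m (by omega)) _ ?_
        (add_mem (hR hsR) (hD.Rc_succ_le (by omega) hr))
      have : s + r = -(leadSum A U m y + ρ) := by
        rw [e, hS] at h
        rw [eq_neg_iff_add_eq_zero, ← h]; abel
      rw [this]
      exact neg_mem (add_mem hl hρ)
    have hs0 : s = 0 := by
      refine Submodule.disjoint_def.mp (hD.R_disjoint m (by omega)) _ hsR ?_
      rw [eq_neg_of_add_eq_zero_left hsr]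
      exact neg_mem hr
    have hr0 : r = 0 := by rw [hs0, zero_add] at hsr; exact hsr
    have hym : y m = 0 := by
      have h1 : y m ∈ D.N (m + 1) := by
        rw [hD.mem_N_succ_iff (by omega) (hyN m (by omega))]
        have h2 := (smul_eq_zero.mp hs0).resolve_left (inv_ne_zero (factorial_div_factorial_ne_zero m))
        have h3 : (⟨U m 0 (y m), h0⟩ : D.N m) = ⟨y m, hyN m (by omega)⟩ :=
          Subtype.ext (hU.zero m (by omega) _)
        rw [h3] at h2
        exact_mod_cast h2
      exact Submodule.disjoint_def.mp (hD.N_disjoint m (by omega)) _ (hy m (by omega)) h1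
    have h4 : leadSum A U m y + 0 = 0 := by
      rw [e, hr0, hym] at h
      simpa [prodCoeff] using h
    have h5 := (ih (by omega) (by omega) y (fun i hi => hy i (by omega)) 0 (zero_mem _) h4).1
    refine ⟨fun i hi => ?_, hr0⟩
    rcases Nat.lt_succ_iff_lt_or_eq.mp hi with h6 | rfl
    · exact h5 i h6
    · exact hym

/-- By induction: the component of `f` in `R_{m+1}` is reached by an element of `N_{m+1}^c`, up to
an error in `R₁ ⊕ ⋯ ⊕ R_m`, which the components with lower index remove. -/
theorem leadSum_surjective (hD : D.IsIteration A k) {M : ℕ} {U : ℕ → ℕ → B →L[𝕜] B}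
    (hU : IsLifting D A k M U) : ∀ m ≤ M + 1, m ≤ k + 1 → ∀ f : F, ∃ y : ℕ → B,
      (∀ i < m, y i ∈ D.Nc (i + 1)) ∧ ∃ r ∈ D.Rc m, leadSum A U m y + r = f := by
  intro m
  induction m with
  | zero =>
    intro _ _ f
    exact ⟨fun _ => 0, fun i hi => absurd hi (Nat.not_lt_zero i), f, by rw [hD.Rc_zero]; trivial,
      by simp [leadSum]⟩
  | succ m ih =>
    intro hm hmk f
    obtain ⟨y, hy, r, hr, rfl⟩ := ih (by omega) (by omega) f
    rw [← hD.R_sup m (by omega)] at hr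
    obtain ⟨s, hs, r', hr', rfl⟩ := Submodule.mem_sup.mp hr
    rw [hD.R_succ m (by omega)] at hs
    obtain ⟨_, ⟨n, rfl⟩, rfl⟩ := hs
    have hn : (n : B) ∈ D.Nc (m + 1) ⊔ D.N (m + 1) := by rw [hD.N_sup m (by omega)]; exact n.2
    obtain ⟨nc, hnc, n', hn', hnn⟩ := Submodule.mem_sup.mp hn
    have hncN : nc ∈ D.N m := hD.Nc_succ_le (by omega) hnc
    have hSn : D.S m n = D.S m ⟨nc, hncN⟩ := by
      have h1 := (hD.mem_N_succ_iff (by omega) (hD.N_succ_le (by omega) hn')).mp hn'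
      have h2 : n = ⟨nc, hncN⟩ + ⟨n', hD.N_succ_le (by omega) hn'⟩ := Subtype.ext hnn.symm
      rw [h2, map_add, h1, add_zero]
    have h0 : U m 0 nc ∈ D.N m := by rw [hU.zero m (by omega)]; exact hncN
    obtain ⟨ρ, hρ, hS⟩ := hD.exists_prodCoeff_eq (by omega) (hU.isLift m (by omega) _ hncN) h0
    have h3 : (⟨U m 0 nc, h0⟩ : D.N m) = ⟨nc, hncN⟩ := Subtype.ext (hU.zero m (by omega) _)
    rw [h3] at hS
    set c : 𝕜 := ((2 * m)! : 𝕜) / (m ! : 𝕜) with hc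
    -- the part of `c • ρ` in `R₁ ⊕ ⋯ ⊕ R_m` is removed by the lower operators
    obtain ⟨y', hy', r'', hr'', hρ'⟩ := ih (by omega) (by omega) (c • ρ)
    have hr0 : r'' = 0 := by
      refine Submodule.disjoint_def.mp (hD.disjoint_RSum m (by omega)) _ ?_ hr''
      rw [eq_sub_of_add_eq' hρ']
      exact sub_mem (Submodule.smul_mem _ _ hρ) (leadSum_mem hD hU (by omega) (by omega)
        fun i hi => hD.Nc_succ_le (by omega) (hy' i hi))
    rw [hr0, add_zero] at hρ'
    refine ⟨fun i => if i < m then y i - y' i else c • nc, ?_, r', hr', ?_⟩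
    · intro i hi
      rcases Nat.lt_succ_iff_lt_or_eq.mp hi with h6 | rfl
      · beta_reduce
        rw [if_pos h6]; exact sub_mem (hy i h6) (hy' i h6)
      · beta_reduce
        rw [if_neg (lt_irrefl _)]; exact Submodule.smul_mem _ _ hnc
    · have e1 : leadSum A U (m + 1) (fun i => if i < m then y i - y' i else c • nc)
          = leadSum A U m y - leadSum A U m y' + c • prodCoeff A m (fun j => U m j nc) := by
        rw [leadSum, Finset.sum_range_succ, if_neg (lt_irrefl _), map_smul, prodCoeffCLM_apply]
        congr 1
        rw [leadSum, leadSum, ← Finset.sum_sub_distrib]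
        refine Finset.sum_congr rfl fun i hi => ?_
        rw [if_pos (Finset.mem_range.mp hi), map_sub]
      rw [e1, hS, hρ', smul_add, smul_inv_smul₀ (factorial_div_factorial_ne_zero m)]
      simp only [ContinuousLinearMap.coe_coe, Submodule.subtype_apply, hSn]
      abel

variable [CompleteSpace B] [CompleteSpace F]

/-- The operator `(y, r) ↦ leadSum y + r` is an isomorphism of
`N₁^c × ⋯ × N_m^c × R_m^c` onto `B̄`. -/
theorem exists_leadSum_equiv (hD : D.IsIteration A k) {M : ℕ} {U : ℕ → ℕ → B →L[𝕜] B}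
    (hU : IsLifting D A k M U) {m : ℕ} (hm : m ≤ M + 1) (hmk : m ≤ k + 1) :
    ∃ e : ((∀ i : Fin m, D.Nc (i + 1)) × D.Rc m) ≃L[𝕜] F, ∀ p,
      e p = ∑ i : Fin m, prodCoeffCLM A i (U i) (p.1 i) + p.2 := by
  have hc1 : ∀ i : Fin m, CompleteSpace (D.Nc (i + 1)) := fun i =>
    (hD.Nc_closed i (by omega)).completeSpace_coe
  have hc2 : CompleteSpace (D.Rc m) := (hD.isClosed_Rc m hmk).completeSpace_coe
  let f : ((∀ i : Fin m, D.Nc (i + 1)) × D.Rc m) →L[𝕜] F :=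
    (∑ i : Fin m, prodCoeffCLM A i (U i) ∘L (D.Nc (i + 1)).subtypeL ∘L
      ContinuousLinearMap.proj i) ∘L ContinuousLinearMap.fst 𝕜 _ _
    + (D.Rc m).subtypeL ∘L ContinuousLinearMap.snd 𝕜 _ _
  have hf : ∀ p, f p = ∑ i : Fin m, prodCoeffCLM A i (U i) (p.1 i) + p.2 := by
    intro p; simp [f]
  have hext : ∀ (y : ∀ i : Fin m, D.Nc (i + 1)),
      ∑ i : Fin m, prodCoeffCLM A i (U i) (y i)
        = leadSum A U m fun i => if h : i < m then (y ⟨i, h⟩ : B) else 0 := by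
    intro y
    rw [leadSum, Finset.sum_range]
    refine Finset.sum_congr rfl fun i _ => ?_
    rw [dif_pos i.2]
  have hinj : f.toLinearMap.ker = ⊥ := by
    rw [LinearMap.ker_eq_bot']
    intro p hp
    have hp' : f p = 0 := hp
    rw [hf, hext] at hp'
    obtain ⟨h1, h2⟩ := leadSum_injective hD hU m hm hmk _ (fun i hi => by
      simp only [dif_pos hi]; exact (p.1 ⟨i, hi⟩).2) _ p.2.2 hp'
    refine Prod.ext (funext fun i => Subtype.ext ?_) (Subtype.ext h2)
    have := h1 i i.2
    rw [dif_pos i.2] at this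
    exact this
  have hsurj : f.toLinearMap.range = ⊤ := by
    rw [LinearMap.range_eq_top]
    intro g
    obtain ⟨y, hy, r, hr, h⟩ := leadSum_surjective hD hU m hm hmk g
    refine ⟨(fun i => ⟨y i, hy i i.2⟩, ⟨r, hr⟩), ?_⟩
    show f _ = g
    rw [hf, ← h]
    congr 1
    rw [leadSum, Finset.sum_range]
  refine ⟨ContinuousLinearEquiv.ofBijective f hinj hsurj, fun p => ?_⟩
  exact hf p

/-- Lifts exist, with bounded linear dependence on the starting element: a lift of order `m` of an
element of `N_{m+1}` is corrected by shifted lifts of elements of `N₁^c, …, N_m^c`. -/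
theorem exists_isLifting (hD : D.IsIteration A k) :
    ∀ M ≤ k + 1, ∃ U : ℕ → ℕ → B →L[𝕜] B, IsLifting D A k M U := by
  intro M
  induction M with
  | zero =>
    intro _
    refine ⟨fun _ j => if j = 0 then ContinuousLinearMap.id 𝕜 B else 0, ?_, ?_, ?_⟩
    · intro m _ b; simp
    · intro m hm n _ i hi; omega
    · intro m _ j hj b
      rw [if_neg (by omega)]
      exact zero_mem _
  | succ M ih =>
    intro hM
    obtain ⟨U, hU⟩ := ih (by omega)
    obtain ⟨e, he⟩ := exists_leadSum_equiv hD hU (m := M) (by omega) (by omega)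
    let κ : ∀ i : Fin M, B →L[𝕜] B := fun i => (D.Nc (i + 1)).subtypeL ∘L
      ContinuousLinearMap.proj i ∘L ContinuousLinearMap.fst 𝕜 _ _ ∘L
      e.symm.toContinuousLinearMap ∘L prodCoeffCLM A M (U M)
    have hκ : ∀ (i : Fin M) b, κ i b ∈ D.Nc (i + 1) := fun i b => Subtype.mem _
    let W : ℕ → B →L[𝕜] B := fun j => U M j -
      ∑ i : Fin M, if M - i ≤ j then U i (j - (M - i)) ∘L κ i else 0
    have hW : ∀ j b, W j b = U M j b -
        ∑ i : Fin M, if M - i ≤ j then U i (j - (M - i)) (κ i b) else 0 := by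
      intro j b
      simp only [W, sub_apply, sum_apply]
      congr 1
      refine Finset.sum_congr rfl fun i _ => ?_
      split_ifs <;> simp
    have hWp : ∀ l b, prodCoeff A l (fun j => W j b) = prodCoeff A l (fun j => U M j b) -
        ∑ i : Fin M, if M - i ≤ l then prodCoeff A (l - (M - i)) (fun j => U i j (κ i b))
          else 0 := by
      intro l b
      simp only [hW]
      rw [prodCoeff_sub, prodCoeff_sum]
      congr 1
      refine Finset.sum_congr rfl fun i _ => ?_
      exact prodCoeff_shift A (M - i) l fun j => U i j (κ i b)
    have hU' : ∀ m ≤ M, (Function.update U (M + 1) W) m = U m := fun m hm =>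
      Function.update_of_ne (by omega) _ _
    have hU'' : (Function.update U (M + 1) W) (M + 1) = W := Function.update_self _ _ _
    refine ⟨Function.update U (M + 1) W, ?_, ?_, ?_⟩
    · intro m hm b
      rcases Nat.le_succ_iff.mp hm with h | rfl
      · rw [hU' m h]; exact hU.zero m h b
      · rw [hU'', hW, hU.zero M le_rfl, Finset.sum_eq_zero, sub_zero]
        intro i _
        rw [if_neg (by omega)]
    · intro m hm n hn
      rcases Nat.le_succ_iff.mp hm with h | rfl
      · rw [hU' m h]; exact hU.isLift m h n hn
      · rw [hU'']
        have hnM : n ∈ D.N M := hD.N_succ_le (by omega) hn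
        intro l hl
        rw [hWp]
        rcases Nat.lt_succ_iff_lt_or_eq.mp hl with h | rfl
        · rw [hU.isLift M le_rfl n hnM l h, zero_sub, neg_eq_zero]
          refine Finset.sum_eq_zero fun i _ => ?_
          split_ifs with h1
          · exact hU.isLift i (by omega) _ (hD.Nc_succ_le (by omega) (hκ i n)) _ (by omega)
          · rfl
        · have h0 : U l 0 n ∈ D.N l := by rw [hU.zero l le_rfl]; exact hnM
          obtain ⟨ρ, hρ, hS⟩ := hD.exists_prodCoeff_eq (by omega) (hU.isLift l le_rfl n hnM) h0
          have hS0 : D.S l ⟨U l 0 n, h0⟩ = 0 := by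
            rw [← hD.mem_N_succ_iff (by omega), hU.zero l le_rfl]; exact hn
          rw [hS0, Submodule.coe_zero, smul_zero, zero_add] at hS
          -- the component in `R_m^c` of the coefficient vanishes
          set p := e.symm (prodCoeff A l fun j => U l j n) with hp
          have hep : e p = ρ := by rw [hp, e.apply_symm_apply, hS]
          have hp2 : (p.2 : F) = 0 := by
            refine Submodule.disjoint_def.mp (hD.disjoint_RSum l (by omega)) _ ?_ p.2.2
            rw [he] at hep
            rw [eq_sub_of_add_eq' hep]
            refine sub_mem hρ ?_
            have := leadSum_mem hD hU (m := l) (by omega) (by omega)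
              (y := fun i => if h : i < l then (p.1 ⟨i, h⟩ : B) else 0) (fun i hi => by
                rw [dif_pos hi]
                exact hD.Nc_succ_le (by omega) (p.1 ⟨i, hi⟩).2)
            rw [leadSum, Finset.sum_range] at this
            convert this using 2 with i
            rw [dif_pos i.2]
          have hκp : ∀ i, κ i n = p.1 i := by
            intro i
            simp [κ, hp, prodCoeffCLM_apply]
          rw [hS, ← hep, he, hp2, add_zero, sub_eq_zero]
          refine Finset.sum_congr rfl fun i _ => ?_
          rw [if_pos (by omega), show l - (l - (i : ℕ)) = i by omega, prodCoeffCLM_apply, hκp]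
    · intro m hm j hj b
      rcases Nat.le_succ_iff.mp hm with h | rfl
      · rw [hU' m h]; exact hU.mem m h j hj b
      · rw [hU'', hW]
        refine sub_mem (hU.mem M le_rfl j hj b) (Submodule.sum_mem _ fun i _ => ?_)
        split_ifs with h1
        · rcases Nat.eq_zero_or_pos (j - (M - i)) with h2 | h2
          · rw [h2, hU.zero i (by omega)]
            exact D.Nc_le_NcSum (by omega) (hκ i b)
          · exact hU.mem i (by omega) _ h2 _
        · exact zero_mem _

omit [CompleteSpace F] in
/-- Bounded projections `Q_m` of `B` onto `N_m` along `N₁^c ⊕ ⋯ ⊕ N_m^c`. -/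
theorem exists_projections (hD : D.IsIteration A k) :
    ∃ Q : ℕ → B →L[𝕜] B, (∀ m ≤ k + 1, ∀ b, Q m b ∈ D.N m) ∧
      (∀ m ≤ k + 1, ∀ n ∈ D.N m, Q m n = n) ∧
      (∀ m ≤ k, ∀ n ∈ D.Nc (m + 1), Q (m + 1) n = 0) ∧
      ∀ m ≤ k, ∀ n ∈ D.N m, n - Q (m + 1) n ∈ D.Nc (m + 1) := by
  have step : ∀ m ≤ k, ∃ π : D.N m →L[𝕜] B, (∀ n, π n ∈ D.N (m + 1)) ∧
      (∀ n : D.N m, (n : B) ∈ D.N (m + 1) → π n = n) ∧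
      (∀ n : D.N m, (n : B) ∈ D.Nc (m + 1) → π n = 0) ∧
      ∀ n : D.N m, (n : B) - π n ∈ D.Nc (m + 1) := by
    intro m hm
    have hc0 : CompleteSpace (D.N m) := (hD.isClosed_N m (by omega)).completeSpace_coe
    have hc1 : CompleteSpace (D.N (m + 1)) := (hD.isClosed_N (m + 1) (by omega)).completeSpace_coe
    have hc2 : CompleteSpace (D.Nc (m + 1)) := (hD.Nc_closed m hm).completeSpace_coe
    let f : (D.Nc (m + 1) × D.N (m + 1)) →L[𝕜] D.N m :=
      ((D.Nc (m + 1)).subtypeL.codRestrict (D.N m) fun x => hD.Nc_succ_le hm x.2) ∘L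
        ContinuousLinearMap.fst 𝕜 _ _
      + ((D.N (m + 1)).subtypeL.codRestrict (D.N m) fun x => hD.N_succ_le hm x.2) ∘L
        ContinuousLinearMap.snd 𝕜 _ _
    have hf : ∀ p, (f p : B) = p.1 + p.2 := fun p => rfl
    have hinj : f.toLinearMap.ker = ⊥ := by
      rw [LinearMap.ker_eq_bot']
      intro p hp
      have h1 : (p.1 : B) + p.2 = 0 := by
        rw [← hf]; exact congrArg Subtype.val hp
      have h2 : (p.1 : B) = 0 := Submodule.disjoint_def.mp (hD.N_disjoint m hm) _ p.1.2 (by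
        rw [eq_neg_of_add_eq_zero_left h1]; exact neg_mem p.2.2)
      rw [h2, zero_add] at h1
      exact Prod.ext (Subtype.ext h2) (Subtype.ext h1)
    have hsurj : f.toLinearMap.range = ⊤ := by
      rw [LinearMap.range_eq_top]
      intro n
      have hn : (n : B) ∈ D.Nc (m + 1) ⊔ D.N (m + 1) := by rw [hD.N_sup m hm]; exact n.2
      obtain ⟨a, ha, b, hb, h⟩ := Submodule.mem_sup.mp hn
      exact ⟨(⟨a, ha⟩, ⟨b, hb⟩), Subtype.ext h⟩
    let e := ContinuousLinearEquiv.ofBijective f hinj hsurj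
    have he : ∀ p, ((e p : D.N m) : B) = p.1 + p.2 := fun p => hf p
    have hes : ∀ n : D.N m, (n : B) = (e.symm n).1 + (e.symm n).2 := fun n => by
      rw [← he, e.apply_symm_apply]
    refine ⟨(D.N (m + 1)).subtypeL ∘L ContinuousLinearMap.snd 𝕜 _ _ ∘L e.symm.toContinuousLinearMap,
      fun n => Subtype.mem _, fun n hn => ?_, fun n hn => ?_, fun n => ?_⟩
    · have : e.symm n = (0, ⟨n, hn⟩) := by
        rw [ContinuousLinearEquiv.symm_apply_eq]; apply Subtype.ext; rw [he]; simp
      simp [this]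
    · have : e.symm n = (⟨n, hn⟩, 0) := by
        rw [ContinuousLinearEquiv.symm_apply_eq]; apply Subtype.ext; rw [he]; simp
      simp [this]
    · have : (n : B) - (e.symm n).2 = (e.symm n).1 := by
        rw [sub_eq_iff_eq_add]; exact hes n
      show (n : B) - (e.symm n).2 ∈ _
      rw [this]
      exact Subtype.mem _
  have hM : ∀ M ≤ k + 1, ∃ Q : ℕ → B →L[𝕜] B, (∀ m ≤ M, ∀ b, Q m b ∈ D.N m) ∧
      (∀ m ≤ M, ∀ n ∈ D.N m, Q m n = n) ∧
      (∀ m < M, ∀ n ∈ D.Nc (m + 1), Q (m + 1) n = 0) ∧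
      ∀ m < M, ∀ n ∈ D.N m, n - Q (m + 1) n ∈ D.Nc (m + 1) := by
    intro M
    induction M with
    | zero =>
      intro _
      refine ⟨fun _ => ContinuousLinearMap.id 𝕜 B, ?_, fun _ _ _ _ => rfl, fun m hm => by omega,
        fun m hm => by omega⟩
      intro m hm b
      rw [Nat.le_zero.mp hm, hD.N_zero]; trivial
    | succ M ih =>
      intro hM
      obtain ⟨Q, h1, h2, h3, h4⟩ := ih (by omega)
      obtain ⟨π, p1, p2, p3, p4⟩ := step M (by omega)
      let q : B →L[𝕜] B := π ∘L (Q M).codRestrict (D.N M) (h1 M le_rfl)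
      have hq : ∀ b, q b = π ⟨Q M b, h1 M le_rfl b⟩ := fun b => rfl
      have hqN : ∀ n (hn : n ∈ D.N M), q n = π ⟨n, hn⟩ := by
        intro n hn
        rw [hq]; congr 1; exact Subtype.ext (h2 M le_rfl n hn)
      have hu : ∀ m ≤ M, (Function.update Q (M + 1) q) m = Q m := fun m hm =>
        Function.update_of_ne (by omega) _ _
      have hu' : (Function.update Q (M + 1) q) (M + 1) = q := Function.update_self _ _ _
      refine ⟨Function.update Q (M + 1) q, ?_, ?_, ?_, ?_⟩
      · intro m hm b
        rcases Nat.le_succ_iff.mp hm with h | rfl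
        · rw [hu m h]; exact h1 m h b
        · rw [hu', hq]; exact p1 _
      · intro m hm n hn
        rcases Nat.le_succ_iff.mp hm with h | rfl
        · rw [hu m h]; exact h2 m h n hn
        · rw [hu', hqN n (hD.N_succ_le (by omega) hn)]; exact p2 _ hn
      · intro m hm n hn
        rcases Nat.lt_succ_iff_lt_or_eq.mp hm with h | rfl
        · rw [hu _ (by omega)]; exact h3 m h n hn
        · rw [hu', hqN n (hD.Nc_succ_le (by omega) hn)]; exact p3 _ hn
      · intro m hm n hn
        rcases Nat.lt_succ_iff_lt_or_eq.mp hm with h | rfl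
        · rw [hu _ (by omega)]; exact h4 m h n hn
        · rw [hu', hqN n hn]; exact p4 ⟨n, hn⟩
  obtain ⟨Q, h1, h2, h3, h4⟩ := hM (k + 1) le_rfl
  exact ⟨Q, h1, h2, fun m hm => h3 m (by omega), fun m hm => h4 m (by omega)⟩

/-- Lifting operators `b ↦ V_{i,0} b + ε V_{i,1} b + ε² V_{i,2} b + ⋯` on `B` with `V_{i,0} = 1`:
elements of `N_i` are lifted to order `i`, elements of `N_{i+1}` to order `i + 1`. The leading
coefficients of the products of `∑ A_j εʲ` and the lifts of elements of `N₁^c, …, N_{k+1}^c`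
define an isomorphism `Ψ` onto `B̄`. -/
structure LiftSystem (D : IterationData 𝕜 B F) (A : ℕ → B →L[𝕜] F) (k : ℕ) where
  V : ℕ → ℕ → B →L[𝕜] B
  V_zero : ∀ i ≤ k, ∀ b, V i 0 b = b
  isLift : ∀ i ≤ k, ∀ n ∈ D.N i, IsLift A i fun j => V i j n
  isLift_succ : ∀ i ≤ k, ∀ n ∈ D.N (i + 1), IsLift A (i + 1) fun j => V i j n
  V_mem : ∀ i ≤ k, ∀ j, ∀ n ∈ D.Nc (i + 1), V i j n ∈ D.NcSum k
  Ψ : D.CoParam k ≃L[𝕜] F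
  Ψ_apply : ∀ y, Ψ y = ∑ i : Fin (k + 1), prodCoeff A i fun j => V i j (y i)

omit [CompleteSpace B] [CompleteSpace F] in
/-- Surjectivity of `[S₁ ⋯ S_{k+1}]` means `R₁ ⊕ ⋯ ⊕ R_{k+1} = B̄`: no complement is left. -/
theorem Rc_eq_bot_of_surjective (hD : D.IsIteration A k)
    (hs : Function.Surjective (D.sumOp k)) : D.Rc (k + 1) = ⊥ := by
  have htop : D.RSum (k + 1) = ⊤ := by
    rw [eq_top_iff]
    intro f _
    obtain ⟨n, rfl⟩ := hs f
    simp only [sumOp, sum_apply]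
    refine Submodule.sum_mem _ fun i _ => ?_
    exact D.R_le_RSum i.2 (hD.S_mem_R (by omega) _)
  have := hD.disjoint_RSum (k + 1) le_rfl
  rw [htop] at this
  exact top_disjoint.mp this

/-- An element of `B` is split by the projection `Q_{i+1}` onto `N_{i+1}`; this part is lifted to
order `i + 1`, the remaining part to order `i`. -/
theorem nonempty_liftSystem (hD : D.IsIteration A k) (hs : Function.Surjective (D.sumOp k)) :
    Nonempty (LiftSystem D A k) := by
  obtain ⟨U, hU⟩ := exists_isLifting hD (k + 1) le_rfl
  obtain ⟨Q, Q1, Q2, Q3, Q4⟩ := exists_projections hD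
  obtain ⟨e, he⟩ := exists_leadSum_equiv hD hU (m := k + 1) (by omega) le_rfl
  have hRc := Rc_eq_bot_of_surjective hD hs
  let V : ℕ → ℕ → B →L[𝕜] B := fun i j =>
    U i j ∘L (ContinuousLinearMap.id 𝕜 B - Q (i + 1)) + U (i + 1) j ∘L Q (i + 1)
  have hV : ∀ i j b, V i j b = U i j (b - Q (i + 1) b) + U (i + 1) j (Q (i + 1) b) :=
    fun i j b => by simp [V]
  have hVc : ∀ i ≤ k, ∀ j, ∀ n ∈ D.Nc (i + 1), V i j n = U i j n := by
    intro i hi j n hn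
    rw [hV, Q3 i hi n hn, sub_zero, map_zero, add_zero]
  have hsub : Subsingleton (D.Rc (k + 1)) := by
    rw [hRc]; infer_instance
  let pr : (D.CoParam k × D.Rc (k + 1)) ≃L[𝕜] D.CoParam k :=
    { toFun := Prod.fst
      invFun := fun y => (y, 0)
      map_add' := fun _ _ => rfl
      map_smul' := fun _ _ => rfl
      left_inv := fun p => Prod.ext rfl (Subsingleton.elim _ _)
      right_inv := fun _ => rfl
      continuous_toFun := continuous_fst
      continuous_invFun := by fun_prop }
  refine ⟨⟨V, ?_, ?_, ?_, ?_, pr.symm.trans e, ?_⟩⟩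
  · intro i hi b
    rw [hV, hU.zero i (by omega), hU.zero (i + 1) (by omega)]; abel
  · intro i hi n hn l hl
    have h1 := hU.isLift i (by omega) _ (hD.Nc_succ_le hi (Q4 i hi n hn)) l hl
    have h2 := hU.isLift (i + 1) (by omega) _ (Q1 (i + 1) (by omega) n) l (by omega)
    simp only [hV]
    rw [prodCoeff_add, h1, h2, add_zero]
  · intro i hi n hn l hl
    have h2 := hU.isLift (i + 1) (by omega) _ hn l (by omega)
    simp only [hV, Q2 (i + 1) (by omega) n hn, sub_self, map_zero, zero_add]
    exact h2
  · intro i hi j n hn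
    rw [hVc i hi j n hn]
    rcases Nat.eq_zero_or_pos j with rfl | hj
    · rw [hU.zero i (by omega)]; exact D.Nc_le_NcSum hi hn
    · exact hU.mem i (by omega) j hj n
  · intro y
    show e (y, 0) = _
    rw [he]
    simp only [Submodule.coe_zero, add_zero, prodCoeffCLM_apply]
    refine Finset.sum_congr rfl fun i _ => ?_
    congr 1
    funext j
    exact (hVc i (by omega) j _ (y i).2).symm

end IterationData
end UndeterminedCoefficients

/-! ### The operator polynomial of the lifts and the coefficient map `M` -/

namespace UndeterminedCoefficients

variable {𝕜 : Type*} [RCLike 𝕜]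
  {B : Type*} [NormedAddCommGroup B] [NormedSpace 𝕜 B]
  {F : Type*} [NormedAddCommGroup F] [NormedSpace 𝕜 F]

/-- Product of two operator polynomials, up to terms of high order. -/
theorem isBigO_comp_sub_sum {V W : Type*} [NormedAddCommGroup V] [NormedSpace 𝕜 V]
    [NormedAddCommGroup W] [NormedSpace 𝕜 W] (n : ℕ) (A : ℕ → W →L[𝕜] F) (L : ℕ → V →L[𝕜] W) :
    (fun ε : 𝕜 => (∑ j ∈ Finset.range n, ε ^ j • A j) ∘L (∑ m ∈ Finset.range n, ε ^ m • L m)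
      - ∑ l ∈ Finset.range n, ε ^ l • ∑ j ∈ Finset.range (l + 1), A j ∘L L (l - j))
      =O[𝓝 0] fun ε => ε ^ n := by
  have e : ∀ ε : 𝕜, (∑ j ∈ Finset.range n, ε ^ j • A j) ∘L (∑ m ∈ Finset.range n, ε ^ m • L m)
      - ∑ l ∈ Finset.range n, ε ^ l • ∑ j ∈ Finset.range (l + 1), A j ∘L L (l - j)
      = ∑ j ∈ Finset.range n, ∑ m ∈ Finset.Ico (n - j) n, ε ^ (j + m) • (A j ∘L L m) := by
    intro ε
    have e1 : (∑ j ∈ Finset.range n, ε ^ j • A j) ∘L (∑ m ∈ Finset.range n, ε ^ m • L m)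
        = ∑ j ∈ Finset.range n, ∑ m ∈ Finset.range n, ε ^ (j + m) • (A j ∘L L m) := by
      ext v
      simp only [ContinuousLinearMap.comp_apply, sum_apply, smul_apply, map_sum, map_smul,
        Finset.smul_sum, smul_smul, pow_add]
      rw [Finset.sum_comm]
      exact Finset.sum_congr rfl fun _ _ => Finset.sum_congr rfl fun _ _ => by rw [mul_comm]
    have e2 : ∑ l ∈ Finset.range n, ε ^ l • ∑ j ∈ Finset.range (l + 1), A j ∘L L (l - j)
        = ∑ j ∈ Finset.range n, ∑ m ∈ Finset.range (n - j), ε ^ (j + m) • (A j ∘L L m) := by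
      rw [← Finset.sum_range_diag_flip]
      refine Finset.sum_congr rfl fun l _ => ?_
      rw [Finset.smul_sum]
      refine Finset.sum_congr rfl fun j hj => ?_
      rw [Finset.mem_range] at hj
      rw [show j + (l - j) = l by omega]
    rw [e1, e2, ← Finset.sum_sub_distrib]
    refine Finset.sum_congr rfl fun j _ => ?_
    rw [Finset.sum_Ico_eq_sub _ (Nat.sub_le _ _)]
  simp only [e]
  refine IsBigO.fun_sum fun j _ => IsBigO.fun_sum fun m hm => ?_
  rw [Finset.mem_Ico] at hm
  exact (isBigO_pow_smul (j + m) (f := fun _ : 𝕜 => A j ∘L L m) continuousAt_const).trans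
    (isBigO_pow_pow (by omega))

theorem isBigO_clm_comp {V W : Type*} [NormedAddCommGroup V] [NormedSpace 𝕜 V]
    [NormedAddCommGroup W] [NormedSpace 𝕜 W] {T : 𝕜 → W →L[𝕜] F} {L : 𝕜 → V →L[𝕜] W} {m : ℕ}
    (hT : T =O[𝓝 0] fun ε => ε ^ m) (hL : ContinuousAt L 0) :
    (fun ε => T ε ∘L L ε) =O[𝓝 0] fun ε => ε ^ m := by
  obtain ⟨C, hC⟩ := hT.bound
  refine IsBigO.of_bound (C * (‖L 0‖ + 1)) ?_
  filter_upwards [hC, hL.norm.eventually_lt continuousAt_const (lt_add_one _)] with ε h1 h2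
  calc _ ≤ ‖T ε‖ * ‖L ε‖ := ContinuousLinearMap.opNorm_comp_le _ _
    _ ≤ (C * ‖ε ^ m‖) * (‖L 0‖ + 1) := by
        gcongr
        exact (norm_nonneg _).trans h1
    _ = _ := by ring

namespace IterationData

variable {D : IterationData 𝕜 B F} {A : ℕ → B →L[𝕜] F} {k : ℕ}

/-- The inclusion `N₁^c × ⋯ × N_{k+1}^c → B^{k+1}`. -/
def inclNc (D : IterationData 𝕜 B F) (k : ℕ) : D.CoParam k →L[𝕜] (Fin (k + 1) → B) :=
  ContinuousLinearMap.pi fun i => (D.Nc (i + 1)).subtypeL ∘L ContinuousLinearMap.proj i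

/-- The inclusion `N₁ × ⋯ × N_{k+1} → B^{k+1}`. -/
def inclN (D : IterationData 𝕜 B F) (k : ℕ) : D.Param k →L[𝕜] (Fin (k + 1) → B) :=
  ContinuousLinearMap.pi fun i => (D.N (i + 1)).subtypeL ∘L ContinuousLinearMap.proj i

/-- The sum map `(n^c, n) ↦ n^c + n` into `B^{k+1}`. -/
def inclSum (D : IterationData 𝕜 B F) (k : ℕ) :
    (D.CoParam k × D.Param k) →L[𝕜] (Fin (k + 1) → B) :=
  (D.inclNc k).coprod (D.inclN k)

theorem inclNc_apply (y : D.CoParam k) (i : Fin (k + 1)) : D.inclNc k y i = y i := rfl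

theorem inclSum_apply (x : D.CoParam k × D.Param k) :
    D.inclSum k x = D.inclNc k x.1 + D.inclN k x.2 := rfl

theorem inclSum_left (y : D.CoParam k) : D.inclSum k (y, 0) = D.inclNc k y := by
  rw [inclSum_apply, map_zero, add_zero]

namespace LiftSystem

variable (Λ : LiftSystem D A k)

/-- The coefficient of `εᵐ` in `∑ᵢ ε^{k-i} (V_{i,0} xᵢ + ε V_{i,1} xᵢ + ⋯)`. -/
def coeff (m : ℕ) : (Fin (k + 1) → B) →L[𝕜] B :=
  ∑ i : Fin (k + 1), if k - i ≤ m then Λ.V i (m - (k - i)) ∘L ContinuousLinearMap.proj i else 0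

theorem coeff_apply (m : ℕ) (x : Fin (k + 1) → B) :
    Λ.coeff m x = ∑ i : Fin (k + 1), if k - i ≤ m then Λ.V i (m - (k - i)) (x i) else 0 := by
  simp only [coeff, sum_apply]
  refine Finset.sum_congr rfl fun i _ => ?_
  split_ifs <;> simp

/-- The operator polynomial `x ↦ ∑ᵢ ε^{k-i} (V_{i,0} xᵢ + ε V_{i,1} xᵢ + ⋯)`, truncated at
order `k`. -/
def poly (ε : 𝕜) : (Fin (k + 1) → B) →L[𝕜] B :=
  ∑ m ∈ Finset.range (k + 1), ε ^ m • Λ.coeff m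

theorem poly_apply (ε : 𝕜) (x : Fin (k + 1) → B) :
    Λ.poly ε x = ∑ m ∈ Finset.range (k + 1), ε ^ m • Λ.coeff m x := by
  simp [poly]

theorem contDiff_poly {n : WithTop ℕ∞} : ContDiff 𝕜 n Λ.poly := by
  unfold poly
  fun_prop

theorem prodCoeff_coeff (l : ℕ) (x : Fin (k + 1) → B) :
    prodCoeff A l (fun m => Λ.coeff m x) = ∑ i : Fin (k + 1),
      if k - i ≤ l then prodCoeff A (l - (k - i)) (fun j => Λ.V i j (x i)) else 0 := by
  simp only [coeff_apply]
  rw [prodCoeff_sum]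
  refine Finset.sum_congr rfl fun i _ => ?_
  exact prodCoeff_shift A (k - i) l fun j => Λ.V i j (x i)

theorem prodCoeff_coeff_inclNc_of_lt (hD : D.IsIteration A k) {l : ℕ} (hl : l < k)
    (y : D.CoParam k) : prodCoeff A l (fun m => Λ.coeff m (D.inclNc k y)) = 0 := by
  rw [prodCoeff_coeff]
  refine Finset.sum_eq_zero fun i _ => ?_
  split_ifs with h
  · exact Λ.isLift i (by omega) _ (hD.Nc_succ_le (by omega) (y i).2) _ (by omega)
  · rfl

theorem prodCoeff_coeff_inclNc (y : D.CoParam k) :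
    prodCoeff A k (fun m => Λ.coeff m (D.inclNc k y)) = Λ.Ψ y := by
  rw [prodCoeff_coeff, Λ.Ψ_apply]
  refine Finset.sum_congr rfl fun i _ => ?_
  rw [if_pos (Nat.sub_le _ _), show k - (k - (i : ℕ)) = i by omega]
  rfl

theorem prodCoeff_coeff_inclN {l : ℕ} (hl : l ≤ k)
    (n : D.Param k) : prodCoeff A l (fun m => Λ.coeff m (D.inclN k n)) = 0 := by
  rw [prodCoeff_coeff]
  refine Finset.sum_eq_zero fun i _ => ?_
  split_ifs with h
  · exact Λ.isLift_succ i (by omega) _ (n i).2 _ (by omega)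
  · rfl

/-- The property of the lifts on which everything rests: `𝒯(ε) Λ(ε) (y + n) = εᵏ Ψ y` up to
`O(ε^{k+1})`, if `𝒯(ε)` agrees with `∑ A_j εʲ` to order `k`. -/
theorem isBigO_comp_poly_of_isBigO (hD : D.IsIteration A k) {𝒯 : 𝕜 → B →L[𝕜] F}
    (h : (fun ε => 𝒯 ε - ∑ j ∈ Finset.range (k + 1), ε ^ j • A j) =O[𝓝 0] fun ε => ε ^ (k + 1)) :
    (fun ε => 𝒯 ε ∘L Λ.poly ε ∘L D.inclSum k
      - ε ^ k • ((Λ.Ψ : D.CoParam k →L[𝕜] F) ∘L ContinuousLinearMap.fst 𝕜 _ (D.Param k)))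
      =O[𝓝 0] fun ε => ε ^ (k + 1) := by
  have h1 := isBigO_comp_sub_sum (𝕜 := 𝕜) (k + 1) A (fun m => Λ.coeff m ∘L D.inclSum k)
  have hp : ∀ ε : 𝕜, ∑ m ∈ Finset.range (k + 1), ε ^ m • Λ.coeff m ∘L D.inclSum k
      = Λ.poly ε ∘L D.inclSum k := by
    intro ε
    ext x
    · simp [poly]
    · simp [poly]
  have hc : ∀ l x, (∑ j ∈ Finset.range (l + 1), A j ∘L (Λ.coeff (l - j) ∘L D.inclSum k)) x
      = prodCoeff A l (fun m => Λ.coeff m (D.inclNc k x.1))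
        + prodCoeff A l (fun m => Λ.coeff m (D.inclN k x.2)) := by
    intro l x
    rw [← prodCoeff_add]
    simp [prodCoeff, inclSum_apply]
  have hs : ∀ ε : 𝕜, ∑ l ∈ Finset.range (k + 1), ε ^ l • ∑ j ∈ Finset.range (l + 1),
      A j ∘L (Λ.coeff (l - j) ∘L D.inclSum k)
      = ε ^ k • ((Λ.Ψ : D.CoParam k →L[𝕜] F) ∘L ContinuousLinearMap.fst 𝕜 _ (D.Param k)) := by
    intro ε
    rw [Finset.sum_range_succ, Finset.sum_eq_zero, zero_add]
    · congr 1
      refine ContinuousLinearMap.ext fun x => ?_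
      rw [hc, prodCoeff_coeff_inclNc, prodCoeff_coeff_inclN Λ le_rfl, add_zero]
      rfl
    · intro l hl
      rw [Finset.mem_range] at hl
      have : ∑ j ∈ Finset.range (l + 1), A j ∘L (Λ.coeff (l - j) ∘L D.inclSum k) = 0 := by
        refine ContinuousLinearMap.ext fun x => ?_
        rw [hc, prodCoeff_coeff_inclNc_of_lt Λ hD hl, prodCoeff_coeff_inclN Λ hl.le, add_zero]
        rfl
      rw [this, smul_zero]
  simp only [hs, hp] at h1
  have h2 : (fun ε => (𝒯 ε - ∑ j ∈ Finset.range (k + 1), ε ^ j • A j) ∘L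
      (Λ.poly ε ∘L D.inclSum k)) =O[𝓝 0] fun ε => ε ^ (k + 1) := by
    exact isBigO_clm_comp h ((Λ.contDiff_poly (n := 0)).continuous.clm_comp continuous_const).continuousAt
  refine (h2.add h1).congr_left fun ε => ?_
  rw [ContinuousLinearMap.sub_comp]
  abel

/-- If `𝒯(ε)` agrees with `∑ A_j εʲ` to order `k - 1` only, the order `εᵏ` of `𝒯(ε) Λ(ε)` remains. -/
theorem isBigO_comp_poly (hD : D.IsIteration A k) {𝒯 : 𝕜 → B →L[𝕜] F}
    (h : (fun ε => 𝒯 ε - ∑ j ∈ Finset.range (k + 1), ε ^ j • A j) =O[𝓝 0] fun ε => ε ^ k) :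
    (fun ε => 𝒯 ε ∘L Λ.poly ε ∘L D.inclSum k) =O[𝓝 0] fun ε => ε ^ k := by
  have h1 := isBigO_comp_poly_of_isBigO Λ hD (𝒯 := fun ε => ∑ j ∈ Finset.range (k + 1), ε ^ j • A j)
    (by simpa using isBigO_zero _ _)
  have h2 : (fun ε => (𝒯 ε - ∑ j ∈ Finset.range (k + 1), ε ^ j • A j) ∘L
      (Λ.poly ε ∘L D.inclSum k)) =O[𝓝 0] fun ε => ε ^ k := by
    exact isBigO_clm_comp h ((Λ.contDiff_poly (n := 0)).continuous.clm_comp continuous_const).continuousAt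
  have h3 := isBigO_pow_smul (𝕜 := 𝕜) k (f := fun _ : 𝕜 =>
    ((Λ.Ψ : D.CoParam k →L[𝕜] F) ∘L ContinuousLinearMap.fst 𝕜 _ (D.Param k))) continuousAt_const
  refine ((h2.add (h1.trans (isBigO_pow_pow (Nat.le_succ k)))).add h3).congr_left fun ε => ?_
  rw [ContinuousLinearMap.sub_comp]
  abel

/-- The tuple `z` changed by `j! • coeff (j - s) x` for `s ≤ j ≤ s + k`, so that its curve changes
by `εˢ • poly ε x`. -/
def shiftTuple (s : ℕ) (x : Fin (k + 1) → B) (z : ℕ → B) (j : ℕ) : B :=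
  z j + if s ≤ j ∧ j ≤ s + k then (j ! : 𝕜) • Λ.coeff (j - s) x else 0

theorem curve_shiftTuple {s N : ℕ} (hs : 1 ≤ s) (hN : s + k ≤ N) (x : Fin (k + 1) → B)
    (z : ℕ → B) (ε : 𝕜) :
    curve N (Λ.shiftTuple s x z) ε = curve N z ε + ε ^ s • Λ.poly ε x := by
  simp only [curve_eq_sum, shiftTuple, smul_add, Finset.sum_add_distrib]
  congr 1
  rw [poly_apply, Finset.smul_sum, ← Finset.sum_subset (s₁ := Finset.Ico s (s + k + 1))]
  · rw [Finset.sum_Ico_eq_sum_range, show s + k + 1 - s = k + 1 by omega]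
    refine Finset.sum_congr rfl fun m hm => ?_
    rw [Finset.mem_range] at hm
    rw [if_pos (by omega), inv_smul_smul₀ (Nat.cast_ne_zero.mpr (Nat.factorial_ne_zero _)),
      smul_smul, pow_add, show s + m - s = m by omega]
  · intro j hj
    rw [Finset.mem_Ico] at hj
    rw [Finset.mem_Icc]
    omega
  · intro j _ hj
    rw [Finset.mem_Ico] at hj
    rw [if_neg (by omega), smul_zero, smul_zero]

theorem shiftTuple_of_lt {s j : ℕ} (h : j < s) (x : Fin (k + 1) → B) (z : ℕ → B) :
    Λ.shiftTuple s x z j = z j := by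
  rw [shiftTuple, if_neg (by omega), add_zero]

/-- The coefficient operator `M`: its `i`-th component is the contribution of `x` to `z_{2k+1-i}`. -/
def coeffMap : (Fin (k + 1) → B) →L[𝕜] (Fin (k + 1) → B) :=
  ContinuousLinearMap.pi fun i => ((2 * k + 1 - i)! : 𝕜) • Λ.coeff (k - i)

theorem coeffMap_apply (x : Fin (k + 1) → B) (i : Fin (k + 1)) :
    Λ.coeffMap x i = ((2 * k + 1 - i)! : 𝕜) • Λ.coeff (k - i) x := by
  simp [coeffMap]

/-- The operator `M` is block triangular. -/
theorem coeff_sub_eq (i : Fin (k + 1)) (x : Fin (k + 1) → B) :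
    Λ.coeff (k - i) x = x i + ∑ q ∈ Finset.univ.filter (fun q : Fin (k + 1) => i < q),
      Λ.V q (q - i) (x q) := by
  rw [coeff_apply, Finset.sum_filter, ← Finset.add_sum_erase _ _ (Finset.mem_univ i),
    ← Finset.add_sum_erase (a := i) _ (fun q => if i < q then _ else _) (Finset.mem_univ i),
    if_pos le_rfl, if_neg (lt_irrefl i), zero_add, Nat.sub_self, Λ.V_zero i (by omega)]
  congr 1
  refine Finset.sum_congr rfl fun q hq => ?_
  have hqi : q ≠ i := (Finset.mem_erase.mp hq).1
  have hqi' : (q : ℕ) ≠ i := fun h => hqi (Fin.ext h)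
  by_cases h : i < q
  · have h' : (i : ℕ) < q := h
    rw [if_pos h, if_pos (by omega), show k - (i : ℕ) - (k - q) = q - i by omega]
  · have h' : ¬ (i : ℕ) < q := h
    rw [if_neg h, if_neg (by omega)]

/-- By induction over the components, using the triangular form of `coeff_sub_eq`. -/
theorem coeffMap_injective : Function.Injective Λ.coeffMap := by
  rw [injective_iff_map_eq_zero]
  intro x hx
  have key : ∀ n : ℕ, ∀ i : Fin (k + 1), k - i < n → x i = 0 := by
    intro n
    induction n with
    | zero => intro i hi; omega
    | succ n ih =>
      intro i hi
      have h1 : Λ.coeff (k - i) x = 0 := by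
        have := congrFun hx i
        rw [coeffMap_apply] at this
        exact (smul_eq_zero.mp this).resolve_left (Nat.cast_ne_zero.mpr (Nat.factorial_ne_zero _))
      rw [coeff_sub_eq, Finset.sum_eq_zero, add_zero] at h1
      · exact h1
      · intro q hq
        have hq' : (i : ℕ) < q := (Finset.mem_filter.mp hq).2
        rw [ih q (by omega), map_zero]
  exact funext fun i => key (k + 1) i (by omega)

theorem coeffMap_surjective : Function.Surjective Λ.coeffMap := by
  intro w
  have key : ∀ n : ℕ, ∃ x : Fin (k + 1) → B, ∀ i : Fin (k + 1), k - i < n →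
      Λ.coeff (k - i) x = ((2 * k + 1 - i)! : 𝕜)⁻¹ • w i := by
    intro n
    induction n with
    | zero => exact ⟨0, fun i hi => by omega⟩
    | succ n ih =>
      obtain ⟨x, hx⟩ := ih
      by_cases hn : n ≤ k
      · let i₀ : Fin (k + 1) := ⟨k - n, by omega⟩
        have hi₀ : (i₀ : ℕ) = k - n := rfl
        -- a change of the component `i₀` does not affect the equations with larger index
        refine ⟨Function.update x i₀ (x i₀ +
          (((2 * k + 1 - i₀)! : 𝕜)⁻¹ • w i₀ - Λ.coeff (k - i₀) x)), fun i hi => ?_⟩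
        have hrest : ∀ i : Fin (k + 1), (i₀ : ℕ) ≤ i → ∀ b,
            ∑ q ∈ Finset.univ.filter (fun q : Fin (k + 1) => i < q),
              Λ.V q (q - i) (Function.update x i₀ b q)
            = ∑ q ∈ Finset.univ.filter (fun q : Fin (k + 1) => i < q), Λ.V q (q - i) (x q) := by
          intro i hi b
          refine Finset.sum_congr rfl fun q hq => ?_
          have hq' : (i : ℕ) < q := (Finset.mem_filter.mp hq).2
          rw [Function.update_of_ne]
          intro h
          rw [h] at hq'
          omega
        by_cases h : i = i₀
        · subst h
          rw [coeff_sub_eq, hrest _ le_rfl, Function.update_self, coeff_sub_eq]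
          abel
        · have h' : (i : ℕ) ≠ i₀ := fun h1 => h (Fin.ext h1)
          rw [← hx i (by omega), coeff_sub_eq, hrest _ (by omega), Function.update_of_ne h]
          exact (Λ.coeff_sub_eq i x).symm
      · exact ⟨x, fun i hi => hx i (by omega)⟩
  obtain ⟨x, hx⟩ := key (k + 1)
  refine ⟨x, funext fun i => ?_⟩
  rw [coeffMap_apply, hx i (by omega),
    smul_inv_smul₀ (Nat.cast_ne_zero.mpr (Nat.factorial_ne_zero _))]

/-- The isomorphism `M` of `B^{k+1}`. -/
def coeffEquiv [CompleteSpace B] : (Fin (k + 1) → B) ≃L[𝕜] (Fin (k + 1) → B) :=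
  ContinuousLinearEquiv.ofBijective Λ.coeffMap (LinearMap.ker_eq_bot.mpr Λ.coeffMap_injective)
    (LinearMap.range_eq_top.mpr Λ.coeffMap_surjective)

theorem coeffEquiv_apply [CompleteSpace B] (x : Fin (k + 1) → B) (i : Fin (k + 1)) :
    Λ.coeffEquiv x i = ((2 * k + 1 - i)! : 𝕜) • Λ.coeff (k - i) x :=
  Λ.coeffMap_apply x i

theorem shiftTuple_eq_coeffEquiv [CompleteSpace B] (x : Fin (k + 1) → B) (z : ℕ → B)
    (i : Fin (k + 1)) :
    Λ.shiftTuple (k + 1) x z (2 * k + 1 - i) = z (2 * k + 1 - i) + Λ.coeffEquiv x i := by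
  rw [shiftTuple, if_pos (by omega), coeffEquiv_apply,
    show 2 * k + 1 - (i : ℕ) - (k + 1) = k - i by omega]

end LiftSystem
end IterationData
end UndeterminedCoefficients

/-! ### Expansion of `G + c H` along a curve -/

namespace UndeterminedCoefficients

variable {𝕜 : Type*} [RCLike 𝕜]
  {B : Type*} [NormedAddCommGroup B] [NormedSpace 𝕜 B]
  {F : Type*} [NormedAddCommGroup F] [NormedSpace 𝕜 F]

/-- A factor `εᵐ` can be cancelled from an estimate, also at `ε = 0` by continuity. -/
theorem isBigO_of_pow_smul {W : Type*} [NormedAddCommGroup W] [NormedSpace 𝕜 W] {f : 𝕜 → W}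
    (hf : ContinuousAt f 0) {m j : ℕ}
    (h : (fun ε : 𝕜 => ε ^ m • f ε) =O[𝓝 0] fun ε => ε ^ (m + j)) :
    f =O[𝓝 0] fun ε => ε ^ j := by
  obtain ⟨C, hC⟩ := h.bound
  have hne : ∀ᶠ ε in 𝓝[≠] (0 : 𝕜), ‖f ε‖ ≤ C * ‖ε ^ j‖ := by
    filter_upwards [self_mem_nhdsWithin, nhdsWithin_le_nhds hC] with ε hε h1
    rw [norm_smul, pow_add, norm_mul] at h1
    have : 0 < ‖ε ^ m‖ := norm_pos_iff.mpr (pow_ne_zero m hε)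
    refine le_of_mul_le_mul_left ?_ this
    linarith
  have h0 : ‖f 0‖ ≤ C * ‖(0 : 𝕜) ^ j‖ := by
    have t2 : Tendsto (fun ε : 𝕜 => C * ‖ε ^ j‖) (𝓝[≠] 0) (𝓝 (C * ‖(0 : 𝕜) ^ j‖)) :=
      (Continuous.tendsto (by fun_prop) 0).mono_left nhdsWithin_le_nhds
    exact le_of_tendsto_of_tendsto (hf.norm.tendsto.mono_left nhdsWithin_le_nhds) t2 hne
  refine IsBigO.of_bound C ?_
  filter_upwards [eventually_nhdsWithin_iff.mp hne] with ε hε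
  rcases eq_or_ne ε 0 with rfl | h
  · exact h0
  · exact hε h

theorem eq_zero_of_isBigO_pow {W : Type*} [NormedAddCommGroup W] {f : 𝕜 → W} {j : ℕ} (hj : 1 ≤ j)
    (h : f =O[𝓝 0] fun ε : 𝕜 => ε ^ j) : f 0 = 0 := by
  obtain ⟨C, hC⟩ := h.bound
  have := hC.self_of_nhds
  rw [zero_pow (by omega), norm_zero, mul_zero] at this
  exact norm_le_zero_iff.mp this

/-- The perturbation `G + c H`. -/
def pert (G H : B → F) (c : 𝕜) (z : B) : F := G z + c • H z

/-- The derivative of the perturbation `G + c H`. -/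
def dpert (G H : B → F) (c : 𝕜) (z : B) : B →L[𝕜] F := fderiv 𝕜 G z + c • fderiv 𝕜 H z

theorem pert_zero (G H : B → F) (z : B) : pert G H (0 : 𝕜) z = G z := by simp [pert]

theorem analyticAt_pert {G H : B → F} (hG : AnalyticAt 𝕜 G 0) (hH : AnalyticAt 𝕜 H 0) (c : 𝕜) :
    AnalyticAt 𝕜 (fun z => G z + c • H z) 0 := hG.fun_add (analyticAt_const.fun_smul hH)

variable [CompleteSpace F]

/-- Quadratic remainder of `G + c H` at increments from a given bounded set, after division by the
square of a small factor. -/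
theorem exists_scaled_remainder {G H : B → F} (hG : AnalyticAt 𝕜 G 0) (hH : AnalyticAt 𝕜 H 0) :
    ∃ δ > 0, ∀ X > 0, ∃ σ > 0, ∃ C K : ℝ, ∃ L : 𝕜 × (𝕜 × B × B) → F,
      ∀ s ∈ ball (0 : 𝕜) σ, ∀ c ∈ ball (0 : 𝕜) δ, ∀ a ∈ ball (0 : B) δ, ∀ u ∈ ball (0 : B) X,
        ContDiffAt 𝕜 ω L (s, (c, a, u)) ∧ ‖L (s, (c, a, u))‖ ≤ C ∧
        (∀ u' ∈ ball (0 : B) X, ‖L (s, (c, a, u)) - L (s, (c, a, u'))‖ ≤ K * ‖u - u'‖) ∧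
        pert G H c (a + s • u) = pert G H c a + s • dpert G H c a u + s ^ 2 • L (s, (c, a, u)) := by
  obtain ⟨L, hL, hLe⟩ := exists_analyticAt_quadratic_remainder hG hH
  obtain ⟨K, t, ht, hK⟩ := (hL.contDiffAt (n := 1)).exists_lipschitzOnWith
  have hbd : ∀ᶠ v in 𝓝 (0 : 𝕜 × (𝕜 × B × B)), ‖L v‖ < ‖L 0‖ + 1 :=
    hL.continuousAt.norm.eventually_lt continuousAt_const (lt_add_one _)
  obtain ⟨δ, hδ, hb⟩ := Metric.eventually_nhds_iff_ball.mp
    ((hLe.and hL.eventually_analyticAt).and (hbd.and (show ∀ᶠ v in 𝓝 _, v ∈ t from ht)))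
  refine ⟨δ, hδ, fun X hX => ?_⟩
  set R : ℝ := X / δ with hR
  have hR0 : 0 < R := by positivity
  have hRk : (R : 𝕜) ≠ 0 := RCLike.ofReal_ne_zero.mpr hR0.ne'
  have hRn : ‖(R : 𝕜)‖ = R := by rw [RCLike.norm_ofReal, abs_of_pos hR0]
  let S : 𝕜 × (𝕜 × B × B) → 𝕜 × (𝕜 × B × B) := fun v =>
    (v.1 * R, (v.2.1, v.2.2.1, (R : 𝕜)⁻¹ • v.2.2.2))
  have hmem : ∀ s ∈ ball (0 : 𝕜) (δ / R), ∀ c ∈ ball (0 : 𝕜) δ, ∀ a ∈ ball (0 : B) δ,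
      ∀ u ∈ ball (0 : B) X, S (s, (c, a, u)) ∈ ball (0 : 𝕜 × (𝕜 × B × B)) δ := by
    intro s hs c hc a ha u hu
    rw [mem_ball_zero_iff] at *
    simp only [S, Prod.norm_def, max_lt_iff, norm_mul, norm_smul, norm_inv, hRn]
    refine ⟨(lt_div_iff₀ hR0).mp hs, hc, ha, ?_⟩
    rw [inv_mul_lt_iff₀ hR0, hR, div_mul_cancel₀ _ hδ.ne']
    exact hu
  refine ⟨δ / R, by positivity, R ^ 2 * (‖L 0‖ + 1), R ^ 2 * (K * R⁻¹),
    fun v => ((R : 𝕜) ^ 2) • L (S v), ?_⟩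
  intro s hs c hc a ha u hu
  have hm := hmem s hs c hc a ha u hu
  obtain ⟨⟨h1, h2⟩, h3, h4⟩ := hb _ hm
  refine ⟨?_, ?_, ?_, ?_⟩
  · have hS : ContDiffAt 𝕜 ω S (s, (c, a, u)) := by
      refine ContDiff.contDiffAt ?_
      fun_prop
    exact contDiffAt_const.smul (ContDiffAt.fun_comp _ h2.contDiffAt hS)
  · rw [norm_smul, norm_pow, hRn]
    gcongr
  · intro u' hu'
    have hm' := hmem s hs c hc a ha u' hu'
    have h5 := hK.dist_le_mul _ h4 _ (hb _ hm').2.2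
    rw [dist_eq_norm, dist_eq_norm] at h5
    rw [← smul_sub, norm_smul, norm_pow, hRn, mul_assoc]
    have h6 : ‖S (s, (c, a, u)) - S (s, (c, a, u'))‖ = R⁻¹ * ‖u - u'‖ := by
      simp only [S, Prod.norm_def, Prod.fst_sub, Prod.snd_sub, sub_self, norm_zero, ← smul_sub,
        norm_smul, norm_inv, hRn]
      rw [max_eq_right, max_eq_right, max_eq_right] <;> positivity
    rw [h6] at h5
    rw [mul_assoc]
    gcongr
  · have h7 : (s * (R : 𝕜)) • ((R : 𝕜)⁻¹ • u) = s • u := by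
      rw [smul_smul, mul_assoc, mul_inv_cancel₀ hRk, mul_one]
    simp only [S, h7] at h1
    rw [sub_eq_iff_eq_add, sub_eq_iff_eq_add] at h1
    rw [← map_smul, h7, map_smul] at h1
    simp only [pert, dpert]
    rw [h1, smul_smul, mul_pow]
    abel

/-- The remainder of `G + c H` at the increment `εᵐ u(ε)` along a curve is of order `2m`. -/
theorem isBigO_remainder {G H : B → F} (hG : AnalyticAt 𝕜 G 0) (hH : AnalyticAt 𝕜 H 0) :
    ∃ δ > 0, ∀ c ∈ ball (0 : 𝕜) δ, ∀ {a u : 𝕜 → B}, Tendsto a (𝓝 0) (𝓝 0) → ContinuousAt u 0 →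
      ∀ {m : ℕ}, 1 ≤ m →
      (fun ε : 𝕜 => pert G H c (a ε + ε ^ m • u ε) - pert G H c (a ε)
        - ε ^ m • dpert G H c (a ε) (u ε)) =O[𝓝 0] fun ε => ε ^ (2 * m) := by
  obtain ⟨δ, hδ, h⟩ := exists_scaled_remainder hG hH
  refine ⟨δ, hδ, fun c hc a u ha hu m hm => ?_⟩
  obtain ⟨σ, hσ, C, K, L, hL⟩ := h (‖u 0‖ + 1) (by positivity)
  refine IsBigO.of_bound C ?_
  have h1 : ∀ᶠ ε : 𝕜 in 𝓝 0, ε ^ m ∈ ball (0 : 𝕜) σ := by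
    have : Tendsto (fun ε : 𝕜 => ε ^ m) (𝓝 0) (𝓝 0) :=
      Continuous.tendsto' (by fun_prop) _ _ (zero_pow (by omega))
    exact this.eventually_mem (ball_mem_nhds _ hσ)
  have h2 : ∀ᶠ ε : 𝕜 in 𝓝 0, u ε ∈ ball (0 : B) (‖u 0‖ + 1) := by
    filter_upwards [hu.norm.eventually_lt continuousAt_const (lt_add_one _)] with ε hε
    rwa [mem_ball_zero_iff]
  filter_upwards [h1, h2, ha.eventually_mem (ball_mem_nhds _ hδ)] with ε h3 h4 h5
  obtain ⟨-, h6, -, h7⟩ := hL _ h3 c hc _ h5 _ h4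
  have e : ∀ a b c : F, a + b + c - a - b = c := fun a b c => by abel
  rw [h7, e, norm_smul, ← pow_mul, mul_comm m 2,
    mul_comm]
  gcongr

/-- The linearization along a curve that agrees with `ε z̄₁ + ⋯ + (1/k!) εᵏ z̄ₖ` to some order. -/
theorem isBigO_fderiv_comp_sub_sum {G : B → F} (hG : AnalyticAt 𝕜 G 0) {k : ℕ} {zbar : ℕ → B}
    {P : 𝕜 → B} (hP : Tendsto P (𝓝 0) (𝓝 0)) {m : ℕ} (hm : m ≤ k + 1)
    (h : (fun ε => P ε - curve k zbar ε) =O[𝓝 0] fun ε => ε ^ m) :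
    (fun ε : 𝕜 => fderiv 𝕜 G (P ε)
      - ∑ j ∈ Finset.range (k + 1), ε ^ j • linCoeff 𝕜 G k zbar j) =O[𝓝 0] fun ε => ε ^ m := by
  have h1 := (AnalyticAt.isBigO_comp_sub_comp hG.fderiv hP (tendsto_curve k zbar)).trans h
  have h2 := (isBigO_fderiv_curve_sub_sum hG k zbar (k + 1)).trans (isBigO_pow_pow hm)
  refine (h1.add h2).congr_left fun ε => ?_
  abel

namespace IterationData
namespace LiftSystem

variable {D : IterationData 𝕜 B F} {G H : B → F} {k : ℕ} {zbar : ℕ → B}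

omit [CompleteSpace F] in
theorem isBigO_apply {V : Type*} [NormedAddCommGroup V] [NormedSpace 𝕜 V] {T : 𝕜 → V →L[𝕜] F}
    {m : ℕ} (hT : T =O[𝓝 0] fun ε : 𝕜 => ε ^ m) (v : V) :
    (fun ε => T ε v) =O[𝓝 0] fun ε : 𝕜 => ε ^ m := by
  obtain ⟨C, hC⟩ := hT.bound
  refine IsBigO.of_bound (C * ‖v‖) ?_
  filter_upwards [hC] with ε h
  calc ‖T ε v‖ ≤ ‖T ε‖ * ‖v‖ := (T ε).le_opNorm v
    _ ≤ C * ‖ε ^ m‖ * ‖v‖ := by gcongr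
    _ = _ := by ring

omit [CompleteSpace F] in
theorem continuousAt_poly_apply {A : ℕ → B →L[𝕜] F} (Λ : LiftSystem D A k)
    (x : Fin (k + 1) → B) : ContinuousAt (fun ε : 𝕜 => Λ.poly ε x) 0 :=
  ((Λ.contDiff_poly (n := 0)).continuous.clm_apply continuous_const).continuousAt

/-- Effect of `ε^{k+1} Λ(ε) (y + n)` on the coefficient of `ε^{2k+1}`. -/
theorem isBigO_comp_add_poly (hG : AnalyticAt 𝕜 G 0)
    (hD : D.IsIteration (linCoeff 𝕜 G k zbar) k) (Λ : LiftSystem D (linCoeff 𝕜 G k zbar) k)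
    {P : 𝕜 → B} (hP : Tendsto P (𝓝 0) (𝓝 0))
    (h : (fun ε => P ε - curve k zbar ε) =O[𝓝 0] fun ε => ε ^ (k + 1))
    (x : D.CoParam k × D.Param k) :
    (fun ε : 𝕜 => G (P ε + ε ^ (k + 1) • Λ.poly ε (D.inclSum k x)) - G (P ε)
      - ε ^ (2 * k + 1) • Λ.Ψ x.1) =O[𝓝 0] fun ε => ε ^ (2 * k + 2) := by
  obtain ⟨δ, hδ, hrem⟩ := isBigO_remainder hG hG
  have h1 := hrem (0 : 𝕜) (mem_ball_self hδ) hP (Λ.continuousAt_poly_apply (D.inclSum k x))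
    (Nat.succ_le_succ (Nat.zero_le k))
  have h2 := isBigO_apply (Λ.isBigO_comp_poly_of_isBigO hD
    (isBigO_fderiv_comp_sub_sum hG hP le_rfl h)) x
  have h3 := (isBigO_refl (fun ε : 𝕜 => ε ^ (k + 1)) (𝓝 0)).smul h2
  simp only [pert_zero, dpert, zero_smul, add_zero] at h1
  have h4 : (fun ε : 𝕜 => ε ^ (k + 1) • ε ^ (k + 1)) = fun ε => ε ^ (2 * k + 2) := by
    funext ε; rw [smul_eq_mul, ← pow_add]; congr 1; omega
  rw [h4] at h3
  rw [show 2 * (k + 1) = 2 * k + 2 by ring] at h1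
  refine (h1.add h3).congr_left fun ε => ?_
  simp only [sub_apply, smul_apply, ContinuousLinearMap.comp_apply, smul_sub, smul_smul,
    ← pow_add, ContinuousLinearMap.coe_fst', ContinuousLinearEquiv.coe_coe]
  rw [show k + 1 + k = 2 * k + 1 by ring]
  abel

/-- An element of `X̄_{2k}` can be changed to an element of `X̄_{2k+1}`. -/
theorem exists_mem_Xbar (hG : AnalyticAt 𝕜 G 0) (hG0 : G 0 = 0)
    (hD : D.IsIteration (linCoeff 𝕜 G k zbar) k) (Λ : LiftSystem D (linCoeff 𝕜 G k zbar) k)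
    (hz : (Xbar 𝕜 G k zbar (2 * k)).Nonempty) : (Xbar 𝕜 G k zbar (2 * k + 1)).Nonempty := by
  obtain ⟨z, hzX, hzk⟩ := hz
  rw [mem_X_iff hG hG0 (Nat.le_succ (2 * k))] at hzX
  have han := analyticAt_comp_curve hG (2 * k + 1) z
  obtain ⟨ψ, hψ, hψe⟩ : ∃ ψ : 𝕜 → F, AnalyticAt 𝕜 ψ 0 ∧
      ∀ᶠ ε in 𝓝 (0 : 𝕜), G (curve (2 * k + 1) z ε) = (ε - 0) ^ (2 * k + 1) • ψ ε := by
    rw [← natCast_le_analyticOrderAt han, natCast_le_analyticOrderAt_iff_iteratedDeriv_eq_zero han,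
      ← isBigO_pow_iff_iteratedDeriv_eq_zero han]
    exact hzX
  refine ⟨Λ.shiftTuple (k + 1) (D.inclSum k (-Λ.Ψ.symm (ψ 0), 0)) z, ?_, fun i h1 h2 => ?_⟩
  · rw [mem_X_iff hG hG0 le_rfl]
    simp only [Λ.curve_shiftTuple (show 1 ≤ k + 1 by omega) (show k + 1 + k ≤ 2 * k + 1 by omega)]
    have h1 := Λ.isBigO_comp_add_poly hG hD (P := fun ε => curve (2 * k + 1) z ε)
      (tendsto_curve _ _) (isBigO_curve_sub_curve le_rfl (by omega) hzk)
      (-Λ.Ψ.symm (ψ 0), (0 : D.Param k))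
    have h2 : (fun ε : 𝕜 => ε ^ (2 * k + 1) • (ψ ε - ψ 0)) =O[𝓝 0] fun ε => ε ^ (2 * k + 2) := by
      have := (isBigO_refl (fun ε : 𝕜 => ε ^ (2 * k + 1)) (𝓝 0)).smul
        hψ.differentiableAt.isBigO_sub
      simpa [← pow_succ] using this
    refine (h1.add h2).congr' ?_ EventuallyEq.rfl
    filter_upwards [hψe] with ε hε
    rw [hε, sub_zero, map_neg, ContinuousLinearEquiv.apply_symm_apply, smul_neg, smul_sub]
    abel
  · rw [Λ.shiftTuple_of_lt (by omega)]
    exact hzk i h1 h2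

/-- The curve with coefficients `z` changed by `εᵏ Λ(ε) y(c)`. -/
def pertCurve {A : ℕ → B →L[𝕜] F} (Λ : LiftSystem D A k) (z : ℕ → B) (yc : 𝕜 → D.CoParam k)
    (v : 𝕜 × 𝕜) : B :=
  curve (2 * k + 1) z v.1 + v.1 ^ k • Λ.poly v.1 (D.inclNc k (yc v.2))

variable [CompleteSpace B]

omit [CompleteSpace B] in
theorem contDiffAt_pertCurve {A : ℕ → B →L[𝕜] F} (Λ : LiftSystem D A k) (z : ℕ → B)
    {yc : 𝕜 → D.CoParam k} {v : 𝕜 × 𝕜} [CompleteSpace B] (hyc : ContDiffAt 𝕜 ω yc v.2) :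
    ContDiffAt 𝕜 ω (Λ.pertCurve z yc) v := by
  have h1 : ContDiffAt 𝕜 ω (fun v : 𝕜 × 𝕜 => curve (2 * k + 1) z v.1) v :=
    ContDiffAt.fun_comp (f := Prod.fst) v (analyticAt_curve _ _ _).contDiffAt contDiffAt_fst
  have h2 : ContDiffAt 𝕜 ω (fun v : 𝕜 × 𝕜 => Λ.poly v.1) v :=
    ContDiffAt.fun_comp (f := Prod.fst) v Λ.contDiff_poly.contDiffAt contDiffAt_fst
  have h3 : ContDiffAt 𝕜 ω (fun v : 𝕜 × 𝕜 => D.inclNc k (yc v.2)) v :=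
    (D.inclNc k).contDiff.contDiffAt.fun_comp v (ContDiffAt.fun_comp v hyc contDiffAt_snd)
  exact h1.add ((contDiffAt_fst.pow k).smul (h2.clm_apply h3))

theorem contDiffAt_pert_comp (hG : AnalyticAt 𝕜 G 0) (hH : AnalyticAt 𝕜 H 0) {V : Type*}
    [NormedAddCommGroup V] [NormedSpace 𝕜 V] {c : V → 𝕜} {z : V → B} {v : V}
    (hc : ContDiffAt 𝕜 ω c v) (hz : ContDiffAt 𝕜 ω z v) (h0 : z v = 0) :
    ContDiffAt 𝕜 ω (fun v => pert G H (c v) (z v)) v ∧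
      ContDiffAt 𝕜 ω (fun v => dpert G H (c v) (z v)) v := by
  have key : ∀ {W : Type _} [NormedAddCommGroup W] [NormedSpace 𝕜 W] [CompleteSpace W] {g : B → W},
      AnalyticAt 𝕜 g 0 → ContDiffAt 𝕜 ω (fun v => g (z v)) v := fun hg =>
    ContDiffAt.fun_comp v (by rw [h0]; exact hg.contDiffAt) hz
  have key' : ∀ {g : B → F}, AnalyticAt 𝕜 g 0 → ContDiffAt 𝕜 ω (fun v => fderiv 𝕜 g (z v)) v :=
    fun hg => ContDiffAt.fun_comp v (by rw [h0]; exact hg.fderiv.contDiffAt) hz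
  exact ⟨(key hG).add (hc.smul (key hH)), (key' hG).add (hc.smul (key' hH))⟩

theorem completeSpace_coParam (hD : D.IsIteration (linCoeff 𝕜 G k zbar) k) :
    CompleteSpace (D.CoParam k) := by
  have hc1 : ∀ i : Fin (k + 1), CompleteSpace (D.Nc (i + 1)) := fun i =>
    (hD.Nc_closed i (by omega)).completeSpace_coe
  infer_instance

theorem completeSpace_param (hD : D.IsIteration (linCoeff 𝕜 G k zbar) k) :
    CompleteSpace (D.Param k) := by
  have hc1 : ∀ i : Fin (k + 1), CompleteSpace (D.N (i + 1)) := fun i =>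
    (hD.isClosed_N (i + 1) (by omega)).completeSpace_coe
  infer_instance

end LiftSystem
end IterationData
end UndeterminedCoefficients

/-! ### The base curve of the perturbed equation -/

namespace UndeterminedCoefficients

variable {𝕜 : Type*} [RCLike 𝕜]
  {B : Type*} [NormedAddCommGroup B] [NormedSpace 𝕜 B]
  {F : Type*} [NormedAddCommGroup F] [NormedSpace 𝕜 F]

namespace IterationData
namespace LiftSystem

variable {D : IterationData 𝕜 B F} {G H : B → F} {k : ℕ} {zbar : ℕ → B}
  [CompleteSpace B] [CompleteSpace F]

theorem isBigO_H_comp (hO : H =O[𝓝 0] fun z => ‖z‖ ^ (2 * k)) {P : 𝕜 → B}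
    (hP : Tendsto P (𝓝 0) (𝓝 0)) (hP' : P =O[𝓝 0] fun ε => ε) :
    (fun ε => H (P ε)) =O[𝓝 0] fun ε : 𝕜 => ε ^ (2 * k) :=
  isBigO_norm_pow_comp hO hP hP'

theorem isBigO_id_of_sub_curve {P : 𝕜 → B} {m : ℕ} (hm : 1 ≤ m)
    (h : (fun ε => P ε - curve k zbar ε) =O[𝓝 0] fun ε => ε ^ m) :
    P =O[𝓝 0] (fun ε => ε) ∧ Tendsto P (𝓝 0) (𝓝 0) := by
  have h1 : P =O[𝓝 0] fun ε : 𝕜 => ε := by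
    have h2 := (h.trans (isBigO_pow_pow hm)).congr_right (g₂ := fun ε : 𝕜 => ε) (by simp)
    refine (h2.add (isBigO_curve k zbar)).congr_left fun ε => ?_
    abel
  exact ⟨h1, h1.trans_tendsto (continuous_id.tendsto 0)⟩

/-- The perturbation does not lower the order `εᵏ` of the linearization applied to the lifts,
since `H'` is of order `2k - 1 ≥ k`. -/
theorem isBigO_dpert_comp_poly (hk : 1 ≤ k) (hG : AnalyticAt 𝕜 G 0) (hH : AnalyticAt 𝕜 H 0)
    (hO : H =O[𝓝 0] fun z => ‖z‖ ^ (2 * k))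
    (hD : D.IsIteration (linCoeff 𝕜 G k zbar) k) (Λ : LiftSystem D (linCoeff 𝕜 G k zbar) k)
    {P : 𝕜 → B} (h : (fun ε => P ε - curve k zbar ε) =O[𝓝 0] fun ε => ε ^ k) (c : 𝕜) :
    (fun ε => dpert G H c (P ε) ∘L Λ.poly ε ∘L D.inclSum k) =O[𝓝 0] fun ε => ε ^ k := by
  obtain ⟨hP', hP⟩ := isBigO_id_of_sub_curve hk h
  refine Λ.isBigO_comp_poly hD ?_
  have h1 := isBigO_fderiv_comp_sub_sum hG hP (Nat.le_succ k) h
  have h2 : (fun ε => fderiv 𝕜 H (P ε)) =O[𝓝 0] fun ε => ε ^ k := by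
    obtain ⟨k, rfl⟩ : ∃ l, k = l + 1 := ⟨k - 1, by omega⟩
    have h3 := isBigO_fderiv (m := 2 * k + 1) hH hO
    exact (isBigO_norm_pow_comp h3 hP hP').trans (isBigO_pow_pow (by omega))
  refine (h1.add (h2.const_smul_left c)).congr_left fun ε => ?_
  simp only [dpert, Pi.smul_apply]
  abel

/-- A curve `P` along which `G + c H` is of order `2k` retains this property if a term
`εᵏ Λ(ε) x` is added. -/
theorem isBigO_pert_add_poly (hk : 1 ≤ k) (hG : AnalyticAt 𝕜 G 0) (hH : AnalyticAt 𝕜 H 0)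
    (hO : H =O[𝓝 0] fun z => ‖z‖ ^ (2 * k))
    (hD : D.IsIteration (linCoeff 𝕜 G k zbar) k) (Λ : LiftSystem D (linCoeff 𝕜 G k zbar) k)
    {P : 𝕜 → B} (h : (fun ε => P ε - curve k zbar ε) =O[𝓝 0] fun ε => ε ^ k)
    (hG2 : (fun ε => G (P ε)) =O[𝓝 0] fun ε : 𝕜 => ε ^ (2 * k))
    (c : 𝕜) (x : D.CoParam k × D.Param k) :
    (fun ε => pert G H c (P ε + ε ^ k • Λ.poly ε (D.inclSum k x)))
      =O[𝓝 0] fun ε => ε ^ (2 * k) := by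
  obtain ⟨hP', hP⟩ := isBigO_id_of_sub_curve hk h
  obtain ⟨δ, hδ, hrem⟩ := isBigO_remainder hG hH
  have h1 := hrem 0 (mem_ball_self hδ) hP (Λ.continuousAt_poly_apply (D.inclSum k x)) hk
  have h2 := isBigO_apply (isBigO_dpert_comp_poly hk hG hH hO hD Λ h 0) x
  have h3 := (isBigO_refl (fun ε : 𝕜 => ε ^ k) (𝓝 0)).smul h2
  have h4 : (fun ε : 𝕜 => ε ^ k • ε ^ k) = fun ε => ε ^ (2 * k) := by
    funext ε; rw [smul_eq_mul, ← pow_add]; congr 1; omega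
  rw [h4] at h3
  simp only [pert_zero] at h1
  have h5 : (fun ε => H (P ε + ε ^ k • Λ.poly ε (D.inclSum k x))) =O[𝓝 0]
      fun ε : 𝕜 => ε ^ (2 * k) := by
    have h6 : (fun ε => (P ε + ε ^ k • Λ.poly ε (D.inclSum k x)) - curve k zbar ε) =O[𝓝 0]
        fun ε => ε ^ k := by
      refine (h.add (isBigO_pow_smul k (Λ.continuousAt_poly_apply (D.inclSum k x)))).congr_left
        fun ε => ?_
      abel
    obtain ⟨h7, h8⟩ := isBigO_id_of_sub_curve hk h6
    exact isBigO_H_comp hO h8 h7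
  refine (((h1.add h3).add hG2).add (h5.const_smul_left c)).congr_left fun ε => ?_
  simp only [pert, Pi.smul_apply, ContinuousLinearMap.comp_apply]
  abel

/-- The equation along `z + εᵏ Λ(ε) y`, divided by `ε^{2k}`, is solved to leading order by
`y = y(c)`: its derivative with respect to `y` at `ε = c = 0` is the isomorphism `Ψ`, and the
implicit function theorem applies. -/
theorem exists_perturbed_base (hk : 1 ≤ k) (hG : AnalyticAt 𝕜 G 0) (hG0 : G 0 = 0)
    (hH : AnalyticAt 𝕜 H 0) (hO : H =O[𝓝 0] fun z => ‖z‖ ^ (2 * k))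
    (hD : D.IsIteration (linCoeff 𝕜 G k zbar) k) (Λ : LiftSystem D (linCoeff 𝕜 G k zbar) k)
    {z : ℕ → B} (hz : z ∈ Xbar 𝕜 G k zbar (2 * k + 1)) :
    ∃ (yc : 𝕜 → D.CoParam k) (h : 𝕜 × 𝕜 → F), ContDiffAt 𝕜 ω yc 0 ∧ yc 0 = 0 ∧
      AnalyticAt 𝕜 h 0 ∧ ∀ᶠ v in 𝓝 (0 : 𝕜 × 𝕜),
        pert G H v.2 (Λ.pertCurve z yc v) = v.1 ^ (2 * k + 1) • h v := by
  have hcomp := completeSpace_coParam hD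
  have hzX : (fun ε : 𝕜 => G (curve (2 * k + 1) z ε)) =O[𝓝 0] fun ε => ε ^ (2 * k + 2) :=
    (mem_X_iff hG hG0 le_rfl z).mp hz.1
  have hzc : (fun ε : 𝕜 => curve (2 * k + 1) z ε - curve k zbar ε) =O[𝓝 0]
      fun ε => ε ^ (k + 1) := isBigO_curve_sub_curve le_rfl (by omega) hz.2
  let f : 𝕜 × (𝕜 × D.CoParam k) → F := fun v =>
    pert G H v.2.1 (curve (2 * k + 1) z v.1 + v.1 ^ k • Λ.poly v.1 (D.inclNc k v.2.2))
  have hf : AnalyticAt 𝕜 f 0 := by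
    have h1 : ContDiffAt 𝕜 ω (fun v : 𝕜 × (𝕜 × D.CoParam k) => curve (2 * k + 1) z v.1) 0 :=
      ContDiffAt.fun_comp (f := Prod.fst) _ (analyticAt_curve _ _ _).contDiffAt contDiffAt_fst
    have h2 : ContDiffAt 𝕜 ω (fun v : 𝕜 × (𝕜 × D.CoParam k) => Λ.poly v.1) 0 :=
      ContDiffAt.fun_comp (f := Prod.fst) _ Λ.contDiff_poly.contDiffAt contDiffAt_fst
    have h3 : ContDiffAt 𝕜 ω (fun v : 𝕜 × (𝕜 × D.CoParam k) => D.inclNc k v.2.2) 0 := by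
      fun_prop
    have h4 : ContDiffAt 𝕜 ω (fun v : 𝕜 × (𝕜 × D.CoParam k) => v.2.1) 0 := by fun_prop
    refine (contDiffAt_pert_comp hG hH h4
      (h1.add ((contDiffAt_fst.pow k).smul (h2.clm_apply h3))) ?_).1.analyticAt
    simp [curve_zero, show k ≠ 0 by omega]
  obtain ⟨ψ, hψ, hfψ⟩ := exists_analyticAt_eq_pow_smul hf (2 * k) (Eventually.of_forall fun x => by
    have := isBigO_pert_add_poly hk hG hH hO hD Λ (hzc.trans (isBigO_pow_pow (Nat.le_succ k)))
      (hzX.trans (isBigO_pow_pow (by omega))) x.1 (x.2, 0)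
    simpa only [inclSum_left] using this)
  -- the derivative of `ψ` at `0` is found along the curves `ε ↦ (ε, 0, ε y)`, on which the equation
  -- is that for the increment `ε^{k+1} Λ(ε) y`, whose leading coefficient is `Ψ y`
  have hψd : HasFDerivAt ψ (fderiv 𝕜 ψ 0) 0 := hψ.differentiableAt.hasFDerivAt
  have hpath : ∀ y : D.CoParam k, ψ 0 = 0 ∧ fderiv 𝕜 ψ 0 (1, (0, y)) = Λ.Ψ y := by
    intro y
    let p : 𝕜 → 𝕜 × (𝕜 × D.CoParam k) := fun ε => (ε, (0, ε • y))
    have hp0 : p 0 = 0 := by simp [p]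
    have hpc : Tendsto p (𝓝 0) (𝓝 0) := by
      have : Continuous p := by fun_prop
      exact this.tendsto' _ _ hp0
    have hpd : HasDerivAt p (1, (0, y)) 0 := by
      refine (hasDerivAt_id (0 : 𝕜)).prodMk ((hasDerivAt_const _ _).prodMk ?_)
      simpa using (hasDerivAt_id (0 : 𝕜)).smul_const y
    have h1 := Λ.isBigO_comp_add_poly hG hD (P := fun ε => curve (2 * k + 1) z ε)
      (tendsto_curve _ _) hzc (y, (0 : D.Param k))
    have h2 : (fun ε : 𝕜 => ε ^ (2 * k) • (ψ (p ε) - ε • Λ.Ψ y)) =O[𝓝 0]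
        fun ε => ε ^ (2 * k + 2) := by
      refine (h1.add hzX).congr' ?_ EventuallyEq.rfl
      filter_upwards [hpc.eventually hfψ] with ε hε
      simp only [f, p, pert_zero] at hε
      rw [smul_sub, ← hε, inclSum_left, map_smul, map_smul, smul_smul, smul_smul, ← pow_succ,
        ← pow_succ]
      abel
    have hca : ContinuousAt (fun ε => ψ (p ε) - ε • Λ.Ψ y) 0 := by
      refine ContinuousAt.sub ?_ (by fun_prop)
      exact ContinuousAt.comp (by rw [hp0]; exact hψ.continuousAt) hpd.continuousAt
    have h3 := isBigO_of_pow_smul hca h2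
    have h0 : ψ 0 = 0 := by
      have := eq_zero_of_isBigO_pow (by norm_num) h3
      simpa [hp0] using this
    refine ⟨h0, ?_⟩
    have hd1 : HasDerivAt (fun ε => ψ (p ε)) (fderiv 𝕜 ψ 0 (1, (0, y))) 0 :=
      HasFDerivAt.comp_hasDerivAt_of_eq (0 : 𝕜) hψd hpd hp0.symm
    have hd2 : HasDerivAt (fun ε => ψ (p ε)) (Λ.Ψ y) 0 := by
      rw [hasDerivAt_iff_isLittleO]
      simp only [hp0, h0, sub_zero]
      refine h3.trans_isLittleO ?_
      simpa using (isLittleO_pow_pow (𝕜 := 𝕜) (show 1 < 2 by norm_num))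
    exact hd1.unique hd2
  have hψ0 : ψ 0 = 0 := (hpath 0).1
  have hψy : ∀ y, fderiv 𝕜 ψ 0 (0, (0, y)) = Λ.Ψ y := by
    intro y
    have h1 := (hpath y).2
    have h2 := (hpath 0).2
    rw [map_zero] at h2
    have : ((1, (0, y)) : 𝕜 × (𝕜 × D.CoParam k)) = (0, (0, y)) + (1, (0, 0)) := by simp
    rw [this, map_add, h2, add_zero] at h1
    exact h1
  let f₀ : 𝕜 × D.CoParam k → F := fun x => ψ (0, x)
  have hf₀ : ContDiffAt 𝕜 ω f₀ 0 :=
    ContDiffAt.fun_comp (f := fun x : 𝕜 × D.CoParam k => ((0 : 𝕜), x)) 0 hψ.contDiffAt (by fun_prop)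
  have hinv : (fderiv 𝕜 f₀ 0 ∘L ContinuousLinearMap.inr 𝕜 𝕜 (D.CoParam k)).IsInvertible := by
    refine ⟨Λ.Ψ, ?_⟩
    have hd : HasFDerivAt f₀ (fderiv 𝕜 ψ 0 ∘L ContinuousLinearMap.inr 𝕜 𝕜 (𝕜 × D.CoParam k)) 0 :=
      HasFDerivAt.comp (0 : 𝕜 × D.CoParam k) (f := fun x => ((0 : 𝕜), x)) hψd
        ((hasFDerivAt_const _ _).prodMk (hasFDerivAt_id _))
    rw [hd.fderiv]
    refine ContinuousLinearMap.ext fun y => ?_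
    exact (hψy y).symm
  set yc := hf₀.implicitFunction (by simp) hinv with hyc
  have hyc0 : yc 0 = 0 := hf₀.implicitFunction_apply_self (by simp) hinv
  have hycc : ContDiffAt 𝕜 ω yc 0 := hf₀.contDiffAt_implicitFunction (by simp) hinv
  have hyce : ∀ᶠ c in 𝓝 (0 : 𝕜), ψ (0, (c, yc c)) = 0 := by
    have h0 : f₀ 0 = 0 := hψ0
    filter_upwards [hf₀.eventually_apply_implicitFunction (by simp) hinv] with c hc
    rw [h0] at hc
    exact hc
  let q : 𝕜 × 𝕜 → 𝕜 × (𝕜 × D.CoParam k) := fun v => (v.1, (v.2, yc v.2))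
  have hq0 : q 0 = 0 := by simp [q, hyc0]
  have hqc : ContDiffAt 𝕜 ω q 0 :=
    contDiffAt_fst.prodMk (contDiffAt_snd.prodMk (ContDiffAt.fun_comp _ hycc contDiffAt_snd))
  have hψq : AnalyticAt 𝕜 (fun v => ψ (q v)) 0 :=
    (ContDiffAt.fun_comp _ (by rw [hq0]; exact hψ.contDiffAt) hqc).analyticAt
  obtain ⟨h, hh, hhe⟩ := exists_analyticAt_sub_eq_smul hψq
  refine ⟨yc, h, hycc, hyc0, hh, ?_⟩
  have hqt : Tendsto q (𝓝 0) (𝓝 0) := by simpa [hq0] using hqc.continuousAt.tendsto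
  have hst : Tendsto (fun v : 𝕜 × 𝕜 => v.2) (𝓝 0) (𝓝 0) := continuous_snd.tendsto' _ _ rfl
  filter_upwards [hhe, hqt.eventually hfψ, hst.eventually hyce] with v h1 h2 h3
  rw [show ψ (q (0, v.2)) = 0 from h3, sub_zero] at h1
  have : pert G H v.2 (Λ.pertCurve z yc v) = v.1 ^ (2 * k) • ψ (q v) := h2
  rw [this, h1, smul_smul, pow_succ]

theorem isBigO_pertCurve_sub_curve {A : ℕ → B →L[𝕜] F} (Λ : LiftSystem D A k) (hk : 1 ≤ k) {z : ℕ → B}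
    (hz : ∀ i, 1 ≤ i → i ≤ k → z i = zbar i) (yc : 𝕜 → D.CoParam k) (c : 𝕜) :
    (fun ε => Λ.pertCurve z yc (ε, c) - curve k zbar ε) =O[𝓝 0] fun ε : 𝕜 => ε ^ k := by
  have h1 : (fun ε : 𝕜 => curve (2 * k + 1) z ε - curve k zbar ε) =O[𝓝 0]
      fun ε => ε ^ (k + 1) := isBigO_curve_sub_curve le_rfl (by omega) hz
  refine ((h1.trans (isBigO_pow_pow (Nat.le_succ k))).add
    (isBigO_pow_smul k (Λ.continuousAt_poly_apply (D.inclNc k (yc c))))).congr_left fun ε => ?_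
  rw [pertCurve]
  abel

/-- Near `0`, the equation for `G + c H` and its linearization along the perturbed curve are, up to
powers of `ε`, analytic in `(ε, c)`. -/
theorem exists_reduction (hk : 1 ≤ k) (hG : AnalyticAt 𝕜 G 0) (hG0 : G 0 = 0)
    (hH : AnalyticAt 𝕜 H 0) (hO : H =O[𝓝 0] fun z => ‖z‖ ^ (2 * k))
    (hD : D.IsIteration (linCoeff 𝕜 G k zbar) k) (Λ : LiftSystem D (linCoeff 𝕜 G k zbar) k)
    {z : ℕ → B} (hz : z ∈ Xbar 𝕜 G k zbar (2 * k + 1)) :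
    ∃ (yc : 𝕜 → D.CoParam k) (h : 𝕜 × 𝕜 → F) (T : 𝕜 × 𝕜 → (D.CoParam k × D.Param k) →L[𝕜] F),
      ContDiffAt 𝕜 ω yc 0 ∧ yc 0 = 0 ∧ AnalyticAt 𝕜 h 0 ∧ h 0 = 0 ∧ AnalyticAt 𝕜 T 0 ∧
      T 0 = (Λ.Ψ : D.CoParam k →L[𝕜] F) ∘L ContinuousLinearMap.fst 𝕜 _ _ ∧
      ∀ᶠ v in 𝓝 (0 : 𝕜 × 𝕜),
        pert G H v.2 (Λ.pertCurve z yc v) = v.1 ^ (2 * k + 1) • h v ∧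
        dpert G H v.2 (Λ.pertCurve z yc v) ∘L Λ.poly v.1 ∘L D.inclSum k = v.1 ^ k • T v := by
  obtain ⟨yc, h, hyc, hyc0, hh, hhe⟩ := exists_perturbed_base hk hG hG0 hH hO hD Λ hz
  have hP0 : Λ.pertCurve z yc 0 = 0 := by simp [pertCurve, curve_zero, show k ≠ 0 by omega]
  have hP : ContDiffAt 𝕜 ω (Λ.pertCurve z yc) 0 := Λ.contDiffAt_pertCurve z hyc
  let f : 𝕜 × 𝕜 → (D.CoParam k × D.Param k) →L[𝕜] F := fun v =>
    dpert G H v.2 (Λ.pertCurve z yc v) ∘L Λ.poly v.1 ∘L D.inclSum k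
  have hf : AnalyticAt 𝕜 f 0 := by
    have h1 := (contDiffAt_pert_comp hG hH contDiffAt_snd hP hP0).2
    have h2 : ContDiffAt 𝕜 ω (fun v : 𝕜 × 𝕜 => Λ.poly v.1) 0 :=
      ContDiffAt.fun_comp (f := Prod.fst) _ Λ.contDiff_poly.contDiffAt contDiffAt_fst
    exact (h1.clm_comp (h2.clm_comp contDiffAt_const)).analyticAt
  obtain ⟨T, hT, hTe⟩ := exists_analyticAt_eq_pow_smul hf k (Eventually.of_forall fun c =>
    isBigO_dpert_comp_poly hk hG hH hO hD Λ (Λ.isBigO_pertCurve_sub_curve hk hz.2 yc c) c)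
  have hPz : ∀ ε : 𝕜, Λ.pertCurve z yc (ε, 0) = curve (2 * k + 1) z ε := by
    intro ε; simp [pertCurve, hyc0]
  have hit : Tendsto (fun ε : 𝕜 => (ε, (0 : 𝕜))) (𝓝 0) (𝓝 0) :=
    Continuous.tendsto' (by fun_prop) _ _ rfl
  refine ⟨yc, h, T, hyc, hyc0, hh, ?_, hT, ?_, hhe.and hTe⟩
  · have h1 : (fun ε : 𝕜 => G (curve (2 * k + 1) z ε)) =O[𝓝 0] fun ε => ε ^ (2 * k + 1 + 1) :=
      (mem_X_iff hG hG0 le_rfl z).mp hz.1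
    have h2 : (fun ε : 𝕜 => ε ^ (2 * k + 1) • h (ε, 0)) =O[𝓝 0] fun ε => ε ^ (2 * k + 1 + 1) := by
      refine h1.congr' ?_ EventuallyEq.rfl
      filter_upwards [hit.eventually hhe] with ε hε
      rw [pert_zero, hPz] at hε
      exact hε
    have h3 : ContinuousAt (fun ε : 𝕜 => h (ε, 0)) 0 :=
      ContinuousAt.comp (f := fun ε : 𝕜 => (ε, (0 : 𝕜))) hh.continuousAt (by fun_prop)
    exact eq_zero_of_isBigO_pow le_rfl (isBigO_of_pow_smul h3 h2)
  · have hzc : (fun ε : 𝕜 => curve (2 * k + 1) z ε - curve k zbar ε) =O[𝓝 0]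
        fun ε => ε ^ (k + 1) := isBigO_curve_sub_curve le_rfl (by omega) hz.2
    have h1 := Λ.isBigO_comp_poly_of_isBigO hD
      (isBigO_fderiv_comp_sub_sum hG (tendsto_curve (𝕜 := 𝕜) (2 * k + 1) z) le_rfl hzc)
    have h2 : (fun ε : 𝕜 => ε ^ k • (T (ε, 0) - (Λ.Ψ : D.CoParam k →L[𝕜] F) ∘L
        ContinuousLinearMap.fst 𝕜 _ _)) =O[𝓝 0] fun ε => ε ^ (k + 1) := by
      refine h1.congr' ?_ EventuallyEq.rfl
      filter_upwards [hit.eventually hTe] with ε hε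
      simp only [f, hPz, dpert, zero_smul, add_zero] at hε
      rw [smul_sub, ← hε]
    have h3 : ContinuousAt (fun ε : 𝕜 => T (ε, 0) - (Λ.Ψ : D.CoParam k →L[𝕜] F) ∘L
        ContinuousLinearMap.fst 𝕜 _ (D.Param k)) 0 :=
      ContinuousAt.sub (ContinuousAt.comp (f := fun ε : 𝕜 => (ε, (0 : 𝕜))) hT.continuousAt
        (by fun_prop)) continuousAt_const
    have h4 := eq_zero_of_isBigO_pow le_rfl
      (isBigO_of_pow_smul (W := (D.CoParam k × D.Param k) →L[𝕜] F) (m := k) (j := 1) h3 (by exact h2))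
    exact sub_eq_zero.mp h4

end LiftSystem
end IterationData
end UndeterminedCoefficients

/-! ### Reduction to a uniform contraction -/

namespace UndeterminedCoefficients

variable {𝕜 : Type*} [RCLike 𝕜]
  {B : Type*} [NormedAddCommGroup B] [NormedSpace 𝕜 B]
  {F : Type*} [NormedAddCommGroup F] [NormedSpace 𝕜 F]

/-- `ContDiffAt` with exponent `ω` persists near the point, with a common bound of the values. -/
theorem eventually_contDiffAt_norm_le {V W : Type*} [NormedAddCommGroup V] [NormedSpace 𝕜 V]
    [NormedAddCommGroup W] [NormedSpace 𝕜 W] [CompleteSpace W] {f : V → W} {x : V}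
    (hf : ContDiffAt 𝕜 ω f x) : ∀ᶠ v in 𝓝 x, ContDiffAt 𝕜 ω f v ∧ ‖f v‖ ≤ ‖f x‖ + 1 := by
  filter_upwards [hf.analyticAt.eventually_analyticAt,
    hf.continuousAt.norm.eventually_lt continuousAt_const (lt_add_one _)] with v h1 h2
  exact ⟨h1.contDiffAt, h2.le⟩

namespace IterationData
namespace LiftSystem

variable {D : IterationData 𝕜 B F} {G H : B → F} {k : ℕ} {zbar : ℕ → B}

/-- The curve with coefficients determined by `c`, the parameters `n`, and `y`. -/
def familyCurve {A : ℕ → B →L[𝕜] F} (Λ : LiftSystem D A k) (z : ℕ → B) (yc : 𝕜 → D.CoParam k)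
    (ylin : 𝕜 → D.Param k → D.CoParam k) (c ε : 𝕜) (n : D.Param k) (y : D.CoParam k) : B :=
  Λ.pertCurve z yc (ε, c) + ε ^ (k + 1) • Λ.poly ε (D.inclSum k (ylin c n + y, n))

/-- The dependent variable `y` solves the equation for `G + c H`; for `ε = 0`, where the
equation is void, its limit `y = 0` is required. -/
def IsSol {A : ℕ → B →L[𝕜] F} (Λ : LiftSystem D A k) (G H : B → F) (z : ℕ → B)
    (yc : 𝕜 → D.CoParam k) (ylin : 𝕜 → D.Param k → D.CoParam k) (c ε : 𝕜) (n : D.Param k)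
    (y : D.CoParam k) : Prop :=
  (ε = 0 → y = 0) ∧ (ε ≠ 0 → pert G H c (Λ.familyCurve z yc ylin c ε n y) = 0)

variable [CompleteSpace B] [CompleteSpace F]

set_option maxHeartbeats 1600000 in
/-- For bounded parameters `n` and small `ε`, the equation is equivalent to a fixed point equation
for `y` in the unit ball that is uniformly contracting. The bound on `c` does not depend on the
bound on `n`, since the part of `y` that is linear in `n` is split off as `ylin c n`. -/
theorem exists_contraction (hk : 1 ≤ k) (hG : AnalyticAt 𝕜 G 0) (hG0 : G 0 = 0)
    (hH : AnalyticAt 𝕜 H 0) (hO : H =O[𝓝 0] fun z => ‖z‖ ^ (2 * k))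
    (hD : D.IsIteration (linCoeff 𝕜 G k zbar) k) (Λ : LiftSystem D (linCoeff 𝕜 G k zbar) k)
    {z : ℕ → B} (hz : z ∈ Xbar 𝕜 G k zbar (2 * k + 1)) :
    ∃ c₀ > 0, ∃ (yc : 𝕜 → D.CoParam k) (ylin : 𝕜 → D.Param k → D.CoParam k)
      (Tc : 𝕜 → D.CoParam k →L[𝕜] F),
      yc 0 = 0 ∧ (∀ c ∈ ball (0 : 𝕜) c₀, ContDiffAt 𝕜 ∞ yc c) ∧ (∀ n, ylin 0 n = 0) ∧
      (∀ c ∈ ball (0 : 𝕜) c₀, ∀ n,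
        ContDiffAt 𝕜 ∞ (fun p : 𝕜 × D.Param k => ylin p.1 p.2) (c, n)) ∧
      ∀ r > 0, ∃ ε₀ > 0, ∃ Q : ℝ, ∃ g : (𝕜 × 𝕜 × D.Param k) × D.CoParam k → D.CoParam k,
        ∀ c ∈ ball (0 : 𝕜) c₀, ∀ ε ∈ ball (0 : 𝕜) ε₀, ∀ n ∈ ball (0 : D.Param k) r,
        ∀ y ∈ ball (0 : D.CoParam k) 1,
          ContDiffAt 𝕜 ∞ g ((c, ε, n), y) ∧ ‖g ((c, ε, n), y)‖ ≤ 1 / 2 ∧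
          (∀ y' ∈ ball (0 : D.CoParam k) 1,
            ‖g ((c, ε, n), y) - g ((c, ε, n), y')‖ ≤ 1 / 2 * ‖y - y'‖) ∧
          (g ((c, ε, n), y) = y ↔ Λ.IsSol G H z yc ylin c ε n y) ∧
          ‖pert G H c (Λ.familyCurve z yc ylin c ε n y) - ε ^ (2 * k + 1) • Tc c y‖
            ≤ Q * ‖ε‖ ^ (2 * k + 2) := by
  have hcomp := completeSpace_coParam hD
  have hcompP := completeSpace_param hD
  obtain ⟨yc, h, T, hyc, hyc0, hh, hh0, hT, hT0, hred⟩ :=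
    exists_reduction hk hG hG0 hH hO hD Λ hz
  obtain ⟨h1, hh1, hh1e⟩ := exists_analyticAt_sub_eq_smul hh
  obtain ⟨T1, hT1, hT1e⟩ := exists_analyticAt_sub_eq_smul hT
  obtain ⟨δL, hδL, hrem⟩ := exists_scaled_remainder hG hH
  -- the parts at `ε = 0`
  let h0 : 𝕜 → F := fun c => h (0, c)
  let T0 : 𝕜 → (D.CoParam k × D.Param k) →L[𝕜] F := fun c => T (0, c)
  let Tc : 𝕜 → D.CoParam k →L[𝕜] F := fun c => T0 c ∘L ContinuousLinearMap.inl 𝕜 _ _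
  let Φ : 𝕜 → F →L[𝕜] D.CoParam k := fun c => (Tc c).inverse
  have hh0c : ContDiffAt 𝕜 ω h0 0 :=
    ContDiffAt.fun_comp (f := fun c : 𝕜 => ((0 : 𝕜), c)) 0 hh.contDiffAt (by fun_prop)
  have hT0c : ContDiffAt 𝕜 ω T0 0 :=
    ContDiffAt.fun_comp (f := fun c : 𝕜 => ((0 : 𝕜), c)) 0 hT.contDiffAt (by fun_prop)
  have hTcc : ContDiffAt 𝕜 ω Tc 0 := hT0c.clm_comp contDiffAt_const
  have hTc0 : Tc 0 = (Λ.Ψ : D.CoParam k →L[𝕜] F) := by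
    have : T0 0 = (Λ.Ψ : D.CoParam k →L[𝕜] F) ∘L ContinuousLinearMap.fst 𝕜 _ _ := hT0
    refine ContinuousLinearMap.ext fun y => ?_
    simp [Tc, this]
  have hΦc : ContDiffAt 𝕜 ω Φ 0 := by
    refine ContDiffAt.fun_comp (f := Tc) 0 ?_ hTcc
    rw [hTc0]
    exact contDiffAt_map_inverse Λ.Ψ
  have hinv : ∀ᶠ c in 𝓝 (0 : 𝕜), (Tc c).IsInvertible := by
    have : ∀ᶠ S in 𝓝 (Tc 0), S.IsInvertible := by
      rw [hTc0]
      exact Λ.Ψ.nhds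
    exact hTcc.continuousAt.eventually this
  have hP0 : Λ.pertCurve z yc 0 = 0 := by simp [pertCurve, curve_zero, show k ≠ 0 by omega]
  have hP : ContDiffAt 𝕜 ω (Λ.pertCurve z yc) 0 := Λ.contDiffAt_pertCurve z hyc
  have hPb : ∀ᶠ v in 𝓝 (0 : 𝕜 × 𝕜), Λ.pertCurve z yc v ∈ ball (0 : B) δL := by
    refine hP.continuousAt.eventually_mem ?_
    rw [hP0]; exact ball_mem_nhds _ hδL
  let p : 𝕜 → (D.CoParam k × D.Param k) →L[𝕜] B := fun ε => Λ.poly ε ∘L D.inclSum k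
  have hp : ContDiff 𝕜 ω p := Λ.contDiff_poly.clm_comp contDiff_const
  have hfst : Tendsto (fun v : 𝕜 × 𝕜 => v.1) (𝓝 0) (𝓝 0) := continuous_fst.tendsto' _ _ rfl
  have hsnd : Tendsto (fun v : 𝕜 × 𝕜 => v.2) (𝓝 0) (𝓝 0) := continuous_snd.tendsto' _ _ rfl
  obtain ⟨δ, hδ, hb⟩ := Metric.eventually_nhds_iff_ball.mp
    ((((hred.and hh1e).and (hT1e.and hPb)).and
      (((eventually_contDiffAt_norm_le hh1.contDiffAt).and
        (eventually_contDiffAt_norm_le hT1.contDiffAt)).and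
        (eventually_contDiffAt_norm_le hP))).and
      (((hsnd.eventually ((eventually_contDiffAt_norm_le hh0c).and
        (eventually_contDiffAt_norm_le hT0c))).and
        (hsnd.eventually ((eventually_contDiffAt_norm_le hΦc).and
        (eventually_contDiffAt_norm_le hyc)))).and
      ((hsnd.eventually (hinv.and (ball_mem_nhds (0 : 𝕜) hδL))).and
        (hfst.eventually (eventually_contDiffAt_norm_le (hp.contDiffAt (x := 0)))))))
  -- a common bound for the coefficient functions
  set C : ℝ := max (max (‖h1 0‖ + 1) (‖T1 0‖ + 1)) (max (max (‖h0 0‖ + 1) (‖T0 0‖ + 1))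
    (max (‖Φ 0‖ + 1) (‖p 0‖ + 1))) with hC
  have hC0 : 0 < C := lt_of_lt_of_le (by positivity) (le_max_left _ _ |>.trans (le_max_left _ _))
  have hCh1 : ‖h1 0‖ + 1 ≤ C := (le_max_left _ _).trans (le_max_left _ _)
  have hCT1 : ‖T1 0‖ + 1 ≤ C := (le_max_right _ _).trans (le_max_left _ _)
  have hCh0 : ‖h0 0‖ + 1 ≤ C :=
    ((le_max_left _ _).trans (le_max_left _ _)).trans (le_max_right _ _)
  have hCT0 : ‖T0 0‖ + 1 ≤ C :=
    ((le_max_right _ _).trans (le_max_left _ _)).trans (le_max_right _ _)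
  have hCΦ : ‖Φ 0‖ + 1 ≤ C :=
    ((le_max_left _ _).trans (le_max_right _ _)).trans (le_max_right _ _)
  have hCp : ‖p 0‖ + 1 ≤ C :=
    ((le_max_right _ _).trans (le_max_right _ _)).trans (le_max_right _ _)
  have hcmem : ∀ c ∈ ball (0 : 𝕜) δ, ((0 : 𝕜), c) ∈ ball (0 : 𝕜 × 𝕜) δ := by
    intro c hc
    rw [mem_ball_zero_iff] at hc ⊢
    rw [Prod.norm_def, norm_zero]
    exact max_lt hδ hc
  let ylin : 𝕜 → D.Param k → D.CoParam k := fun c n => -Φ c (h0 c + T0 c (0, n))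
  have hylin : ∀ c ∈ ball (0 : 𝕜) δ, ∀ n,
      ContDiffAt 𝕜 ω (fun p : 𝕜 × D.Param k => ylin p.1 p.2) (c, n) := by
    intro c hc n
    obtain ⟨-, ⟨⟨hb1, hb2⟩, ⟨hb3, -⟩⟩, -⟩ := hb _ (hcmem c hc)
    have f1 : ContDiffAt 𝕜 ω (fun p : 𝕜 × D.Param k => h0 p.1) (c, n) :=
      ContDiffAt.fun_comp _ hb1.1 contDiffAt_fst
    have f2 : ContDiffAt 𝕜 ω (fun p : 𝕜 × D.Param k => T0 p.1) (c, n) :=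
      ContDiffAt.fun_comp _ hb2.1 contDiffAt_fst
    have f3 : ContDiffAt 𝕜 ω (fun p : 𝕜 × D.Param k => Φ p.1) (c, n) :=
      ContDiffAt.fun_comp _ hb3.1 contDiffAt_fst
    exact (f3.clm_apply (f1.add (f2.clm_apply (contDiffAt_const.prodMk contDiffAt_snd)))).neg
  refine ⟨δ, hδ, yc, ylin, Tc, hyc0, ?_, ?_, ?_, ?_⟩
  · intro c hc
    obtain ⟨-, ⟨-, ⟨-, hb4⟩⟩, -⟩ := hb _ (hcmem c hc)
    exact hb4.1.of_le le_top
  · intro n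
    have e1 : h0 0 = 0 := hh0
    have e2 : T0 0 = (Λ.Ψ : D.CoParam k →L[𝕜] F) ∘L ContinuousLinearMap.fst 𝕜 _ _ := hT0
    simp [ylin, e1, e2]
  · intro c hc n
    exact (hylin c hc n).of_le le_top
  intro r hr
  -- bounds for `x = (ylin + y, n)` and for the coefficient curve
  set Y : ℝ := C * (C + C * r) with hY
  have hY0 : 0 < Y := by positivity
  set X : ℝ := Y + 1 + r with hX
  have hX0 : 0 < X := by positivity
  obtain ⟨σ, hσ, CL, KL, L, hL⟩ := hrem (C * X + 1) (by positivity)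
  set Q : ℝ := C + C * X + |CL| with hQ
  have hQ0 : 0 < Q := by positivity
  -- `W` bounds `Φ q` and its Lipschitz constant in `y`
  set W : ℝ := C * (Q + C + |KL| * C) with hW
  have hW0 : 0 < W := by positivity
  -- the equation divided by `ε^{2k+1}` is `Tc y + ε q = 0`
  let q : (𝕜 × 𝕜 × D.Param k) × D.CoParam k → F := fun v =>
    h1 (v.1.2.1, v.1.1) + T1 (v.1.2.1, v.1.1) (ylin v.1.1 v.1.2.2 + v.2, v.1.2.2)
      + L (v.1.2.1 ^ (k + 1), (v.1.1, Λ.pertCurve z yc (v.1.2.1, v.1.1),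
        p v.1.2.1 (ylin v.1.1 v.1.2.2 + v.2, v.1.2.2)))
  refine ⟨min (min δ 1) (min σ (1 / (2 * (W + 1)))), by positivity, Q,
    fun v => -(v.1.2.1 • Φ v.1.1 (q v)), ?_⟩
  intro c hc ε hε n hn y hy
  have hεn : ‖ε‖ < min (min δ 1) (min σ (1 / (2 * (W + 1)))) := mem_ball_zero_iff.mp hε
  have hεδ : ‖ε‖ < δ := hεn.trans_le ((min_le_left _ _).trans (min_le_left _ _))
  have hε1 : ‖ε‖ < 1 := hεn.trans_le ((min_le_left _ _).trans (min_le_right _ _))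
  have hεσ : ‖ε‖ < σ := hεn.trans_le ((min_le_right _ _).trans (min_le_left _ _))
  have hεW : ‖ε‖ * W ≤ 1 / 2 := by
    have h2 : ‖ε‖ ≤ 1 / (2 * (W + 1)) :=
      (hεn.trans_le ((min_le_right _ _).trans (min_le_right _ _))).le
    calc ‖ε‖ * W ≤ 1 / (2 * (W + 1)) * (W + 1) := by gcongr; linarith
      _ = 1 / 2 := by field_simp
  have hvmem : (ε, c) ∈ ball (0 : 𝕜 × 𝕜) δ := by
    rw [mem_ball_zero_iff, Prod.norm_def, max_lt_iff]
    exact ⟨hεδ, mem_ball_zero_iff.mp hc⟩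
  obtain ⟨⟨⟨⟨⟨e1, e2⟩, e3⟩, e4, e5⟩, ⟨⟨b1, b2⟩, b3⟩⟩, ⟨⟨b4, b5⟩, b6, -⟩, ⟨b7, b8⟩, b9⟩ :=
    hb _ hvmem
  have hεk : ε ^ (k + 1) ∈ ball (0 : 𝕜) σ := by
    rw [mem_ball_zero_iff, norm_pow]
    exact (pow_le_of_le_one (norm_nonneg _) hε1.le (Nat.succ_ne_zero k)).trans_lt hεσ
  have hn' : ‖n‖ < r := mem_ball_zero_iff.mp hn
  have hyl : ‖ylin c n‖ ≤ Y := by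
    have h2 : ‖T0 c (0, n)‖ ≤ C * r := by
      refine ((T0 c).le_opNorm _).trans ?_
      have : ‖((0, n) : D.CoParam k × D.Param k)‖ ≤ r := by simp [Prod.norm_def, hn'.le]
      exact mul_le_mul (b5.2.trans hCT0) this (norm_nonneg _) hC0.le
    calc ‖ylin c n‖ = ‖Φ c (h0 c + T0 c (0, n))‖ := norm_neg _
      _ ≤ ‖Φ c‖ * ‖h0 c + T0 c (0, n)‖ := (Φ c).le_opNorm _
      _ ≤ C * (C + C * r) := by
          refine mul_le_mul (b6.2.trans hCΦ) ?_ (norm_nonneg _) hC0.le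
          exact (norm_add_le _ _).trans (add_le_add (b4.2.trans hCh0) h2)
  have hx : ∀ y ∈ ball (0 : D.CoParam k) 1, ‖(ylin c n + y, n)‖ ≤ X := by
    intro y hy
    rw [mem_ball_zero_iff] at hy
    rw [Prod.norm_def]
    refine max_le ?_ (by linarith)
    exact (norm_add_le _ _).trans (by linarith)
  have hu : ∀ y ∈ ball (0 : D.CoParam k) 1, p ε (ylin c n + y, n) ∈ ball (0 : B) (C * X + 1) := by
    intro y hy
    rw [mem_ball_zero_iff]
    refine lt_of_le_of_lt ?_ (lt_add_one _)
    exact ((p ε).le_opNorm _).trans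
      (mul_le_mul (b9.2.trans hCp) (hx y hy) (norm_nonneg _) hC0.le)
  have hqn : ‖q ((c, ε, n), y)‖ ≤ Q := by
    obtain ⟨-, l2, -, -⟩ := hL _ hεk c b8 _ e5 _ (hu y hy)
    refine (norm_add₃_le).trans ?_
    refine add_le_add (add_le_add (b1.2.trans hCh1) ?_) (l2.trans (le_abs_self _))
    exact ((T1 (ε, c)).le_opNorm _).trans
      (mul_le_mul (b2.2.trans hCT1) (hx y hy) (norm_nonneg _) hC0.le)
  have heq : pert G H c (Λ.familyCurve z yc ylin c ε n y)
      = ε ^ (2 * k + 1) • (Tc c y + ε • q ((c, ε, n), y)) := by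
    obtain ⟨-, -, -, l4⟩ := hL _ hεk c b8 _ e5 _ (hu y hy)
    have e6 : dpert G H c (Λ.pertCurve z yc (ε, c)) (p ε (ylin c n + y, n))
        = ε ^ k • T (ε, c) (ylin c n + y, n) := by
      exact congrArg (fun S => S (ylin c n + y, n)) e2
    have e7 : h0 c + T0 c (ylin c n + y, n) = Tc c y := by
      have hinl : ∀ w, Tc c w = T0 c (w, 0) := fun w => rfl
      have hs : Tc c (ylin c n) = -(h0 c + T0 c (0, n)) := by
        show Tc c (-Φ c (h0 c + T0 c (0, n))) = _
        rw [map_neg]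
        congr 1
        obtain ⟨e, he⟩ := b7
        simp only [Φ, ← he, ContinuousLinearMap.inverse_equiv]
        simp
      have hsplit : ((ylin c n + y, n) : D.CoParam k × D.Param k)
          = (ylin c n, 0) + (y, 0) + (0, n) := by simp
      rw [hsplit, map_add, map_add, ← hinl, ← hinl, hs]
      abel
    have e8 : h (ε, c) = h0 c + ε • h1 (ε, c) := by
      rw [← sub_eq_iff_eq_add']; exact e3
    have e9 : T (ε, c) = T0 c + ε • T1 (ε, c) := by
      rw [← sub_eq_iff_eq_add']; exact e4
    have e10 : Λ.familyCurve z yc ylin c ε n y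
        = Λ.pertCurve z yc (ε, c) + ε ^ (k + 1) • p ε (ylin c n + y, n) := rfl
    have e11 : q ((c, ε, n), y) = h1 (ε, c) + T1 (ε, c) (ylin c n + y, n)
        + L (ε ^ (k + 1), (c, Λ.pertCurve z yc (ε, c), p ε (ylin c n + y, n))) := rfl
    rw [e10, l4, e1, e6, e8, e9, ← e7, e11, add_apply,
      smul_apply]
    generalize h1 (ε, c) = w₁
    generalize T1 (ε, c) (ylin c n + y, n) = w₂
    generalize T0 c (ylin c n + y, n) = w₃
    generalize h0 c = w₄
    generalize L _ = w₅
    module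
  have hΦT : ∀ w f, Tc c w = f ↔ w = Φ c f := by
    obtain ⟨e, he⟩ := b7
    intro w f
    simp only [Φ, ← he, ContinuousLinearMap.inverse_equiv]
    exact (e.eq_symm_apply).symm
  refine ⟨?_, ?_, ?_, ?_, ?_⟩
  · refine ContDiffAt.of_le (n := ω) ?_ le_top
    set v₀ : (𝕜 × 𝕜 × D.Param k) × D.CoParam k := ((c, ε, n), y)
    have s1 : ContDiffAt 𝕜 ω
        (fun v : (𝕜 × 𝕜 × D.Param k) × D.CoParam k => ((v.1.2.1, v.1.1) : 𝕜 × 𝕜)) v₀ := by fun_prop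
    have s2 : ContDiffAt 𝕜 ω
        (fun v : (𝕜 × 𝕜 × D.Param k) × D.CoParam k => ((v.1.1, v.1.2.2) : 𝕜 × D.Param k)) v₀ := by
      fun_prop
    have s3 : ContDiffAt 𝕜 ω (fun v : (𝕜 × 𝕜 × D.Param k) × D.CoParam k =>
        ylin v.1.1 v.1.2.2) v₀ := ContDiffAt.fun_comp v₀ (hylin c hc n) s2
    have s4 : ContDiffAt 𝕜 ω (fun v : (𝕜 × 𝕜 × D.Param k) × D.CoParam k =>
        (ylin v.1.1 v.1.2.2 + v.2, v.1.2.2)) v₀ :=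
      (s3.add contDiffAt_snd).prodMk (by fun_prop)
    have s5 : ContDiffAt 𝕜 ω (fun v : (𝕜 × 𝕜 × D.Param k) × D.CoParam k =>
        h1 (v.1.2.1, v.1.1)) v₀ := ContDiffAt.fun_comp v₀ b1.1 s1
    have s6 : ContDiffAt 𝕜 ω (fun v : (𝕜 × 𝕜 × D.Param k) × D.CoParam k =>
        T1 (v.1.2.1, v.1.1)) v₀ := ContDiffAt.fun_comp v₀ b2.1 s1
    have s7 : ContDiffAt 𝕜 ω (fun v : (𝕜 × 𝕜 × D.Param k) × D.CoParam k =>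
        Λ.pertCurve z yc (v.1.2.1, v.1.1)) v₀ := ContDiffAt.fun_comp v₀ b3.1 s1
    have s8 : ContDiffAt 𝕜 ω (fun v : (𝕜 × 𝕜 × D.Param k) × D.CoParam k => v.1.2.1) v₀ := by
      fun_prop
    have s9 : ContDiffAt 𝕜 ω (fun v : (𝕜 × 𝕜 × D.Param k) × D.CoParam k => v.1.1) v₀ := by
      fun_prop
    have s10 : ContDiffAt 𝕜 ω (fun v : (𝕜 × 𝕜 × D.Param k) × D.CoParam k => p v.1.2.1) v₀ :=
      ContDiffAt.fun_comp v₀ hp.contDiffAt s8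
    have s11 : ContDiffAt 𝕜 ω (fun v : (𝕜 × 𝕜 × D.Param k) × D.CoParam k => Φ v.1.1) v₀ :=
      ContDiffAt.fun_comp v₀ b6.1 s9
    have s12 := ContDiffAt.fun_comp v₀ (hL _ hεk c b8 _ e5 _ (hu y hy)).1
      ((s8.pow (k + 1)).prodMk (s9.prodMk (s7.prodMk (s10.clm_apply s4))))
    exact (s8.smul (s11.clm_apply ((s5.add (s6.clm_apply s4)).add s12))).neg
  · rw [norm_neg, norm_smul]
    calc ‖ε‖ * ‖Φ c (q ((c, ε, n), y))‖ ≤ ‖ε‖ * (C * Q) := by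
          gcongr
          exact ((Φ c).le_opNorm _).trans
            (mul_le_mul (b6.2.trans hCΦ) hqn (norm_nonneg _) hC0.le)
      _ ≤ ‖ε‖ * W := by
          gcongr
          rw [hW]
          gcongr
          have : 0 ≤ |KL| * C := by positivity
          linarith
      _ ≤ 1 / 2 := hεW
  · intro y' hy'
    obtain ⟨-, -, l3, -⟩ := hL _ hεk c b8 _ e5 _ (hu y hy)
    have d1 : ((ylin c n + y, n) : D.CoParam k × D.Param k) - (ylin c n + y', n) = (y - y', 0) := by
      simp
    have d2 : ‖((y - y', 0) : D.CoParam k × D.Param k)‖ = ‖y - y'‖ := by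
      simp [Prod.norm_def]
    have d3 : ‖q ((c, ε, n), y) - q ((c, ε, n), y')‖ ≤ (C + |KL| * C) * ‖y - y'‖ := by
      have : q ((c, ε, n), y) - q ((c, ε, n), y') = T1 (ε, c) (y - y', 0)
          + (L (ε ^ (k + 1), (c, Λ.pertCurve z yc (ε, c), p ε (ylin c n + y, n)))
            - L (ε ^ (k + 1), (c, Λ.pertCurve z yc (ε, c), p ε (ylin c n + y', n)))) := by
        rw [← d1, map_sub]
        simp only [q]
        abel
      rw [this, add_mul]
      refine (norm_add_le _ _).trans (add_le_add ?_ ?_)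
      · refine ((T1 (ε, c)).le_opNorm _).trans ?_
        rw [d2]
        gcongr
        exact b2.2.trans hCT1
      · refine (l3 _ (hu y' hy')).trans ?_
        rw [← map_sub, d1, mul_assoc]
        refine mul_le_mul (le_abs_self _) ?_ (norm_nonneg _) (abs_nonneg _)
        refine ((p ε).le_opNorm _).trans ?_
        rw [d2]
        gcongr
        exact b9.2.trans hCp
    calc ‖-(ε • Φ c (q ((c, ε, n), y))) - -(ε • Φ c (q ((c, ε, n), y')))‖
        = ‖ε‖ * ‖Φ c (q ((c, ε, n), y) - q ((c, ε, n), y'))‖ := by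
          rw [← neg_sub', norm_neg, ← smul_sub, norm_smul, map_sub]
      _ ≤ ‖ε‖ * (C * ((C + |KL| * C) * ‖y - y'‖)) := by
          gcongr
          exact ((Φ c).le_opNorm _).trans
            (mul_le_mul (b6.2.trans hCΦ) d3 (norm_nonneg _) hC0.le)
      _ = (‖ε‖ * (C * (C + |KL| * C))) * ‖y - y'‖ := by ring
      _ ≤ (‖ε‖ * W) * ‖y - y'‖ := by
          gcongr
          rw [hW]
          gcongr
          linarith
      _ ≤ 1 / 2 * ‖y - y'‖ := by gcongr
  · rw [IsSol, heq]
    have e11 : (-(ε • Φ c (q ((c, ε, n), y))) = y) ↔ Tc c y + ε • q ((c, ε, n), y) = 0 := by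
      rw [add_eq_zero_iff_eq_neg, hΦT, map_neg, map_smul, eq_comm]
    show (-(ε • Φ c (q ((c, ε, n), y))) = y) ↔ _
    rcases eq_or_ne ε 0 with h2 | h2
    · constructor
      · intro h3
        refine ⟨fun _ => ?_, fun h4 => absurd h2 h4⟩
        rw [← h3, h2, zero_smul, neg_zero]
      · intro h3
        rw [h3.1 h2, h2, zero_smul, neg_zero]
    · rw [e11]
      constructor
      · intro h3
        exact ⟨fun h4 => absurd h4 h2, fun _ => by rw [h3, smul_zero]⟩
      · intro h3
        exact (smul_eq_zero.mp (h3.2 h2)).resolve_left (pow_ne_zero _ h2)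
  · rw [heq, smul_add, add_sub_cancel_left, smul_smul, ← pow_succ, norm_smul, norm_pow, mul_comm]
    gcongr

end LiftSystem
end IterationData
end UndeterminedCoefficients

/-! ### Families of solution curves -/

namespace UndeterminedCoefficients

variable {𝕜 : Type*} [RCLike 𝕜]
  {B : Type*} [NormedAddCommGroup B] [NormedSpace 𝕜 B]
  {F : Type*} [NormedAddCommGroup F] [NormedSpace 𝕜 F]

namespace IterationData
namespace LiftSystem

variable {D : IterationData 𝕜 B F} {G H : B → F} {k : ℕ} {zbar : ℕ → B}
  {A : ℕ → B →L[𝕜] F} (Λ : LiftSystem D A k)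

theorem shiftTuple_zero (s : ℕ) (z : ℕ → B) : Λ.shiftTuple s 0 z = z := by
  funext j
  simp [shiftTuple]

theorem contDiffAt_shiftTuple {V : Type*} [NormedAddCommGroup V] [NormedSpace 𝕜 V] {s : ℕ}
    {n : WithTop ℕ∞} {x : V → Fin (k + 1) → B} {z : V → ℕ → B} {v : V} (hx : ContDiffAt 𝕜 n x v)
    {j : ℕ} (hz : ContDiffAt 𝕜 n (fun v => z v j) v) :
    ContDiffAt 𝕜 n (fun v => Λ.shiftTuple s (x v) (z v) j) v := by
  unfold shiftTuple
  refine hz.add ?_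
  split_ifs
  · exact contDiffAt_const.smul ((Λ.coeff (j - s)).contDiff.contDiffAt.fun_comp v hx)
  · exact contDiffAt_const

/-- The coefficients of `familyCurve`. -/
def familyTuple (z : ℕ → B) (yc : 𝕜 → D.CoParam k) (ylin : 𝕜 → D.Param k → D.CoParam k) (c : 𝕜)
    (n : D.Param k) (y : D.CoParam k) : ℕ → B :=
  Λ.shiftTuple (k + 1) (D.inclSum k (ylin c n + y, n)) (Λ.shiftTuple k (D.inclNc k (yc c)) z)

theorem curve_familyTuple (hk : 1 ≤ k) (z : ℕ → B) (yc : 𝕜 → D.CoParam k)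
    (ylin : 𝕜 → D.Param k → D.CoParam k) (c ε : 𝕜) (n : D.Param k) (y : D.CoParam k) :
    curve (2 * k + 1) (Λ.familyTuple z yc ylin c n y) ε = Λ.familyCurve z yc ylin c ε n y := by
  rw [familyTuple, Λ.curve_shiftTuple (by omega) (by omega), Λ.curve_shiftTuple hk (by omega)]
  rfl

theorem familyTuple_of_lt {j : ℕ} (hj : j < k) (z : ℕ → B) (yc : 𝕜 → D.CoParam k)
    (ylin : 𝕜 → D.Param k → D.CoParam k) (c : 𝕜) (n : D.Param k) (y : D.CoParam k) :
    Λ.familyTuple z yc ylin c n y j = z j := by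
  rw [familyTuple, Λ.shiftTuple_of_lt (by omega), Λ.shiftTuple_of_lt hj]

theorem familyTuple_self (z : ℕ → B) (yc : 𝕜 → D.CoParam k)
    (ylin : 𝕜 → D.Param k → D.CoParam k) (c : 𝕜) (n : D.Param k) (y : D.CoParam k) :
    Λ.familyTuple z yc ylin c n y k = z k + (k ! : 𝕜) • Λ.coeff 0 (D.inclNc k (yc c)) := by
  rw [familyTuple, Λ.shiftTuple_of_lt (by omega), shiftTuple, if_pos (by omega), Nat.sub_self]

open Classical in
/-- The solution `y = n^c(c, ε, n)` in the unit ball, or `0` if there is none. It is a choice made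
pointwise; on each region where the solution is unique it agrees with the smooth family of fixed
points, hence these families for different regions fit together. -/
def solution (G H : B → F) (z : ℕ → B) (yc : 𝕜 → D.CoParam k)
    (ylin : 𝕜 → D.Param k → D.CoParam k) (c ε : 𝕜) (n : D.Param k) : D.CoParam k :=
  if h : ∃ y ∈ ball (0 : D.CoParam k) 1, Λ.IsSol G H z yc ylin c ε n y then h.choose else 0

theorem solution_mem (G H : B → F) (z : ℕ → B) (yc : 𝕜 → D.CoParam k)
    (ylin : 𝕜 → D.Param k → D.CoParam k) (c ε : 𝕜) (n : D.Param k) :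
    Λ.solution G H z yc ylin c ε n ∈ ball (0 : D.CoParam k) 1 := by
  unfold solution
  split_ifs with h
  · exact h.choose_spec.1
  · exact mem_ball_self one_pos

theorem solution_zero (G H : B → F) (z : ℕ → B) (yc : 𝕜 → D.CoParam k)
    (ylin : 𝕜 → D.Param k → D.CoParam k) (c : 𝕜) (n : D.Param k) :
    Λ.solution G H z yc ylin c 0 n = 0 := by
  unfold solution
  split_ifs with h
  · exact h.choose_spec.2.1 rfl
  · rfl

theorem solution_eq {G H : B → F} {z : ℕ → B} {yc : 𝕜 → D.CoParam k}
    {ylin : 𝕜 → D.Param k → D.CoParam k} {c ε : 𝕜} {n : D.Param k} {y₀ : D.CoParam k}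
    (h₀ : y₀ ∈ ball (0 : D.CoParam k) 1)
    (h : ∀ y ∈ ball (0 : D.CoParam k) 1, Λ.IsSol G H z yc ylin c ε n y ↔ y = y₀) :
    Λ.solution G H z yc ylin c ε n = y₀ := by
  have hex : ∃ y ∈ ball (0 : D.CoParam k) 1, Λ.IsSol G H z yc ylin c ε n y :=
    ⟨y₀, h₀, (h y₀ h₀).mpr rfl⟩
  rw [solution, dif_pos hex]
  exact (h _ hex.choose_spec.1).mp hex.choose_spec.2

/-- For `c = 0` the perturbation is irrelevant. -/
theorem solution_congr {G H H' : B → F} {z : ℕ → B} {yc yc' : 𝕜 → D.CoParam k}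
    {ylin ylin' : 𝕜 → D.Param k → D.CoParam k} (h1 : yc 0 = yc' 0) (h2 : ∀ n, ylin 0 n = ylin' 0 n)
    (ε : 𝕜) (n : D.Param k) :
    Λ.solution G H z yc ylin 0 ε n = Λ.solution G H' z yc' ylin' 0 ε n := by
  have : Λ.IsSol G H z yc ylin 0 ε n = Λ.IsSol G H' z yc' ylin' 0 ε n := by
    funext y
    simp only [IsSol, familyCurve, pertCurve, h1, h2, pert_zero]
  unfold solution
  generalize Λ.IsSol G H z yc ylin 0 ε n = p at this
  subst this
  rfl

variable [CompleteSpace B] [CompleteSpace F]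

/-- The family of solution curves of `G + c H`. The radius `c₀` is chosen before `r`, and `ε₀`
after it; membership in `X_{2k}` and `X_{2k+1}` holds for all `n`, since it concerns the Taylor
coefficients only. -/
theorem exists_family (hk : 1 ≤ k) (hG : AnalyticAt 𝕜 G 0) (hG0 : G 0 = 0)
    (hH : AnalyticAt 𝕜 H 0) (hO : H =O[𝓝 0] fun z => ‖z‖ ^ (2 * k))
    (hD : D.IsIteration (linCoeff 𝕜 G k zbar) k) (Λ : LiftSystem D (linCoeff 𝕜 G k zbar) k)
    {z : ℕ → B} (hz : z ∈ Xbar 𝕜 G k zbar (2 * k + 1)) :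
    ∃ c₀ > 0, ∃ (yc : 𝕜 → D.CoParam k) (ylin : 𝕜 → D.Param k → D.CoParam k),
      yc 0 = 0 ∧ (∀ n, ylin 0 n = 0) ∧
      (∀ c ∈ ball (0 : 𝕜) c₀, ContDiffAt 𝕜 ∞ yc c) ∧
      (∀ c ∈ ball (0 : 𝕜) c₀, ∀ n,
        ContDiffAt 𝕜 ∞ (fun p : 𝕜 × D.Param k => ylin p.1 p.2) (c, n) ∧
        (∀ y ∈ ball (0 : D.CoParam k) 1,
          Λ.familyTuple z yc ylin c n y ∈ X 𝕜 (pert G H c) (2 * k)) ∧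
        Λ.familyTuple z yc ylin c n 0 ∈ X 𝕜 (pert G H c) (2 * k + 1)) ∧
      ∀ r > 0, ∃ ε₀ > 0,
        ∀ c ∈ ball (0 : 𝕜) c₀, ∀ ε ∈ ball (0 : 𝕜) ε₀, ∀ n ∈ ball (0 : D.Param k) r,
          ContDiffAt 𝕜 ∞ (fun p : 𝕜 × 𝕜 × D.Param k =>
            Λ.solution G H z yc ylin p.1 p.2.1 p.2.2) (c, ε, n) ∧
          pert G H c (Λ.familyCurve z yc ylin c ε n (Λ.solution G H z yc ylin c ε n)) = 0 := by
  have hcomp := completeSpace_coParam hD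
  have hcompP := completeSpace_param hD
  obtain ⟨c₀, hc₀, yc, ylin, Tc, hyc0, hyc, hylin0, hylin, hcontr⟩ :=
    exists_contraction hk hG hG0 hH hO hD Λ hz
  have hH0 : H 0 = 0 := by
    have := hO.eq_zero_imp.self_of_nhds
    exact this (by simp [show k ≠ 0 by omega])
  have hP0 : ∀ c : 𝕜, pert G H c 0 = 0 := fun c => by simp [pert, hG0, hH0]
  have hX : ∀ c ∈ ball (0 : 𝕜) c₀, ∀ n, ∀ y ∈ ball (0 : D.CoParam k) 1, ∃ Q : ℝ,
      ∀ᶠ ε in 𝓝 (0 : 𝕜), ‖pert G H c (curve (2 * k + 1) (Λ.familyTuple z yc ylin c n y) ε)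
        - ε ^ (2 * k + 1) • Tc c y‖ ≤ Q * ‖ε ^ (2 * k + 2)‖ := by
    intro c hc n y hy
    obtain ⟨ε₀, hε₀, Q, g, hg⟩ := hcontr (‖n‖ + 1) (by positivity)
    refine ⟨Q, ?_⟩
    filter_upwards [ball_mem_nhds (0 : 𝕜) hε₀] with ε hε
    rw [Λ.curve_familyTuple hk, norm_pow]
    exact (hg c hc ε hε n (by simp) y hy).2.2.2.2
  refine ⟨c₀, hc₀, yc, ylin, hyc0, hylin0, hyc, fun c hc n => ⟨hylin c hc n, ?_, ?_⟩, ?_⟩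
  · intro y hy
    obtain ⟨Q, hQ⟩ := hX c hc n y hy
    rw [mem_X_iff (G := pert G H c) (analyticAt_pert hG hH c) (hP0 c) (Nat.le_succ (2 * k))]
    have h1 := (IsBigO.of_bound Q hQ).trans (isBigO_pow_pow (𝕜 := 𝕜) (Nat.le_succ (2 * k + 1)))
    have h2 := isBigO_pow_smul (𝕜 := 𝕜) (2 * k + 1) (f := fun _ : 𝕜 => Tc c y) continuousAt_const
    refine (h1.add h2).congr_left fun ε => ?_
    abel
  · obtain ⟨Q, hQ⟩ := hX c hc n 0 (mem_ball_self one_pos)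
    rw [mem_X_iff (G := pert G H c) (analyticAt_pert hG hH c) (hP0 c) le_rfl]
    refine (IsBigO.of_bound Q hQ).congr_left fun ε => ?_
    simp
  · intro r hr
    obtain ⟨ε₀, hε₀, Q, g, hg⟩ := hcontr r hr
    refine ⟨ε₀, hε₀, ?_⟩
    have hopen : IsOpen (ball (0 : 𝕜) c₀ ×ˢ ball (0 : 𝕜) ε₀ ×ˢ ball (0 : D.Param k) r) :=
      isOpen_ball.prod (isOpen_ball.prod isOpen_ball)
    obtain ⟨Y, hY⟩ := exists_contDiffAt_fixedPoint (𝕜 := 𝕜) hopen (g := g)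
      (fun x hx y hy => (hg _ hx.1 _ hx.2.1 _ hx.2.2 y hy).1)
      (fun x hx y hy => (hg _ hx.1 _ hx.2.1 _ hx.2.2 y hy).2.1)
      (fun x hx y hy => (hg _ hx.1 _ hx.2.1 _ hx.2.2 y hy).2.2.1)
    have hYs : ∀ x ∈ ball (0 : 𝕜) c₀ ×ˢ ball (0 : 𝕜) ε₀ ×ˢ ball (0 : D.Param k) r,
        Λ.solution G H z yc ylin x.1 x.2.1 x.2.2 = Y x := by
      intro x hx
      refine Λ.solution_eq (hY x hx).2.1 fun y hy => ?_
      rw [← (hY x hx).2.2 y hy]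
      exact (hg _ hx.1 _ hx.2.1 _ hx.2.2 y hy).2.2.2.1.symm
    intro c hc ε hε n hn
    have hx : (c, ε, n) ∈ ball (0 : 𝕜) c₀ ×ˢ ball (0 : 𝕜) ε₀ ×ˢ ball (0 : D.Param k) r :=
      ⟨hc, hε, hn⟩
    refine ⟨(hY _ hx).1.congr_of_eventuallyEq ?_, ?_⟩
    · filter_upwards [hopen.mem_nhds hx] with x' hx'
      exact hYs x' hx'
    · rcases eq_or_ne ε 0 with h0 | h0
      · rw [← Λ.curve_familyTuple hk, h0, curve_zero, hP0]
      · rw [hYs _ hx]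
        have h1 := (hY _ hx).2.1
        have h2 := (hg _ hc _ hε _ hn _ h1).2.2.2.1.mp (((hY _ hx).2.2 _ h1).mpr rfl)
        exact h2.2 h0

/-- The dependent variables `n^c(ε, n̄)` of the family of solution curves of `G`. -/
def baseSolution {A : ℕ → B →L[𝕜] F} (Λ : LiftSystem D A k) (G : B → F) (z : ℕ → B) (ε : 𝕜)
    (n : D.Param k) : D.CoParam k :=
  Λ.solution G 0 z 0 0 0 ε n

/-- The coefficients of the family of solution curves of `G`. -/
def baseTuple {A : ℕ → B →L[𝕜] F} (Λ : LiftSystem D A k) (G : B → F) (z : ℕ → B) (ε : 𝕜)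
    (n : D.Param k) : ℕ → B :=
  Λ.shiftTuple (k + 1) (D.inclSum k (Λ.baseSolution G z ε n, n)) z

theorem familyTuple_solution {A : ℕ → B →L[𝕜] F} (Λ : LiftSystem D A k) {z : ℕ → B}
    {yc : 𝕜 → D.CoParam k} {ylin : 𝕜 → D.Param k → D.CoParam k} (h1 : yc 0 = 0)
    (h2 : ∀ n, ylin 0 n = 0) (ε : 𝕜) (n : D.Param k) :
    Λ.familyTuple z yc ylin 0 n (Λ.solution G H z yc ylin 0 ε n) = Λ.baseTuple G z ε n := by
  rw [familyTuple, h1, h2, map_zero, shiftTuple_zero, zero_add, baseTuple, baseSolution,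
    Λ.solution_congr (H' := 0) (yc' := 0) (ylin' := 0) h1 h2]

theorem baseTuple_zero {A : ℕ → B →L[𝕜] F} (Λ : LiftSystem D A k) {z : ℕ → B}
    {yc : 𝕜 → D.CoParam k} {ylin : 𝕜 → D.Param k → D.CoParam k} (h1 : yc 0 = 0)
    (h2 : ∀ n, ylin 0 n = 0) (n : D.Param k) :
    Λ.familyTuple z yc ylin 0 n 0 = Λ.baseTuple G z 0 n := by
  rw [← Λ.familyTuple_solution (H := 0) h1 h2, solution_zero]

/-- The family of solution curves of `G`. -/
theorem isSolutionFamily (hk : 1 ≤ k) (hG : AnalyticAt 𝕜 G 0) (hG0 : G 0 = 0)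
    (hD : D.IsIteration (linCoeff 𝕜 G k zbar) k) (Λ : LiftSystem D (linCoeff 𝕜 G k zbar) k)
    {z : ℕ → B} (hz : z ∈ Xbar 𝕜 G k zbar (2 * k + 1)) :
    IsSolutionFamily G k zbar D (fun i => z (2 * k + 1 - i)) Λ.coeffEquiv
      (ContinuousLinearEquiv.refl 𝕜 _) (Λ.baseSolution G z) (Λ.baseTuple G z) := by
  obtain ⟨c₀, hc₀, yc, ylin, hyc0, hylin0, -, hc, hr⟩ := exists_family (H := 0) hk hG hG0
    analyticAt_const (isBigO_zero _ _) hD Λ hz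
  have hmem := mem_ball_self hc₀ (x := (0 : 𝕜))
  have hP : pert G 0 (0 : 𝕜) = G := funext fun z => pert_zero _ _ _
  have hlt : ∀ ε n i, 1 ≤ i → i ≤ k → Λ.baseTuple G z ε n i = zbar i := fun ε n i h1 h2 => by
    rw [baseTuple, Λ.shiftTuple_of_lt (by omega)]
    exact hz.2 i h1 h2
  refine ⟨fun n => ⟨Λ.solution_zero _ _ _ _ _ _ n, ?_, hlt 0 n⟩, fun r hr0 => ?_⟩
  · rw [← Λ.baseTuple_zero hyc0 hylin0]
    have := (hc 0 hmem n).2.2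
    rwa [hP] at this
  obtain ⟨ε₀, hε₀, hs⟩ := hr r hr0
  have hsm : ∀ p ∈ ball (0 : 𝕜) ε₀ ×ˢ ball (0 : D.Param k) r,
      ContDiffAt 𝕜 ∞ (fun p : 𝕜 × D.Param k => Λ.baseSolution G z p.1 p.2) p := by
    intro p hp
    have h1 := (hs 0 hmem p.1 hp.1 p.2 hp.2).1
    have h2 : ContDiffAt 𝕜 ∞ (fun p : 𝕜 × D.Param k => ((0 : 𝕜), p)) p := by fun_prop
    refine (ContDiffAt.fun_comp p h1 h2).congr_of_eventuallyEq (Eventually.of_forall fun q => ?_)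
    exact Λ.solution_congr (yc := 0) (ylin := 0) hyc0.symm (fun n => (hylin0 n).symm) q.1 q.2
  refine ⟨ε₀, hε₀, fun p hp => (hsm p hp).contDiffWithinAt, fun j _ p hp => ?_, ?_⟩
  · refine ContDiffAt.contDiffWithinAt (Λ.contDiffAt_shiftTuple ?_ contDiffAt_const)
    exact (D.inclSum k).contDiff.contDiffAt.fun_comp p ((hsm p hp).prodMk contDiffAt_snd)
  · intro ε hε n hn
    refine ⟨?_, ⟨?_, hlt ε n⟩, fun i => ?_⟩
    · have := (hs 0 hmem ε hε n hn).2
      rwa [pert_zero, ← Λ.curve_familyTuple hk, Λ.familyTuple_solution hyc0 hylin0] at this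
    · have := (hc 0 hmem n).2.1 _ (Λ.solution_mem G 0 z yc ylin 0 ε n)
      rwa [hP, Λ.familyTuple_solution hyc0 hylin0] at this
    · rw [baseTuple, Λ.shiftTuple_eq_coeffEquiv]
      rfl

/-- The family of solution curves of `G` persists under perturbations of order `2k`. -/
theorem persists (hk : 1 ≤ k) (hG : AnalyticAt 𝕜 G 0) (hG0 : G 0 = 0)
    (hH : AnalyticAt 𝕜 H 0) (hO : H =O[𝓝 0] fun z => ‖z‖ ^ (2 * k))
    (hD : D.IsIteration (linCoeff 𝕜 G k zbar) k) (Λ : LiftSystem D (linCoeff 𝕜 G k zbar) k)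
    {z : ℕ → B} (hz : z ∈ Xbar 𝕜 G k zbar (2 * k + 1)) :
    Persists G H k zbar D (Λ.baseTuple G z) := by
  obtain ⟨c₀, hc₀, yc, ylin, hyc0, hylin0, hyc, hc, hr⟩ := exists_family hk hG hG0 hH hO hD Λ hz
  have hyc' : ∀ c ∈ ball (0 : 𝕜) c₀, ContDiffAt 𝕜 ∞ (fun c => D.inclNc k (yc c)) c :=
    fun c h => (D.inclNc k).contDiff.contDiffAt.fun_comp c (hyc c h)
  have hbar : ∀ c n y, ∀ i, 1 ≤ i → i ≤ k → Λ.familyTuple z yc ylin c n y i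
      = Function.update zbar k (z k + (k ! : 𝕜) • Λ.coeff 0 (D.inclNc k (yc c))) i := by
    intro c n y i h1 h2
    rcases h2.lt_or_eq with h | rfl
    · rw [Λ.familyTuple_of_lt h, Function.update_of_ne h.ne, hz.2 i h1 h2]
    · rw [familyTuple_self, Function.update_self]
  refine ⟨c₀, hc₀, fun c => z k + (k ! : 𝕜) • Λ.coeff 0 (D.inclNc k (yc c)),
    fun c ε n => Λ.familyTuple z yc ylin c n (Λ.solution G H z yc ylin c ε n), ?_, ?_, ?_⟩
  · simp [hyc0, hz.2 k hk le_rfl]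
  · intro c h
    exact (contDiffAt_const.add (contDiffAt_const.smul
      ((Λ.coeff 0).contDiff.contDiffAt.fun_comp c (hyc' c h)))).contDiffWithinAt
  intro r hr0
  obtain ⟨ε₀, hε₀, hs⟩ := hr r hr0
  refine ⟨ε₀, hε₀, ?_, ?_, ?_⟩
  · intro j _ p hp
    obtain ⟨hp1, hp2, hp3⟩ := hp
    have s1 : ContDiffAt 𝕜 ∞ (fun p : 𝕜 × 𝕜 × D.Param k => ((p.1, p.2.2) : 𝕜 × D.Param k)) p := by
      fun_prop
    have s2 := ContDiffAt.fun_comp p (hc p.1 hp1 p.2.2).1 s1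
    have s3 := (hs p.1 hp1 p.2.1 hp2 p.2.2 hp3).1
    have s4 := ContDiffAt.fun_comp p (hyc' p.1 hp1) contDiffAt_fst
    have s5 : ContDiffAt 𝕜 ∞ (fun p : 𝕜 × 𝕜 × D.Param k => p.2.2) p := by fun_prop
    have s6 := (D.inclSum k).contDiff.contDiffAt.fun_comp p ((s2.add s3).prodMk s5)
    exact (Λ.contDiffAt_shiftTuple s6
      (Λ.contDiffAt_shiftTuple s4 contDiffAt_const)).contDiffWithinAt
  · intro c h ε hε n hn
    refine ⟨?_, ⟨(hc c h n).2.1 _ (Λ.solution_mem _ _ _ _ _ _ _ _), hbar c n _⟩, ?_, hbar c n _⟩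
    · rw [Λ.curve_familyTuple hk]
      exact (hs c h ε hε n hn).2
    · simp only [solution_zero]
      exact (hc c h n).2.2
  · intro ε _ n _ j _
    simp only [Λ.familyTuple_solution hyc0 hylin0]

end LiftSystem
end IterationData
end UndeterminedCoefficients

/-! ### Perturbations of order `2k + 1` -/

namespace UndeterminedCoefficients

variable {𝕜 : Type*} [RCLike 𝕜]
  {B : Type*} [NormedAddCommGroup B] [NormedSpace 𝕜 B]
  {F : Type*} [NormedAddCommGroup F] [NormedSpace 𝕜 F]

theorem prodCoeff_congr_left {A A' : ℕ → B →L[𝕜] F} {k : ℕ} (h : ∀ j ≤ k, A j = A' j) {m : ℕ}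
    (hm : m ≤ k) (v : ℕ → B) : prodCoeff A m v = prodCoeff A' m v := by
  refine Finset.sum_congr rfl fun j hj => ?_
  rw [Finset.mem_range] at hj
  rw [h j (by omega)]

theorem isLift_congr {A A' : ℕ → B →L[𝕜] F} {k : ℕ} (h : ∀ j ≤ k, A j = A' j) {m : ℕ}
    (hm : m ≤ k + 1) (v : ℕ → B) : IsLift A m v ↔ IsLift A' m v := by
  refine forall₂_congr fun i hi => ?_
  rw [prodCoeff_congr_left h (by omega)]

namespace IterationData

variable {D : IterationData 𝕜 B F} {k : ℕ} {A A' : ℕ → B →L[𝕜] F}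

/-- The iteration up to `S_{k+1}` depends on `A₀, …, A_k` only. -/
theorem IsIteration.congr (hD : D.IsIteration A k) (h : ∀ j ≤ k, A j = A' j) :
    D.IsIteration A' k where
  __ := hD
  S_spec m hm n := by
    obtain ⟨v, h0, hl, hs⟩ := hD.S_spec m hm n
    refine ⟨v, h0, (isLift_congr h (by omega) v).mp hl, ?_⟩
    rwa [← prodCoeff_congr_left h hm]

/-- The same lifting operators for operators `A'_j` that agree with `A_j` for `j ≤ k`. -/
def LiftSystem.congr (Λ : LiftSystem D A k) (h : ∀ j ≤ k, A j = A' j) : LiftSystem D A' k where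
  V := Λ.V
  V_zero := Λ.V_zero
  isLift i hi n hn := (isLift_congr h (by omega) _).mp (Λ.isLift i hi n hn)
  isLift_succ i hi n hn := (isLift_congr h (by omega) _).mp (Λ.isLift_succ i hi n hn)
  V_mem := Λ.V_mem
  Ψ := Λ.Ψ
  Ψ_apply y := by
    rw [Λ.Ψ_apply]
    exact Finset.sum_congr rfl fun i _ => prodCoeff_congr_left h (by omega) _

end IterationData

section Perturbation

variable [CompleteSpace F] {G H : B → F} {k : ℕ} {zbar : ℕ → B}

theorem isBigO_pow_succ_zero {W : Type*} [NormedAddCommGroup W] {f : B → W} {m : ℕ}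
    (h : f =O[𝓝 0] fun z => ‖z‖ ^ (m + 1)) : f 0 = 0 :=
  h.eq_zero_imp.self_of_nhds (by simp)

/-- A perturbation of order `2k + 1` does not affect `A_0, …, A_k`, since its derivative is of order
`2k ≥ k + 1`. -/
theorem linCoeff_add_eq (hk : 1 ≤ k) (hG : AnalyticAt 𝕜 G 0) (hH : AnalyticAt 𝕜 H 0)
    (hO : H =O[𝓝 0] fun z => ‖z‖ ^ (2 * k + 1)) (zbar : ℕ → B) :
    ∀ j ≤ k, linCoeff 𝕜 G k zbar j = linCoeff 𝕜 (fun z => G z + H z) k zbar j := by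
  intro j hj
  refine (linCoeff_eq_of_isBigO (hG.fun_add hH) (n := k + 1) ?_ j (by omega)).symm
  have h1 := isBigO_fderiv_curve_sub_sum hG k zbar (k + 1)
  have h2 := (isBigO_norm_pow_comp (isBigO_fderiv hH hO) (tendsto_curve (𝕜 := 𝕜) k zbar)
    (isBigO_curve k zbar)).trans (isBigO_pow_pow (show k + 1 ≤ 2 * k by omega))
  have h3 : ∀ᶠ z in 𝓝 (0 : B), fderiv 𝕜 (fun z => G z + H z) z = fderiv 𝕜 G z + fderiv 𝕜 H z := by
    filter_upwards [hG.eventually_analyticAt, hH.eventually_analyticAt] with z h4 h5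
    exact fderiv_fun_add h4.differentiableAt h5.differentiableAt
  refine (h1.add h2).congr' ?_ EventuallyEq.rfl
  filter_upwards [(tendsto_curve (𝕜 := 𝕜) k zbar).eventually h3] with ε hε
  rw [hε]
  abel

theorem X_add_eq (hG : AnalyticAt 𝕜 G 0) (hG0 : G 0 = 0) (hH : AnalyticAt 𝕜 H 0) {m : ℕ}
    (hO : H =O[𝓝 0] fun z => ‖z‖ ^ (m + 1)) :
    X 𝕜 (fun z => G z + H z) m = X 𝕜 G m := by
  ext z
  rw [mem_X_iff (hG.fun_add hH) (by simp [hG0, isBigO_pow_succ_zero hO]) le_rfl,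
    mem_X_iff hG hG0 le_rfl]
  have h1 := isBigO_norm_pow_comp hO (tendsto_curve (𝕜 := 𝕜) m z) (isBigO_curve m z)
  constructor
  · intro h
    refine (h.sub h1).congr_left fun ε => ?_
    simp
  · exact fun h => h.add h1

theorem Xbar_add_eq (hG : AnalyticAt 𝕜 G 0) (hG0 : G 0 = 0) (hH : AnalyticAt 𝕜 H 0) {m : ℕ}
    (hO : H =O[𝓝 0] fun z => ‖z‖ ^ (m + 1)) :
    Xbar 𝕜 (fun z => G z + H z) k zbar m = Xbar 𝕜 G k zbar m := by
  rw [Xbar, Xbar, X_add_eq hG hG0 hH hO]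

theorem IsRegularWith.add {D : IterationData 𝕜 B F} (hreg : IsRegularWith G k zbar D)
    (hk : 1 ≤ k) (hG : AnalyticAt 𝕜 G 0) (hG0 : G 0 = 0) (hH : AnalyticAt 𝕜 H 0)
    (hO : H =O[𝓝 0] fun z => ‖z‖ ^ (2 * k + 1)) :
    IsRegularWith (fun z => G z + H z) k zbar D where
  iteration := hreg.iteration.congr (linCoeff_add_eq hk hG hH hO zbar)
  solvable := by
    rw [Xbar_add_eq hG hG0 hH hO]
    exact hreg.solvable
  surjective := hreg.surjective

end Perturbation
end UndeterminedCoefficients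

/-! ### The lift with values in `N^c` -/

namespace UndeterminedCoefficients

section Det

variable {𝕜 : Type*} [RCLike 𝕜] {ι : Type*} [Fintype ι] [DecidableEq ι]

theorem differentiableAt_det {V : Type*} [NormedAddCommGroup V] [NormedSpace 𝕜 V]
    {M : V → Matrix ι ι 𝕜} {v : V} (h : ∀ i j, DifferentiableAt 𝕜 (fun v => M v i j) v) :
    DifferentiableAt 𝕜 (fun v => (M v).det) v := by
  simp only [Matrix.det_apply]
  refine DifferentiableAt.fun_sum fun σ _ => ?_
  refine DifferentiableAt.fun_const_smul ?_ _
  exact (HasFDerivAt.finsetProd fun i _ => (h (σ i) i).hasFDerivAt).differentiableAt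

/-- The determinant of a scaling of the factors of a product. -/
theorem det_pi_smul {n : ℕ} (E : Fin n → Type*) [∀ i, AddCommGroup (E i)] [∀ i, Module 𝕜 (E i)]
    [∀ i, FiniteDimensional 𝕜 (E i)] (a : Fin n → 𝕜) :
    LinearMap.det (LinearMap.pi fun i => a i • (LinearMap.proj i : (∀ i, E i) →ₗ[𝕜] E i))
      = ∏ i, a i ^ Module.finrank 𝕜 (E i) := by
  let b := Pi.basis fun i => Module.finBasis 𝕜 (E i)
  rw [← LinearMap.det_toMatrix b]
  have : LinearMap.toMatrix b b (LinearMap.pi fun i => a i • (LinearMap.proj i : (∀ i, E i) →ₗ[𝕜] E i))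
      = Matrix.diagonal fun p => a p.1 := by
    ext p q
    have h1 : (LinearMap.pi fun i => a i • (LinearMap.proj i : (∀ i, E i) →ₗ[𝕜] E i)) (b q)
        = a q.1 • b q := by
      funext i
      simp only [LinearMap.pi_apply, LinearMap.smul_apply, LinearMap.proj_apply, Pi.smul_apply, b,
        Pi.basis_apply]
      by_cases h : i = q.1
      · subst h; simp
      · simp [Pi.single_eq_of_ne h]
    rw [LinearMap.toMatrix_apply, h1, map_smul, Module.Basis.repr_self, Finsupp.smul_single,
      Finsupp.single_apply, Matrix.diagonal_apply]
    by_cases h : q = p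
    · rw [if_pos h, if_pos h.symm, h, smul_eq_mul, mul_one]
    · rw [if_neg h, if_neg (Ne.symm h)]
  rw [this, Matrix.det_diagonal, Fintype.prod_sigma]
  refine Finset.prod_congr rfl fun i _ => ?_
  simp

end Det

variable {𝕜 : Type*} [RCLike 𝕜]
  {B : Type*} [NormedAddCommGroup B] [NormedSpace 𝕜 B]
  {F : Type*} [NormedAddCommGroup F] [NormedSpace 𝕜 F]

namespace IterationData

variable {D : IterationData 𝕜 B F} {k : ℕ} {A : ℕ → B →L[𝕜] F}

theorem IsIteration.N_le_of_le (hD : D.IsIteration A k) {i j : ℕ} (hij : i ≤ j) (hj : j ≤ k + 1) :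
    D.N j ≤ D.N i := by
  induction j, hij using Nat.le_induction with
  | base => exact le_rfl
  | succ j _ ih => exact (hD.N_succ_le (by omega)).trans (ih (by omega))

/-- The sum map of `N₁^c × ⋯ × N_{k+1}^c`, with values in `N^c`. -/
def sumNc (D : IterationData 𝕜 B F) (k : ℕ) : D.CoParam k →ₗ[𝕜] D.NcSum k :=
  ∑ i : Fin (k + 1), (Submodule.inclusion (D.Nc_le_NcSum (Nat.lt_succ_iff.mp i.2))) ∘ₗ
    LinearMap.proj i

theorem coe_sumNc (y : D.CoParam k) : (D.sumNc k y : B) = ∑ i, (y i : B) := by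
  simp [sumNc]

theorem IsIteration.sumNc_injective (hD : D.IsIteration A k) :
    Function.Injective (D.sumNc k) := by
  rw [injective_iff_map_eq_zero]
  intro y hy
  have hs : ∑ i, (y i : B) = 0 := by rw [← coe_sumNc, hy, Submodule.coe_zero]
  have key : ∀ n : ℕ, ∀ i : Fin (k + 1), (i : ℕ) < n → y i = 0 := by
    intro n
    induction n with
    | zero => intro i hi; omega
    | succ n ih =>
      intro i hi
      rw [← Finset.add_sum_erase _ _ (Finset.mem_univ i)] at hs
      have h1 : ∑ j ∈ Finset.univ.erase i, (y j : B) ∈ D.N (i + 1) := by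
        refine Submodule.sum_mem _ fun j hj => ?_
        rcases lt_trichotomy (j : ℕ) i with h | h | h
        · rw [ih j (by omega)]; exact zero_mem _
        · exact absurd (Fin.ext h) (Finset.ne_of_mem_erase hj)
        · exact hD.N_le_of_le (show (i : ℕ) + 1 ≤ j from h) (by omega)
            (hD.Nc_succ_le (by omega) (y j).2)
      have h2 : (y i : B) ∈ D.N (i + 1) := by
        rw [eq_neg_of_add_eq_zero_left hs]; exact neg_mem h1
      exact Subtype.ext (Submodule.disjoint_def.mp (hD.N_disjoint i (by omega)) _ (y i).2 h2)
  exact funext fun i => key (k + 1) i i.2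

theorem sumNc_surjective : Function.Surjective (D.sumNc k) := by
  have h : D.NcSum k ≤ LinearMap.range ((D.NcSum k).subtype ∘ₗ D.sumNc k) := by
    refine iSup_le fun i n hn => ⟨Pi.single i ⟨n, hn⟩, ?_⟩
    rw [LinearMap.comp_apply, Submodule.subtype_apply, coe_sumNc,
      Finset.sum_eq_single i]
    · simp
    · intro j _ hj
      simp [Pi.single_eq_of_ne hj]
    · simp
  intro x
  obtain ⟨y, hy⟩ := h x.2
  exact ⟨y, Subtype.ext hy⟩

/-- The isomorphism `N₁^c × ⋯ × N_{k+1}^c ≃ N^c`. -/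
def IsIteration.sumNcEquiv (hD : D.IsIteration A k) : D.CoParam k ≃ₗ[𝕜] D.NcSum k :=
  LinearEquiv.ofBijective (D.sumNc k) ⟨hD.sumNc_injective, sumNc_surjective⟩

namespace LiftSystem

variable (Λ : LiftSystem D A k)

/-- The `N^c`-valued lift `y ↦ ∑ᵢ (V_{i,0} yᵢ + ε V_{i,1} yᵢ + ⋯ + εⁱ V_{i,i} yᵢ)`. -/
def liftNc (ε : 𝕜) : D.CoParam k →ₗ[𝕜] D.NcSum k :=
  ∑ i : Fin (k + 1), ∑ j ∈ Finset.range (i + 1), ε ^ j •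
    (((Λ.V i j : B →ₗ[𝕜] B) ∘ₗ (D.Nc (i + 1)).subtype).codRestrict (D.NcSum k)
      (fun n => Λ.V_mem i (Nat.lt_succ_iff.mp i.2) j n n.2)) ∘ₗ LinearMap.proj i

theorem coe_liftNc (ε : 𝕜) (y : D.CoParam k) :
    (Λ.liftNc ε y : B) = ∑ i : Fin (k + 1), ∑ j ∈ Finset.range (i + 1), ε ^ j • Λ.V i j (y i) := by
  simp only [liftNc, LinearMap.sum_apply, Submodule.coe_sum]
  rfl

theorem liftNc_zero : Λ.liftNc 0 = D.sumNc k := by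
  refine LinearMap.ext fun y => Subtype.ext ?_
  rw [coe_liftNc, coe_sumNc]
  refine Finset.sum_congr rfl fun i _ => ?_
  rw [Finset.sum_range_succ', Finset.sum_eq_zero, zero_add, pow_zero, one_smul,
    Λ.V_zero i (by omega)]
  intro j _
  rw [zero_pow (Nat.succ_ne_zero j), zero_smul]

/-- The lift `Λ(ε)` on `N₁^c × ⋯ × N_{k+1}^c` is a scaling by `ε^{k-i}` followed by the `N^c`-valued
lift. -/
theorem poly_inclNc (ε : 𝕜) (y : D.CoParam k) :
    Λ.poly ε (D.inclNc k y)
      = Λ.liftNc ε (fun i => ε ^ (k - i : ℕ) • y i) := by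
  rw [poly_apply, coe_liftNc]
  simp only [coeff_apply, Finset.smul_sum]
  rw [Finset.sum_comm]
  refine Finset.sum_congr rfl fun i _ => ?_
  rw [Finset.range_eq_Ico, ← Finset.sum_Ico_consecutive _ (Nat.zero_le (k - i))
    (show k - (i : ℕ) ≤ k + 1 by omega), Finset.sum_eq_zero, zero_add,
    Finset.sum_Ico_eq_sum_range, show k + 1 - (k - (i : ℕ)) = i + 1 by omega]
  · refine Finset.sum_congr rfl fun j _ => ?_
    rw [if_pos (by omega), show k - (i : ℕ) + j - (k - i) = j by omega, Submodule.coe_smul,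
      map_smul, smul_smul, ← pow_add, inclNc_apply, add_comm]
  · intro m hm
    rw [Finset.mem_Ico] at hm
    rw [if_neg (by omega), smul_zero]

end LiftSystem
end IterationData
end UndeterminedCoefficients

/-! ### Expansion of the determinant -/

namespace UndeterminedCoefficients

variable {𝕜 : Type*} [RCLike 𝕜]
  {B : Type*} [NormedAddCommGroup B] [NormedSpace 𝕜 B]
  {F : Type*} [NormedAddCommGroup F] [NormedSpace 𝕜 F]

theorem differentiableAt_det_toMatrix {V E : Type*} [NormedAddCommGroup V] [NormedSpace 𝕜 V]
    [AddCommGroup E] [Module 𝕜 E] [FiniteDimensional 𝕜 F] {d : ℕ} (b : Module.Basis (Fin d) 𝕜 E)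
    (b' : Module.Basis (Fin d) 𝕜 F) {f : V → E →ₗ[𝕜] F} {v : V}
    (hf : ∀ x, DifferentiableAt 𝕜 (fun v => f v x) v) :
    DifferentiableAt 𝕜 (fun v => (LinearMap.toMatrix b b' (f v)).det) v := by
  refine differentiableAt_det fun i j => ?_
  simp only [LinearMap.toMatrix_apply]
  exact ((LinearMap.toContinuousLinearMap (b'.coord i)).hasFDerivAt.comp v
    (hf (b j)).hasFDerivAt).differentiableAt

theorem exists_bound_of_differentiableAt {V W : Type*} [NormedAddCommGroup V] [NormedSpace 𝕜 V]
    [NormedAddCommGroup W] [NormedSpace 𝕜 W] {f : V → W} {v : V} (hf : DifferentiableAt 𝕜 f v) :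
    ∃ K > 0, ∃ δ > 0, ∀ w, ‖w - v‖ < δ → ‖f w - f v‖ ≤ K * ‖w - v‖ := by
  obtain ⟨K, hK, h⟩ := hf.isBigO_sub.exists_pos
  obtain ⟨δ, hδ, h'⟩ := Metric.eventually_nhds_iff.mp h.bound
  exact ⟨K, hK, δ, hδ, fun w hw => h' (by rwa [dist_eq_norm])⟩

namespace IterationData

variable {D : IterationData 𝕜 B F} {k : ℕ} {A : ℕ → B →L[𝕜] F}

/-- The exponents of the scaling `ε^{k-i}` and of the determinant expansion add up to that of
`εᵏ` on the whole space. -/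
theorem exponent_add (D : IterationData 𝕜 B F) (k : ℕ) :
    ∑ i ∈ Finset.range (k + 1), i * Module.finrank 𝕜 (D.Nc (i + 1))
      + ∑ i : Fin (k + 1), (k - i) * Module.finrank 𝕜 (D.Nc (i + 1))
      = k * ∑ i : Fin (k + 1), Module.finrank 𝕜 (D.Nc (i + 1)) := by
  rw [Finset.sum_range, ← Finset.sum_add_distrib, Finset.mul_sum]
  refine Finset.sum_congr rfl fun i _ => ?_
  rw [← add_mul, show (i : ℕ) + (k - i) = k by omega]

theorem finiteDimensional_Nc [FiniteDimensional 𝕜 (D.NcSum k)] (i : Fin (k + 1)) :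
    FiniteDimensional 𝕜 (D.Nc (i + 1)) :=
  Submodule.finiteDimensional_of_le (D.Nc_le_NcSum (Nat.lt_succ_iff.mp i.2))

theorem IsIteration.finrank_NcSum (hD : D.IsIteration A k) [FiniteDimensional 𝕜 (D.NcSum k)] :
    Module.finrank 𝕜 (D.NcSum k) = ∑ i : Fin (k + 1), Module.finrank 𝕜 (D.Nc (i + 1)) := by
  have := finiteDimensional_Nc (D := D) (k := k)
  rw [← hD.sumNcEquiv.finrank_eq, Module.finrank_pi_fintype]

namespace LiftSystem

theorem finiteDimensional (hD : D.IsIteration A k) (Λ : LiftSystem D A k)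
    [FiniteDimensional 𝕜 (D.NcSum k)] :
    FiniteDimensional 𝕜 F ∧ Module.finrank 𝕜 (D.NcSum k) = Module.finrank 𝕜 F := by
  let e : D.NcSum k ≃ₗ[𝕜] F := hD.sumNcEquiv.symm.trans Λ.Ψ.toLinearEquiv
  exact ⟨e.finiteDimensional, e.finrank_eq⟩

/-- The determinants of the factors of `𝒯 Λ(ε)` on `N₁^c × ⋯ × N_{k+1}^c`: since `Λ(ε)` is the
composition of a lift with values in `N^c` and a scaling, and `𝒯 Λ(ε) = εᵏ S`, the powers of `ε`
combine to `ε^χ`. -/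
theorem det_mul_eq (hD : D.IsIteration A k) (Λ : LiftSystem D A k)
    [FiniteDimensional 𝕜 (D.NcSum k)] {d : ℕ} (bC : Module.Basis (Fin d) 𝕜 (D.CoParam k))
    (b : Module.Basis (Fin d) 𝕜 (D.NcSum k)) (b' : Module.Basis (Fin d) 𝕜 F) {ε : 𝕜} (hε : ε ≠ 0)
    {𝒯 : B →L[𝕜] F} {S : D.CoParam k →L[𝕜] F}
    (h : ∀ y, 𝒯 (Λ.poly ε (D.inclNc k y)) = ε ^ k • S y) :
    (LinearMap.toMatrix b b' ((𝒯 : B →ₗ[𝕜] F) ∘ₗ (D.NcSum k).subtype)).det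
      * (LinearMap.toMatrix bC b (Λ.liftNc ε)).det
      = ε ^ (∑ i ∈ Finset.range (k + 1), i * Module.finrank 𝕜 (D.Nc (i + 1)))
        * (LinearMap.toMatrix bC b' (S : D.CoParam k →ₗ[𝕜] F)).det := by
  have := finiteDimensional_Nc (D := D) (k := k)
  let sc : D.CoParam k →ₗ[𝕜] D.CoParam k := LinearMap.pi fun i => ε ^ (k - i : ℕ) •
    (LinearMap.proj i : D.CoParam k →ₗ[𝕜] D.Nc (i + 1))
  have hcomp : ((𝒯 : B →ₗ[𝕜] F) ∘ₗ (D.NcSum k).subtype) ∘ₗ (Λ.liftNc ε ∘ₗ sc)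
      = ε ^ k • (S : D.CoParam k →ₗ[𝕜] F) := by
    refine LinearMap.ext fun y => ?_
    have := h y
    rw [poly_inclNc] at this
    exact this
  have hdet := congrArg (fun f => (LinearMap.toMatrix bC b' f).det) hcomp
  simp only [LinearMap.toMatrix_comp bC b b', LinearMap.toMatrix_comp bC bC b, Matrix.det_mul,
    map_smul, Matrix.det_smul, LinearMap.det_toMatrix] at hdet
  have hsc : LinearMap.det sc = ε ^ (∑ i : Fin (k + 1), (k - i) * Module.finrank 𝕜 (D.Nc (i + 1))) := by
    rw [det_pi_smul, ← Finset.prod_pow_eq_pow_sum]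
    exact Finset.prod_congr rfl fun i _ => (pow_mul _ _ _).symm
  have hd : d = ∑ i : Fin (k + 1), Module.finrank 𝕜 (D.Nc (i + 1)) := by
    rw [← hD.finrank_NcSum, Module.finrank_eq_card_basis b, Fintype.card_fin]
  rw [hsc, Fintype.card_fin, ← pow_mul] at hdet
  rw [show k * d = _ from hd ▸ (D.exponent_add k).symm, pow_add] at hdet
  refine mul_right_cancel₀ (pow_ne_zero
    (∑ i : Fin (k + 1), (k - i : ℕ) * Module.finrank 𝕜 (D.Nc (i + 1))) hε) (Eq.trans ?_ (hdet.trans ?_))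
  · ring
  · ring

/-- The determinant expansion, uniformly for all operators near `∑ εʲ A_j`. The constant is the
determinant of `Ψ`, in a basis of `N₁^c × ⋯ × N_{k+1}^c` for which the lift at `ε = 0` has
determinant `1`. -/
theorem exists_det_expansion (hD : D.IsIteration A k) (Λ : LiftSystem D A k)
    [FiniteDimensional 𝕜 (D.NcSum k)] {d : ℕ}
    (b : Module.Basis (Fin d) 𝕜 (D.NcSum k)) (b' : Module.Basis (Fin d) 𝕜 F) :
    ∃ c : 𝕜, c ≠ 0 ∧ ∀ C > 0, ∃ ε₀ > 0, ∃ C' : ℝ, ∀ ε ∈ ball (0 : 𝕜) ε₀, ∀ 𝒯 : B →L[𝕜] F,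
      ‖𝒯 - ∑ j ∈ Finset.range (k + 1), ε ^ j • A j‖ ≤ C * ‖ε‖ ^ (k + 1) →
      ‖(LinearMap.toMatrix b b' ((𝒯 : B →ₗ[𝕜] F) ∘ₗ (D.NcSum k).subtype)).det
        - c * ε ^ (∑ i ∈ Finset.range (k + 1), i * Module.finrank 𝕜 (D.Nc (i + 1)))‖
      ≤ C' * ‖ε‖ ^ ((∑ i ∈ Finset.range (k + 1), i * Module.finrank 𝕜 (D.Nc (i + 1))) + 1) := by
  obtain ⟨hF, -⟩ := finiteDimensional hD Λ
  set χ := ∑ i ∈ Finset.range (k + 1), i * Module.finrank 𝕜 (D.Nc (i + 1)) with hχ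
  set bC := b.map hD.sumNcEquiv.symm with hbC
  let f : (D.CoParam k →L[𝕜] F) → 𝕜 := fun S =>
    (LinearMap.toMatrix bC b' (S : D.CoParam k →ₗ[𝕜] F)).det
  let q : 𝕜 → 𝕜 := fun ε => (LinearMap.toMatrix bC b (Λ.liftNc ε)).det
  let t : (B →L[𝕜] F) → 𝕜 := fun 𝒯 =>
    (LinearMap.toMatrix b b' ((𝒯 : B →ₗ[𝕜] F) ∘ₗ (D.NcSum k).subtype)).det
  let p : D.CoParam k →L[𝕜] F := Λ.Ψ
  have hf : DifferentiableAt 𝕜 f p := differentiableAt_det_toMatrix bC b' fun x =>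
    (ContinuousLinearMap.apply 𝕜 F x).differentiableAt
  have hfp : f p ≠ 0 := (LinearEquiv.isUnit_det Λ.Ψ.toLinearEquiv bC b').ne_zero
  have hq : DifferentiableAt 𝕜 q 0 := by
    refine differentiableAt_det_toMatrix bC b fun x => ?_
    simp only [liftNc, LinearMap.sum_apply, LinearMap.smul_apply]
    fun_prop
  have hq0 : q 0 = 1 := by
    have : LinearMap.toMatrix bC b (Λ.liftNc 0) = 1 := by
      rw [liftNc_zero]
      ext i j
      have h1 : D.sumNc k (bC j) = b j := by
        rw [hbC, Module.Basis.map_apply]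
        exact hD.sumNcEquiv.apply_symm_apply _
      rw [LinearMap.toMatrix_apply, h1, Module.Basis.repr_self, Finsupp.single_apply,
        Matrix.one_apply]
      simp only [eq_comm]
    simp only [q, this, Matrix.det_one]
  obtain ⟨K, hK, δ, hδ, hfK⟩ := exists_bound_of_differentiableAt (𝕜 := 𝕜)
    (V := D.CoParam k →L[𝕜] F) (W := 𝕜) hf
  obtain ⟨K₂, hK₂, δ₂, hδ₂, hqK⟩ := exists_bound_of_differentiableAt hq
  obtain ⟨C₁, hC₁, hb₁⟩ := (Λ.isBigO_comp_poly_of_isBigO hD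
    (𝒯 := fun ε : 𝕜 => ∑ j ∈ Finset.range (k + 1), ε ^ j • A j)
    (by simpa using isBigO_zero _ _)).exists_pos
  have hb₂ : ∀ᶠ ε : 𝕜 in 𝓝 0, ‖Λ.poly ε ∘L D.inclSum k‖ < ‖Λ.poly (0 : 𝕜) ∘L D.inclSum k‖ + 1 :=
    ((Λ.contDiff_poly (n := 0)).continuous.clm_comp continuous_const).continuousAt.norm.eventually_lt
      continuousAt_const (lt_add_one _)
  set C₂ := ‖Λ.poly (0 : 𝕜) ∘L D.inclSum k‖ + 1 with hC₂
  obtain ⟨δ₃, hδ₃, hb⟩ := Metric.eventually_nhds_iff_ball.mp (hb₁.bound.and hb₂)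
  refine ⟨f p, hfp, fun C hC => ?_⟩
  set C₃ := C₁ + C * C₂ with hC₃
  have hC₃0 : 0 < C₃ := by positivity
  set C' := 2 * (K * C₃ + ‖f p‖ * K₂) with hC'
  -- the estimate for `ε ≠ 0`
  have key : ∀ ε ∈ ball (0 : 𝕜) (min (min δ₃ (δ / C₃)) (min δ₂ (1 / (2 * K₂)))), ε ≠ 0 →
      ∀ 𝒯 : B →L[𝕜] F, ‖𝒯 - ∑ j ∈ Finset.range (k + 1), ε ^ j • A j‖ ≤ C * ‖ε‖ ^ (k + 1) →
      ‖t 𝒯 - f p * ε ^ χ‖ ≤ C' * ‖ε‖ ^ (χ + 1) := by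
    intro ε hε hε0 𝒯 h𝒯
    rw [mem_ball_zero_iff, lt_min_iff, lt_min_iff, lt_min_iff] at hε
    obtain ⟨⟨ε1, ε2⟩, ε3, ε4⟩ := hε
    obtain ⟨h1, h2⟩ := hb ε (mem_ball_zero_iff.mpr ε1)
    have hεp : 0 < ‖ε‖ := norm_pos_iff.mpr hε0
    let S : D.CoParam k →L[𝕜] F := (ε ^ k)⁻¹ • (𝒯 ∘L Λ.poly ε ∘L D.inclNc k)
    have hS : ∀ y, 𝒯 (Λ.poly ε (D.inclNc k y)) = ε ^ k • S y := by
      intro y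
      show _ = ε ^ k • ((ε ^ k)⁻¹ • 𝒯 (Λ.poly ε (D.inclNc k y)))
      rw [smul_inv_smul₀ (pow_ne_zero k hε0)]
    have hSp : ‖S - p‖ ≤ C₃ * ‖ε‖ := by
      refine ContinuousLinearMap.opNorm_le_bound _ (by positivity) fun y => ?_
      have e1 : ε ^ k • (S - p) y = (𝒯 - ∑ j ∈ Finset.range (k + 1), ε ^ j • A j)
            ((Λ.poly ε ∘L D.inclSum k) (y, 0))
          + ((∑ j ∈ Finset.range (k + 1), ε ^ j • A j) ∘L Λ.poly ε ∘L D.inclSum k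
            - ε ^ k • (p ∘L ContinuousLinearMap.fst 𝕜 _ (D.Param k))) (y, 0) := by
        rw [sub_apply, smul_sub, ← hS, ← inclSum_left]
        simp only [sub_apply, ContinuousLinearMap.comp_apply, smul_apply,
          ContinuousLinearMap.coe_fst']
        abel
      have e2 : ‖((y, 0) : D.CoParam k × D.Param k)‖ = ‖y‖ := by simp [Prod.norm_def]
      have e3 : ‖ε ^ k • (S - p) y‖ ≤ ‖ε‖ ^ k * (C₃ * ‖ε‖ * ‖y‖) := by
        rw [e1]
        calc _ ≤ C * ‖ε‖ ^ (k + 1) * (C₂ * ‖y‖) + C₁ * ‖ε ^ (k + 1)‖ * ‖y‖ := by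
              refine (norm_add_le _ _).trans (add_le_add ?_ ?_)
              · refine (ContinuousLinearMap.le_opNorm _ _).trans
                  (mul_le_mul h𝒯 ?_ (norm_nonneg _) (by positivity))
                refine (ContinuousLinearMap.le_opNorm _ _).trans ?_
                rw [e2]
                gcongr
              · refine (ContinuousLinearMap.le_opNorm _ _).trans ?_
                rw [e2]
                gcongr
          _ = _ := by rw [norm_pow, hC₃]; ring
      rw [norm_smul, norm_pow] at e3
      exact le_of_mul_le_mul_left e3 (by positivity)
    have hfS : ‖f S - f p‖ ≤ K * (C₃ * ‖ε‖) := by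
      refine (hfK S (hSp.trans_lt ?_)).trans (by gcongr)
      rw [mul_comm]
      exact (lt_div_iff₀ hC₃0).mp ε2
    have hqε : ‖q ε - 1‖ ≤ K₂ * ‖ε‖ := by
      have := hqK ε (by rwa [sub_zero])
      rwa [hq0, sub_zero] at this
    have hq2 : 1 / 2 ≤ ‖q ε‖ := by
      have h3 : K₂ * ‖ε‖ ≤ 1 / 2 := by
        have := mul_le_mul_of_nonneg_left ε4.le hK₂.le
        have e : K₂ * (1 / (2 * K₂)) = 1 / 2 := by field_simp
        linarith
      have h4 : ‖(1 : 𝕜)‖ ≤ ‖q ε‖ + ‖q ε - 1‖ := by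
        have : (1 : 𝕜) = q ε - (q ε - 1) := by ring
        calc ‖(1 : 𝕜)‖ = ‖q ε - (q ε - 1)‖ := by rw [← this]
          _ ≤ _ := norm_sub_le _ _
      rw [norm_one] at h4
      linarith
    have hid : t 𝒯 * q ε = ε ^ χ * f S := det_mul_eq hD Λ bC b b' hε0 hS
    have e4 : (t 𝒯 - f p * ε ^ χ) * q ε = ε ^ χ * ((f S - f p) - f p * (q ε - 1)) := by
      rw [sub_mul, hid]; ring
    have e5 : ‖t 𝒯 - f p * ε ^ χ‖ * (1 / 2)
        ≤ ‖ε‖ ^ χ * (K * (C₃ * ‖ε‖) + ‖f p‖ * (K₂ * ‖ε‖)) := by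
      calc _ ≤ ‖t 𝒯 - f p * ε ^ χ‖ * ‖q ε‖ := by gcongr
        _ = ‖ε‖ ^ χ * ‖(f S - f p) - f p * (q ε - 1)‖ := by
          rw [← norm_mul, e4, norm_mul, norm_pow]
        _ ≤ _ := by
          gcongr
          refine (norm_sub_le _ _).trans (add_le_add hfS ?_)
          rw [norm_mul]
          gcongr
    calc _ ≤ 2 * (‖ε‖ ^ χ * (K * (C₃ * ‖ε‖) + ‖f p‖ * (K₂ * ‖ε‖))) := by linarith
      _ = _ := by rw [hC']; ring
  have hr : 0 < min (min δ₃ (δ / C₃)) (min δ₂ (1 / (2 * K₂))) := by positivity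
  refine ⟨_, hr, C', fun ε hε 𝒯 h𝒯 => ?_⟩
  rcases eq_or_ne ε 0 with rfl | hε0
  · -- the value at `ε = 0` is a limit
    have hT : 𝒯 = ∑ j ∈ Finset.range (k + 1), (0 : 𝕜) ^ j • A j := by
      rw [norm_zero, zero_pow (Nat.succ_ne_zero k), mul_zero] at h𝒯
      exact sub_eq_zero.mp (norm_le_zero_iff.mp h𝒯)
    have hc : ContinuousAt (fun ε : 𝕜 =>
        t (∑ j ∈ Finset.range (k + 1), ε ^ j • A j) - f p * ε ^ χ) 0 := by
      refine ContinuousAt.sub (DifferentiableAt.continuousAt (𝕜 := 𝕜)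
        (differentiableAt_det_toMatrix b b' fun x => ?_)) (by fun_prop)
      simp only [LinearMap.comp_apply, Submodule.subtype_apply, ContinuousLinearMap.coe_coe,
        sum_apply, smul_apply]
      fun_prop
    have hlim := hc.norm.tendsto.mono_left (nhdsWithin_le_nhds (s := {0}ᶜ))
    have hlim' : Tendsto (fun ε : 𝕜 => C' * ‖ε‖ ^ (χ + 1)) (𝓝[≠] 0)
        (𝓝 (C' * ‖(0 : 𝕜)‖ ^ (χ + 1))) :=
      (Continuous.tendsto (by fun_prop) 0).mono_left nhdsWithin_le_nhds
    rw [hT]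
    refine le_of_tendsto_of_tendsto hlim hlim' ?_
    filter_upwards [self_mem_nhdsWithin, nhdsWithin_le_nhds (ball_mem_nhds (0 : 𝕜) hr)]
      with ε h1 h2
    refine key ε h2 h1 _ ?_
    rw [sub_self, norm_zero]
    positivity
  · exact key ε hε hε0 𝒯 h𝒯

variable {G : B → F} {zbar : ℕ → B} [CompleteSpace B] [CompleteSpace F]

/-- The determinant formula for the family of solution curves of `G`. -/
theorem hasDetExpansion (hk : 1 ≤ k) (hG : AnalyticAt 𝕜 G 0)
    (hD : D.IsIteration (linCoeff 𝕜 G k zbar) k) (Λ : LiftSystem D (linCoeff 𝕜 G k zbar) k)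
    {z : ℕ → B} (hz : ∀ i, 1 ≤ i → i ≤ k → z i = zbar i) :
    HasDetExpansion G k D (Λ.baseTuple G z) := by
  intro hfin
  obtain ⟨h1, h2⟩ := finiteDimensional hD Λ
  refine ⟨h1, h2, fun d b b' => ?_⟩
  obtain ⟨c, hc, hexp⟩ := exists_det_expansion hD Λ b b'
  refine ⟨c, hc, fun r hr => ?_⟩
  obtain ⟨C₁, hC₁, hb₁⟩ := (isBigO_fderiv_comp_sub_sum hG (tendsto_curve (𝕜 := 𝕜) (2 * k + 1) z)
    le_rfl (isBigO_curve_sub_curve le_rfl (by omega) hz)).exists_pos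
  obtain ⟨K, u, hu, hK⟩ := (hG.fderiv.contDiffAt (n := 1)).exists_lipschitzOnWith
  obtain ⟨δ, hδ, hδu⟩ := Metric.mem_nhds_iff.mp hu
  have hb₂ : ∀ᶠ ε : 𝕜 in 𝓝 0, ‖Λ.poly ε ∘L D.inclSum k‖ < ‖Λ.poly (0 : 𝕜) ∘L D.inclSum k‖ + 1 :=
    ((Λ.contDiff_poly (n := 0)).continuous.clm_comp continuous_const).continuousAt.norm.eventually_lt
      continuousAt_const (lt_add_one _)
  set C₂ := ‖Λ.poly (0 : 𝕜) ∘L D.inclSum k‖ + 1 with hC₂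
  have hb₃ : ∀ᶠ ε : 𝕜 in 𝓝 0, curve (2 * k + 1) z ε ∈ ball (0 : B) (δ / 2) :=
    (tendsto_curve (2 * k + 1) z).eventually_mem (ball_mem_nhds _ (half_pos hδ))
  have hb₄ : ∀ᶠ ε : 𝕜 in 𝓝 0, ‖ε‖ ^ (k + 1) * (C₂ * (1 + r)) < δ / 2 := by
    have : Tendsto (fun ε : 𝕜 => ‖ε‖ ^ (k + 1) * (C₂ * (1 + r))) (𝓝 0) (𝓝 0) :=
      Continuous.tendsto' (by fun_prop) _ _ (by simp)
    exact this.eventually_lt_const (half_pos hδ)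
  obtain ⟨ε₁, hε₁, C', hd⟩ := hexp (K * (C₂ * (1 + r)) + C₁) (by positivity)
  obtain ⟨ε₂, hε₂, hb⟩ := Metric.eventually_nhds_iff_ball.mp
    ((hb₁.bound.and hb₂).and (hb₃.and hb₄))
  refine ⟨min ε₁ ε₂, lt_min hε₁ hε₂, C', fun ε hε n hn => hd ε ?_ _ ?_⟩
  · exact ball_subset_ball (min_le_left _ _) hε
  obtain ⟨⟨b1, b2⟩, b3, b4⟩ := hb ε (ball_subset_ball (min_le_right _ _) hε)
  set x : D.CoParam k × D.Param k := (Λ.baseSolution G z ε n, n) with hx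
  have hxn : ‖x‖ ≤ 1 + r := by
    have h3 : ‖Λ.baseSolution G z ε n‖ < 1 :=
      mem_ball_zero_iff.mp (Λ.solution_mem G 0 z 0 0 0 ε n)
    have h4 : ‖n‖ < r := mem_ball_zero_iff.mp hn
    rw [hx, Prod.norm_def]
    exact max_le (by linarith) (by linarith)
  have hcurve : curve (2 * k + 1) (Λ.baseTuple G z ε n) ε
      = curve (2 * k + 1) z ε + ε ^ (k + 1) • (Λ.poly ε ∘L D.inclSum k) x := by
    rw [baseTuple, Λ.curve_shiftTuple (by omega) (by omega)]
    rfl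
  have hadd : ‖ε ^ (k + 1) • (Λ.poly ε ∘L D.inclSum k) x‖ ≤ ‖ε‖ ^ (k + 1) * (C₂ * (1 + r)) := by
    rw [norm_smul, norm_pow]
    gcongr
    exact (ContinuousLinearMap.le_opNorm _ _).trans
      (mul_le_mul b2.le hxn (norm_nonneg _) (by positivity))
  have hm1 : curve (2 * k + 1) z ε ∈ u :=
    hδu (ball_subset_ball (by linarith) b3)
  have hm2 : curve (2 * k + 1) (Λ.baseTuple G z ε n) ε ∈ u := by
    refine hδu ?_
    rw [mem_ball_zero_iff] at b3 ⊢
    rw [hcurve]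
    exact (norm_add_le _ _).trans_lt (by linarith)
  have hL := hK.dist_le_mul _ hm2 _ hm1
  rw [dist_eq_norm, dist_eq_norm] at hL
  have e0 : curve (2 * k + 1) (Λ.baseTuple G z ε n) ε - curve (2 * k + 1) z ε
      = ε ^ (k + 1) • (Λ.poly ε ∘L D.inclSum k) x := by
    rw [hcurve, add_sub_cancel_left]
  rw [e0] at hL
  rw [norm_pow] at b1
  calc _ ≤ ‖fderiv 𝕜 G (curve (2 * k + 1) (Λ.baseTuple G z ε n) ε)
          - fderiv 𝕜 G (curve (2 * k + 1) z ε)‖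
        + ‖fderiv 𝕜 G (curve (2 * k + 1) z ε)
          - ∑ j ∈ Finset.range (k + 1), ε ^ j • linCoeff 𝕜 G k zbar j‖ := norm_sub_le_norm_sub_add_norm_sub _ _ _
    _ ≤ K * (‖ε‖ ^ (k + 1) * (C₂ * (1 + r))) + C₁ * ‖ε‖ ^ (k + 1) := by
        refine add_le_add (hL.trans ?_) b1
        gcongr
    _ = _ := by ring

end LiftSystem
end IterationData
end UndeterminedCoefficients

/-! ### Smooth square roots of odd powers -/

namespace UndeterminedCoefficients

section SquareRoot

/-- A smooth function that is `o(tᵐ)` is `O(t^{m+1})`. -/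
theorem isBigO_pow_succ_of_isLittleO {E : Type*} [NormedAddCommGroup E] [NormedSpace ℝ E]
    {g : ℝ → E} (hg : ContDiffAt ℝ ∞ g 0) {m : ℕ} (h : g =o[𝓝 0] fun t => t ^ m) :
    g =O[𝓝 0] fun t => t ^ (m + 1) := by
  obtain ⟨δ, hδ, hb⟩ := Metric.eventually_nhds_iff_ball.mp
    ((hg.of_le (m := ((m + 1 : ℕ) : WithTop ℕ∞)) (by exact_mod_cast le_top)).eventually
      (by exact_mod_cast ENat.natCast_ne_top (m + 1)))
  have hs : Convex ℝ (ball (0 : ℝ) δ) := convex_ball _ _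
  have h0 : (0 : ℝ) ∈ ball (0 : ℝ) δ := mem_ball_self hδ
  have hT : ∀ n ≤ m + 1, (fun t => g t - taylorWithinEval g n (ball 0 δ) 0 t) =o[𝓝 0]
      fun t => t ^ n := by
    intro n hn
    have := taylor_isLittleO (n := n) hs h0 fun t ht =>
      ((hb t ht).of_le (by exact_mod_cast hn)).contDiffWithinAt
    simpa [nhdsWithin_eq_nhds.mpr (isOpen_ball.mem_nhds h0)] using this
  have key : ∀ n ≤ m, ∀ t, taylorWithinEval g n (ball 0 δ) 0 t = 0 := by
    intro n
    induction n with
    | zero =>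
      intro _ t
      rw [taylor_within_zero_eval]
      have h1 : g =o[𝓝 0] fun _ => (1 : ℝ) :=
        h.trans_isBigO ((continuousAt_id.pow m).isBigO_one ℝ)
      rw [isLittleO_one_iff] at h1
      exact tendsto_nhds_unique hg.continuousAt h1
    | succ n ih =>
      intro hn t
      set a := iteratedDerivWithin (n + 1) g (ball 0 δ) 0 with ha
      have e : ∀ t, taylorWithinEval g (n + 1) (ball 0 δ) 0 t
          = (((n + 1 : ℝ) * n !)⁻¹ * t ^ (n + 1)) • a := fun t => by
        rw [taylorWithinEval_succ, ih (by omega), zero_add, sub_zero]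
      have h1 : (fun t : ℝ => (((n + 1 : ℝ) * n !)⁻¹ * t ^ (n + 1)) • a) =o[𝓝 0]
          fun t => t ^ (n + 1) := by
        have h2 := (h.trans_isBigO (isBigO_pow_pow hn)).sub (hT (n + 1) (by omega))
        refine h2.congr_left fun t => ?_
        rw [e]; abel
      have ha0 : a = 0 := by
        by_contra hne
        have h3 : (fun t : ℝ => t ^ (n + 1)) =O[𝓝 0]
            fun t : ℝ => (((n + 1 : ℝ) * n !)⁻¹ * t ^ (n + 1)) • a := by
          have hc : 0 < ((n + 1 : ℝ) * n !)⁻¹ * ‖a‖ := by positivity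
          refine IsBigO.of_bound (((n + 1 : ℝ) * n !)⁻¹ * ‖a‖)⁻¹ (Eventually.of_forall fun t => ?_)
          rw [norm_smul, norm_mul, Real.norm_of_nonneg (show 0 ≤ ((n + 1 : ℝ) * n !)⁻¹ by positivity)]
          refine le_of_eq ?_
          field_simp
        refine isLittleO_irrefl ?_ (h3.trans_isLittleO h1)
        have h4 : ∃ᶠ t : ℝ in 𝓝[≠] 0, t ^ (n + 1) ≠ 0 :=
          (eventually_mem_nhdsWithin.mono fun t (ht : t ∈ ({0}ᶜ : Set ℝ)) =>
            pow_ne_zero _ ht).frequently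
        exact h4.filter_mono nhdsWithin_le_nhds
      rw [e, ha0, smul_zero]
  have h1 : (fun t => taylorWithinEval g (m + 1) (ball 0 δ) 0 t) =O[𝓝 0] fun t => t ^ (m + 1) := by
    simp only [taylorWithinEval_succ, key m le_rfl, zero_add, sub_zero, mul_comm _ (_ ^ (m + 1)),
      mul_smul]
    exact isBigO_pow_smul (𝕜 := ℝ) (m + 1) continuousAt_const
  refine ((hT (m + 1) le_rfl).isBigO.add h1).congr_left fun t => ?_
  abel

variable {𝕜 : Type*} [RCLike 𝕜]

/-- A product of an odd power of `x`, where `x` has a simple zero, and a unit has no smooth square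
root `y`: on the real line, `y` would be `o(tᵐ)`, hence `O(t^{m+1})`, and `y²` of too high order. -/
theorem not_eventually_sq_mul_eq {x y u v : 𝕜 → 𝕜} (hy : ContDiffAt 𝕜 ∞ y 0) {x' : 𝕜}
    (hx : HasDerivAt x x' 0) (hx' : x' ≠ 0) (hx0 : x 0 = 0) (hu : ContinuousAt u 0) (hu0 : u 0 ≠ 0)
    (hv : ContinuousAt v 0) (hv0 : v 0 ≠ 0) (m : ℕ) :
    ¬ ∀ᶠ ε in 𝓝 0, y ε ^ 2 * u ε = x ε ^ (2 * m + 1) * v ε := by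
  intro h
  -- the restrictions to the real line
  have hι : Tendsto (fun t : ℝ => (t : 𝕜)) (𝓝 0) (𝓝 0) :=
    RCLike.continuous_ofReal.tendsto' _ _ RCLike.ofReal_zero
  have hg : ContDiffAt ℝ ∞ (fun t : ℝ => y t) 0 := by
    refine ContDiffAt.fun_comp (f := fun t : ℝ => (t : 𝕜)) 0 ?_
      (RCLike.ofRealCLM (K := 𝕜)).contDiff.contDiffAt
    rw [RCLike.ofReal_zero]
    exact hy.restrict_scalars ℝ
  have hxt : x =Θ[𝓝 0] fun ε => ε := by
    have h1 := HasDerivAtFilter.isTheta_sub hx hx'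
    have h2 : Tendsto (fun ε : 𝕜 => (ε, (0 : 𝕜))) (𝓝 0) (𝓝 0 ×ˢ pure 0) :=
      tendsto_id.prodMk tendsto_const_pure
    have h3 : (fun ε => x ε - x 0) =Θ[𝓝 0] fun ε => ε - 0 :=
      ⟨h1.1.comp_tendsto h2, h1.2.comp_tendsto h2⟩
    simpa [hx0] using h3
  have hxv : (fun ε => x ε ^ (2 * m + 1) * v ε) =Θ[𝓝 0] fun ε : 𝕜 => ε ^ (2 * m + 1) := by
    have h1 : v =Θ[𝓝 0] fun _ => (1 : 𝕜) := by
      exact ((isEquivalent_const_iff_tendsto hv0).mpr hv).isTheta.trans (isTheta_const_const hv0 one_ne_zero)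
    simpa using (hxt.pow (2 * m + 1)).mul h1
  have hyu : (fun ε => y ε ^ 2) =Θ[𝓝 0] fun ε : 𝕜 => ε ^ (2 * m + 1) := by
    have h1 : u =Θ[𝓝 0] fun _ => (1 : 𝕜) := by
      exact ((isEquivalent_const_iff_tendsto hu0).mpr hu).isTheta.trans (isTheta_const_const hu0 one_ne_zero)
    have h2 : (fun ε => y ε ^ 2) =Θ[𝓝 0] fun ε => y ε ^ 2 * u ε := by
      simpa using (isTheta_refl (fun ε => y ε ^ 2) (𝓝 0)).mul h1.symm
    exact (h2.trans_eventuallyEq h).trans hxv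
  have hyt : (fun t : ℝ => y t ^ 2) =Θ[𝓝 0] fun t : ℝ => t ^ (2 * m + 1) := by
    have h1 : (fun t : ℝ => y t ^ 2) =Θ[𝓝 0] fun t : ℝ => (t : 𝕜) ^ (2 * m + 1) :=
      ⟨hyu.1.comp_tendsto hι, hyu.2.comp_tendsto hι⟩
    refine h1.trans (IsTheta.of_norm_eventuallyEq_norm (Eventually.of_forall fun t => ?_))
    simp
  have hlt : (fun t : ℝ => t ^ (2 * m + 1)) =o[𝓝 0] fun t : ℝ => t ^ (2 * m) :=
    isLittleO_pow_pow (by omega)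
  have hlt' : (fun t : ℝ => t ^ (2 * m + 2)) =o[𝓝 0] fun t : ℝ => t ^ (2 * m + 1) :=
    isLittleO_pow_pow (by omega)
  have ho : (fun t : ℝ => y t) =o[𝓝 0] fun t : ℝ => t ^ m := by
    refine IsLittleO.of_pow (n := 2) ?_ two_ne_zero
    have : (fun t : ℝ => t ^ m) ^ 2 = fun t : ℝ => t ^ (2 * m) := by
      funext t
      rw [Pi.pow_apply, ← pow_mul, mul_comm]
    rw [this]
    exact hyt.1.trans_isLittleO hlt
  have hO := (isBigO_pow_succ_of_isLittleO hg ho).pow 2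
  have hO' : (fun t : ℝ => y t ^ 2) =O[𝓝 0] fun t : ℝ => t ^ (2 * m + 2) := by
    refine hO.congr_right fun t => ?_
    rw [← pow_mul]
    congr 1
    ring
  refine isLittleO_irrefl ?_ ((hyt.2.trans hO').trans_isLittleO hlt')
  have h4 : ∃ᶠ t : ℝ in 𝓝[≠] 0, t ^ (2 * m + 1) ≠ 0 :=
    (eventually_mem_nhdsWithin.mono fun t (ht : t ∈ ({0}ᶜ : Set ℝ)) =>
            pow_ne_zero _ ht).frequently
  exact h4.filter_mono nhdsWithin_le_nhds

end SquareRoot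
end UndeterminedCoefficients

/-! ### The curves `y² = x^{2k}` and their perturbations -/

namespace UndeterminedCoefficients

section Example

variable {𝕜 : Type*} [RCLike 𝕜]

/-- The scaling factor `(2m)!/m!` in the definition of `S_{m+1}`. -/
def factorialRatio (𝕜 : Type*) [RCLike 𝕜] (m : ℕ) : 𝕜 := ((2 * m)! : 𝕜) / (m ! : 𝕜)

theorem factorialRatio_ne_zero (m : ℕ) : factorialRatio 𝕜 m ≠ 0 :=
  IterationData.factorial_div_factorial_ne_zero m

/-- The iteration for `A₀ = ⋯ = A_{k-1} = 0` and a linear functional `A_k = L` on `𝕜²` with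
`L (0, 1) ≠ 0`: the first `k` operators vanish, and `S_{k+1}` is a multiple of `L`. -/
def finalStepData (L : 𝕜 × 𝕜 →L[𝕜] 𝕜) (k : ℕ) : IterationData 𝕜 (𝕜 × 𝕜) 𝕜 where
  N m := if m ≤ k then ⊤ else LinearMap.ker (L : 𝕜 × 𝕜 →ₗ[𝕜] 𝕜)
  Nc m := if m = k + 1 then Submodule.span 𝕜 {(0, 1)} else ⊥
  R m := if m = k + 1 then ⊤ else ⊥
  Rc m := if m ≤ k then ⊤ else ⊥
  S m := if h : m = k then
    (factorialRatio 𝕜 m • (L ∘L Submodule.subtypeL _)).codRestrict _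
      (fun n => by rw [if_pos h.le]; trivial)
    else 0

variable {L : 𝕜 × 𝕜 →L[𝕜] 𝕜} {k : ℕ}

theorem finalStepData_N {m : ℕ} (hm : m ≤ k) : (finalStepData L k).N m = ⊤ := if_pos hm
theorem finalStepData_N_succ :
    (finalStepData L k).N (k + 1) = LinearMap.ker (L : 𝕜 × 𝕜 →ₗ[𝕜] 𝕜) := if_neg (by omega)
theorem finalStepData_Nc {m : ℕ} (hm : m < k) : (finalStepData L k).Nc (m + 1) = ⊥ :=
  if_neg (by omega)
theorem finalStepData_Nc_succ : (finalStepData L k).Nc (k + 1) = Submodule.span 𝕜 {(0, 1)} :=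
  if_pos rfl
theorem finalStepData_R {m : ℕ} (hm : m < k) : (finalStepData L k).R (m + 1) = ⊥ :=
  if_neg (by omega)
theorem finalStepData_R_succ : (finalStepData L k).R (k + 1) = ⊤ := if_pos rfl
theorem finalStepData_Rc {m : ℕ} (hm : m ≤ k) : (finalStepData L k).Rc m = ⊤ := if_pos hm
theorem finalStepData_Rc_succ : (finalStepData L k).Rc (k + 1) = ⊥ := if_neg (by omega)

theorem finalStepData_S_of_ne {m : ℕ} (hm : m ≠ k) : (finalStepData L k).S m = 0 :=
  dif_neg hm

theorem finalStepData_S_self (n : (finalStepData L k).N k) :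
    ((finalStepData L k).S k n : 𝕜) = factorialRatio 𝕜 k * L n := by
  have : (finalStepData L k).S k = (factorialRatio 𝕜 k • (L ∘L Submodule.subtypeL _)).codRestrict _
      (fun n => by rw [finalStepData_Rc le_rfl]; trivial) := dif_pos rfl
  rw [this]
  rfl

theorem factorialRatio_mul_apply (hL : L (0, 1) ≠ 0) (f : 𝕜) :
    factorialRatio 𝕜 k * L (0, f / (factorialRatio 𝕜 k * L (0, 1))) = f := by
  have e : ((0, f / (factorialRatio 𝕜 k * L (0, 1))) : 𝕜 × 𝕜)
      = (f / (factorialRatio 𝕜 k * L (0, 1))) • (0, 1) := by simp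
  rw [e, map_smul, smul_eq_mul]
  have := factorialRatio_ne_zero (𝕜 := 𝕜) k
  field_simp

theorem finalStepData_isIteration (hL : L (0, 1) ≠ 0) {A : ℕ → 𝕜 × 𝕜 →L[𝕜] 𝕜}
    (hA : ∀ j < k, A j = 0) (hAk : A k = L) : (finalStepData L k).IsIteration A k where
  N_zero := finalStepData_N (Nat.zero_le k)
  Rc_zero := finalStepData_Rc (Nat.zero_le k)
  S_spec m hm n := by
    have hlift : ∀ i ≤ m, prodCoeff A i (fun j => if j = 0 then (n : 𝕜 × 𝕜) else 0) = A i n := by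
      intro i hi
      rw [prodCoeff, Finset.sum_range_succ, Finset.sum_eq_zero, zero_add, Nat.sub_self, if_pos rfl]
      intro j hj
      rw [Finset.mem_range] at hj
      rw [hA j (by omega), zero_apply]
    refine ⟨fun j => if j = 0 then n else 0, if_pos rfl, fun i hi => ?_, ?_⟩
    · rw [hlift i hi.le, hA i (by omega), zero_apply]
    · rw [hlift m le_rfl]
      rcases hm.lt_or_eq with h | rfl
      · rw [finalStepData_S_of_ne h.ne, hA m h]
        simp
      · rw [finalStepData_S_self, hAk, smul_eq_mul, factorialRatio, sub_self]
        exact zero_mem _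
  N_succ m hm := by
    rcases hm.lt_or_eq with h | rfl
    · rw [finalStepData_S_of_ne h.ne, finalStepData_N h]
      simp [finalStepData_N hm]
    · rw [finalStepData_N_succ]
      ext x
      constructor
      · intro hx
        have hxN : x ∈ (finalStepData L m).N m := by rw [finalStepData_N le_rfl]; trivial
        refine ⟨⟨x, hxN⟩, Subtype.ext ?_, rfl⟩
        rw [ContinuousLinearMap.coe_coe, finalStepData_S_self, show L x = 0 from hx, mul_zero]
        rfl
      · rintro ⟨y, hy, rfl⟩
        have h1 : ((finalStepData L m).S m y : 𝕜) = 0 := congrArg Subtype.val hy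
        rw [finalStepData_S_self] at h1
        exact (mul_eq_zero.mp h1).resolve_left (factorialRatio_ne_zero m)
  R_succ m hm := by
    rcases hm.lt_or_eq with h | rfl
    · rw [finalStepData_S_of_ne h.ne, finalStepData_R h]
      simp
    · rw [finalStepData_R_succ, eq_comm, eq_top_iff]
      intro f _
      have hN : (0, f / (factorialRatio 𝕜 m * L (0, 1))) ∈ (finalStepData L m).N m := by
        rw [finalStepData_N le_rfl]; trivial
      refine ⟨_, ⟨⟨_, hN⟩, rfl⟩, ?_⟩
      rw [Submodule.subtype_apply, ContinuousLinearMap.coe_coe, finalStepData_S_self]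
      exact factorialRatio_mul_apply hL f
  N_disjoint m hm := by
    rcases hm.lt_or_eq with h | rfl
    · rw [finalStepData_Nc h]; exact disjoint_bot_left
    · rw [finalStepData_Nc_succ, finalStepData_N_succ, Submodule.disjoint_def]
      intro x hx hx'
      obtain ⟨t, rfl⟩ := Submodule.mem_span_singleton.mp hx
      have h1 : L (t • (0, 1)) = 0 := hx'
      rw [map_smul, smul_eq_mul] at h1
      rw [(mul_eq_zero.mp h1).resolve_right hL, zero_smul]
  N_sup m hm := by
    rcases hm.lt_or_eq with h | rfl
    · rw [finalStepData_Nc h, finalStepData_N h, finalStepData_N hm, bot_sup_eq]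
    · rw [finalStepData_Nc_succ, finalStepData_N_succ, finalStepData_N le_rfl, eq_top_iff]
      intro x _
      refine Submodule.mem_sup.mpr ⟨(L x / L (0, 1)) • (0, 1),
        Submodule.smul_mem _ _ (Submodule.mem_span_singleton_self _),
        x - (L x / L (0, 1)) • (0, 1), ?_, by abel⟩
      show L (x - (L x / L (0, 1)) • (0, 1)) = 0
      rw [map_sub, map_smul, smul_eq_mul, div_mul_cancel₀ _ hL, sub_self]
  R_disjoint m hm := by
    rcases hm.lt_or_eq with h | rfl
    · rw [finalStepData_R h]; exact disjoint_bot_left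
    · rw [finalStepData_Rc_succ]; exact disjoint_bot_right
  R_sup m hm := by
    rcases hm.lt_or_eq with h | rfl
    · rw [finalStepData_R h, finalStepData_Rc h, finalStepData_Rc hm, bot_sup_eq]
    · rw [finalStepData_R_succ, finalStepData_Rc le_rfl, top_sup_eq]
  Nc_closed m _ := Submodule.closed_of_finiteDimensional _
  R_closed m _ := Submodule.closed_of_finiteDimensional _
  Rc_closed m _ := Submodule.closed_of_finiteDimensional _

theorem finalStepData_surjective (hL : L (0, 1) ≠ 0) :
    Function.Surjective ((finalStepData L k).sumOp k) := by
  intro f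
  have hN : (0, f / (factorialRatio 𝕜 k * L (0, 1))) ∈ (finalStepData L k).N (Fin.last k) := by
    rw [Fin.val_last, finalStepData_N le_rfl]; trivial
  refine ⟨Pi.single (Fin.last k) ⟨_, hN⟩, ?_⟩
  simp only [IterationData.sumOp, sum_apply, ContinuousLinearMap.comp_apply,
    ContinuousLinearMap.proj_apply, Submodule.subtypeL_apply]
  rw [Finset.sum_eq_single (Fin.last k)]
  · rw [Pi.single_eq_same]
    exact (finalStepData_S_self _).trans (factorialRatio_mul_apply hL f)
  · intro i _ hi
    rw [Pi.single_eq_of_ne hi, map_zero, Submodule.coe_zero]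
  · simp

/-- The function `y² - x^{2k}`, whose zero set consists of the curves `y = ± xᵏ`. -/
def tangentCurves (𝕜 : Type*) [RCLike 𝕜] (k : ℕ) (z : 𝕜 × 𝕜) : 𝕜 := z.2 ^ 2 - z.1 ^ (2 * k)

/-- The coefficients of the curve `(ε, εᵏ)`. -/
def powerTuple (𝕜 : Type*) [RCLike 𝕜] (k i : ℕ) : 𝕜 × 𝕜 :=
  (if i = 1 then 1 else 0, if i = k then (k ! : 𝕜) else 0)

theorem curve_powerTuple (hk : 1 ≤ k) {n : ℕ} (hn : k ≤ n) (ε : 𝕜) :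
    curve n (powerTuple 𝕜 k) ε = (ε, ε ^ k) := by
  have hfac : (k ! : 𝕜) ≠ 0 := Nat.cast_ne_zero.mpr (Nat.factorial_ne_zero _)
  refine Prod.ext ?_ ?_
  · rw [curve, Prod.fst_sum, Finset.sum_eq_single 1]
    · simp [powerTuple]
    · intro j _ hj
      simp [powerTuple, hj]
    · intro h
      exact absurd (Finset.mem_Icc.mpr ⟨le_rfl, hk.trans hn⟩) h
  · rw [curve, Prod.snd_sum, Finset.sum_eq_single k]
    · simp [powerTuple, hfac]
    · intro j _ hj
      simp [powerTuple, hj]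
    · intro h
      exact absurd (Finset.mem_Icc.mpr ⟨hk, hn⟩) h

theorem analyticAt_tangentCurves (z : 𝕜 × 𝕜) : AnalyticAt 𝕜 (tangentCurves 𝕜 k) z :=
  (analyticAt_snd.pow 2).sub (analyticAt_fst.pow (2 * k))

theorem tangentCurves_zero (hk : 1 ≤ k) : tangentCurves 𝕜 k 0 = 0 := by
  simp [tangentCurves, show k ≠ 0 by omega]

theorem fderiv_tangentCurves (z : 𝕜 × 𝕜) : fderiv 𝕜 (tangentCurves 𝕜 k) z
    = (2 * z.2) • ContinuousLinearMap.snd 𝕜 𝕜 𝕜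
      - (2 * k * z.1 ^ (2 * k - 1)) • ContinuousLinearMap.fst 𝕜 𝕜 𝕜 := by
  have h1 := (hasFDerivAt_snd (𝕜 := 𝕜) (p := z)).pow 2
  have h2 := (hasFDerivAt_fst (𝕜 := 𝕜) (p := z)).pow (2 * k)
  refine (h1.sub h2).fderiv.trans ?_
  simp

/-- The first nonvanishing coefficient of the linearization of `y² - x^{2k}` along `(ε, εᵏ)`. -/
def tangentFunctional (𝕜 : Type*) [RCLike 𝕜] (k : ℕ) : 𝕜 × 𝕜 →L[𝕜] 𝕜 :=
  (2 : 𝕜) • ContinuousLinearMap.snd 𝕜 𝕜 𝕜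
    - (if k = 1 then (2 : 𝕜) else 0) • ContinuousLinearMap.fst 𝕜 𝕜 𝕜

theorem tangentFunctional_apply : tangentFunctional 𝕜 k (0, 1) ≠ 0 := by
  show (2 : 𝕜) * 1 - (if k = 1 then (2 : 𝕜) else 0) * 0 ≠ 0
  simp

theorem linCoeff_tangentCurves (hk : 1 ≤ k) : ∀ j < k + 1,
    linCoeff 𝕜 (tangentCurves 𝕜 k) k (powerTuple 𝕜 k) j
      = if j = k then tangentFunctional 𝕜 k else 0 := by
  refine linCoeff_eq_of_isBigO (analyticAt_tangentCurves 0) ?_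
  have e : ∀ ε : 𝕜, fderiv 𝕜 (tangentCurves 𝕜 k) (curve k (powerTuple 𝕜 k) ε)
      - ∑ j ∈ Finset.range (k + 1), ε ^ j • (if j = k then tangentFunctional 𝕜 k else 0)
      = ε ^ k • (if k = 1 then (2 : 𝕜) else 0) • ContinuousLinearMap.fst 𝕜 𝕜 𝕜
        - ε ^ (2 * k - 1) • ((2 * k : 𝕜) • ContinuousLinearMap.fst 𝕜 𝕜 𝕜) := by
    intro ε
    have hs : ∑ j ∈ Finset.range (k + 1), ε ^ j • (if j = k then tangentFunctional 𝕜 k else 0)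
        = ε ^ k • tangentFunctional 𝕜 k := by
      rw [Finset.sum_eq_single k]
      · rw [if_pos rfl]
      · intro j _ hj
        rw [if_neg hj]
        exact smul_zero (A := 𝕜 × 𝕜 →L[𝕜] 𝕜) (ε ^ j)
      · intro h
        exact absurd (Finset.self_mem_range_succ k) h
    rw [hs, curve_powerTuple hk le_rfl, fderiv_tangentCurves, tangentFunctional]
    module
  simp only [e]
  rcases hk.eq_or_lt with rfl | hk1
  · refine (isBigO_zero _ _).congr_left fun ε => ?_
    simp
  · refine (((isBigO_pow_smul (2 * k - 1) (f := fun _ : 𝕜 =>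
      (2 * k : 𝕜) • ContinuousLinearMap.fst 𝕜 𝕜 𝕜) continuousAt_const).trans
      (isBigO_pow_pow (by omega))).neg_left).congr_left fun ε => ?_
    rw [if_neg hk1.ne']
    module

theorem isRegularWith_tangentCurves (hk : 1 ≤ k) :
    IsRegularWith (tangentCurves 𝕜 k) k (powerTuple 𝕜 k)
      (finalStepData (tangentFunctional 𝕜 k) k) where
  iteration := finalStepData_isIteration tangentFunctional_apply
    (fun j hj => by rw [linCoeff_tangentCurves hk j (by omega), if_neg hj.ne])
    (by rw [linCoeff_tangentCurves hk k (by omega), if_pos rfl])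
  solvable := by
    refine ⟨powerTuple 𝕜 k, ?_, fun _ _ _ => rfl⟩
    rw [mem_X_iff (analyticAt_tangentCurves 0) (tangentCurves_zero hk) le_rfl]
    refine (isBigO_zero _ _).congr_left fun ε => ?_
    rw [curve_powerTuple hk (by omega), tangentCurves, ← pow_mul, mul_comm, sub_self]
  surjective := finalStepData_surjective tangentFunctional_apply

/-- The perturbation of `y² - x^{2k}` of order `l`: the odd power `xˡ` if `l` is odd, and
`yˡ + x^{2k-1}` if `l` is even, where `yˡ` fixes the order and the odd power of `x` prevents smooth
solution curves. -/
def destroyer (𝕜 : Type*) [RCLike 𝕜] (k l : ℕ) (z : 𝕜 × 𝕜) : 𝕜 :=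
  if Odd l then z.1 ^ l else z.2 ^ l + z.1 ^ (2 * k - 1)

theorem analyticAt_destroyer (l : ℕ) (z : 𝕜 × 𝕜) : AnalyticAt 𝕜 (destroyer 𝕜 k l) z := by
  unfold destroyer
  split_ifs
  · exact analyticAt_fst.pow l
  · exact (analyticAt_snd.pow l).add (analyticAt_fst.pow _)

theorem isBigO_destroyer {l : ℕ} (hl : l ≤ 2 * k - 1) :
    destroyer 𝕜 k l =O[𝓝 0] fun z => ‖z‖ ^ l := by
  have h1 : ∀ {m : ℕ}, l ≤ m → (fun z : 𝕜 × 𝕜 => z.1 ^ m) =O[𝓝 0] fun z => ‖z‖ ^ l := by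
    intro m hm
    refine IsBigO.of_bound 1 ?_
    filter_upwards [ball_mem_nhds (0 : 𝕜 × 𝕜) one_pos] with z hz
    rw [mem_ball_zero_iff] at hz
    rw [norm_pow, norm_pow, norm_norm, one_mul]
    exact (pow_le_pow_left₀ (norm_nonneg _) (norm_fst_le z) m).trans
      (pow_le_pow_of_le_one (norm_nonneg _) hz.le hm)
  have h2 : (fun z : 𝕜 × 𝕜 => z.2 ^ l) =O[𝓝 0] fun z => ‖z‖ ^ l := by
    refine IsBigO.of_bound 1 (Eventually.of_forall fun z => ?_)
    rw [norm_pow, norm_pow, norm_norm, one_mul]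
    exact pow_le_pow_left₀ (norm_nonneg _) (norm_snd_le z) l
  unfold destroyer
  split_ifs
  · exact h1 le_rfl
  · exact h2.add (h1 hl)

theorem not_isBigO_destroyer (hk : 1 ≤ k) (l : ℕ) :
    ¬ destroyer 𝕜 k l =O[𝓝 0] fun z => ‖z‖ ^ (l + 1) := by
  intro h
  -- on one of the coordinate axes the function is `εˡ`
  obtain ⟨p, hp, hpe⟩ : ∃ p : 𝕜 × 𝕜, ‖p‖ = 1 ∧ ∀ ε : 𝕜, destroyer 𝕜 k l (ε • p) = ε ^ l := by
    by_cases hl : Odd l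
    · refine ⟨(1, 0), by simp, fun ε => ?_⟩
      simp [destroyer, hl]
    · refine ⟨(0, 1), by simp, fun ε => ?_⟩
      simp [destroyer, hl, show 2 * k - 1 ≠ 0 by omega]
  have ht : Tendsto (fun ε : 𝕜 => ε • p) (𝓝 0) (𝓝 0) :=
    Continuous.tendsto' (by fun_prop) _ _ (zero_smul _ _)
  have h1 : (fun ε : 𝕜 => ε ^ l) =O[𝓝 0] fun ε : 𝕜 => ε ^ (l + 1) := by
    refine ((h.comp_tendsto ht).congr_left hpe).trans ?_
    refine IsBigO.of_bound 1 (Eventually.of_forall fun ε => ?_)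
    simp [norm_smul, hp]
  refine isLittleO_irrefl ?_ (h1.trans_isLittleO (isLittleO_pow_pow (Nat.lt_succ_self l)))
  have h4 : ∃ᶠ t : 𝕜 in 𝓝[≠] 0, t ^ l ≠ 0 :=
    (eventually_mem_nhdsWithin.mono fun t (ht : t ∈ ({0}ᶜ : Set 𝕜)) =>
      pow_ne_zero _ ht).frequently
  exact h4.filter_mono nhdsWithin_le_nhds

/-- Along a solution curve with `x'(0) ≠ 0`, a unit times `y²` would be a unit times an odd power of
`x`, which `not_eventually_sq_mul_eq` excludes. The exceptions are `l = 0`, where the origin is no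
solution, and `l = 2`, `c = -1`, where the terms in `y` cancel. -/
theorem noSolutionCurve_destroyer (hk : 1 ≤ k) {l : ℕ} (hl : l ≤ 2 * k - 1) {c : 𝕜} (hc : c ≠ 0) :
    NoSolutionCurve 𝕜 (fun z => tangentCurves 𝕜 k z + c • destroyer 𝕜 k l z)
      {z : 𝕜 × 𝕜 | z.1 ≠ 0} := by
  intro z hz hz0 hzd hsol
  have hx : ContDiffAt 𝕜 ∞ (fun ε => (z ε).1) 0 := hz.fst
  have hy : ContDiffAt 𝕜 ∞ (fun ε => (z ε).2) 0 := hz.snd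
  have hxd : HasDerivAt (fun ε => (z ε).1) (deriv z 0).1 0 := by
    exact hasFDerivAt_fst.comp_hasDerivAt (0 : 𝕜) (hz.differentiableAt (by simp)).hasDerivAt
  have hx0 : (z 0).1 = 0 := by rw [hz0]; rfl
  have hy0 : (z 0).2 = 0 := by rw [hz0]; rfl
  by_cases hodd : Odd l
  · -- `y² = x^l (x^{2k-l} - c)`
    obtain ⟨m, rfl⟩ := hodd
    refine not_eventually_sq_mul_eq (x := fun ε => (z ε).1) (u := fun _ => 1)
      (v := fun ε => (z ε).1 ^ (2 * k - (2 * m + 1)) - c) hy hxd hzd hx0 continuousAt_const one_ne_zero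
      ((hx.continuousAt.pow _).sub continuousAt_const) ?_ m ?_
    · rw [hx0, zero_pow (by omega), zero_sub]
      exact neg_ne_zero.mpr hc
    · filter_upwards [hsol] with ε hε
      simp only [tangentCurves, destroyer, if_pos (show Odd (2 * m + 1) from ⟨m, rfl⟩),
        smul_eq_mul] at hε
      have e : (z ε).1 ^ (2 * k) = (z ε).1 ^ (2 * m + 1) * (z ε).1 ^ (2 * k - (2 * m + 1)) := by
        rw [← pow_add]; congr 1; omega
      rw [e] at hε
      linear_combination hε
  · have hsol' : ∀ᶠ ε in 𝓝 (0 : 𝕜),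
        (z ε).2 ^ 2 + c * (z ε).2 ^ l = (z ε).1 ^ (2 * (k - 1) + 1) * ((z ε).1 - c) := by
      filter_upwards [hsol] with ε hε
      simp only [tangentCurves, destroyer, if_neg hodd, smul_eq_mul] at hε
      have e1 : 2 * k - 1 = 2 * (k - 1) + 1 := by omega
      have e2 : (z ε).1 ^ (2 * k) = (z ε).1 ^ (2 * (k - 1) + 1) * (z ε).1 := by
        rw [← pow_succ]; congr 1; omega
      rw [e1, e2] at hε
      linear_combination hε
    have hvc : ContinuousAt (fun ε => (z ε).1 - c) 0 := hx.continuousAt.sub continuousAt_const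
    have hv0 : (z 0).1 - c ≠ 0 := by rw [hx0, zero_sub]; exact neg_ne_zero.mpr hc
    obtain rfl | rfl | hl4 : l = 0 ∨ l = 2 ∨ 3 ≤ l := by
      rcases Nat.lt_or_ge l 3 with h | h
      · interval_cases l
        · exact Or.inl rfl
        · exact absurd odd_one hodd
        · exact Or.inr (Or.inl rfl)
      · exact Or.inr (Or.inr h)
    · -- the origin is no solution
      have := hsol'.self_of_nhds
      rw [hx0, hy0] at this
      simp [hc] at this
    · by_cases hc1 : 1 + c = 0
      · -- the terms in `y` cancel, and `x` is not constant
        have h1 : ∀ᶠ ε in 𝓝[≠] (0 : 𝕜), (z ε).1 ≠ 0 := by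
          have := hxd.eventually_ne (c := 0) hzd
          exact this
        have h2 : ∀ᶠ ε in 𝓝[≠] (0 : 𝕜), (z ε).1 - c ≠ 0 :=
          nhdsWithin_le_nhds (hvc.eventually_ne hv0)
        obtain ⟨ε, ⟨h3, h4⟩, h5⟩ := ((h1.and h2).and (nhdsWithin_le_nhds hsol')).exists
        have h6 : (z ε).1 ^ (2 * (k - 1) + 1) * ((z ε).1 - c) = 0 := by
          rw [← h5]
          linear_combination (z ε).2 ^ 2 * hc1
        rcases mul_eq_zero.mp h6 with h7 | h7
        · exact h3 (pow_eq_zero_iff (by omega) |>.mp h7)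
        · exact h4 h7
      · refine not_eventually_sq_mul_eq (x := fun ε => (z ε).1) (u := fun _ => 1 + c)
          hy hxd hzd hx0 continuousAt_const hc1 hvc hv0 (k - 1) ?_
        filter_upwards [hsol'] with ε hε
        rw [← hε]; ring
    · refine not_eventually_sq_mul_eq (x := fun ε => (z ε).1)
        (u := fun ε => 1 + c * (z ε).2 ^ (l - 2))
        hy hxd hzd hx0 (continuousAt_const.add (continuousAt_const.mul (hy.continuousAt.pow _)))
        ?_ hvc hv0 (k - 1) ?_
      · rw [hy0, zero_pow (by omega)]; simp
      · filter_upwards [hsol'] with ε hε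
        rw [← hε]
        have e : (z ε).2 ^ l = (z ε).2 ^ 2 * (z ε).2 ^ (l - 2) := by
          rw [← pow_add]; congr 1; omega
        rw [e]; ring

end Example
end UndeterminedCoefficients

open UndeterminedCoefficients in
theorem corollary1 {𝕜 : Type*} [RCLike 𝕜]
    {B : Type*} [NormedAddCommGroup B] [NormedSpace 𝕜 B] [CompleteSpace B]
    {F : Type*} [NormedAddCommGroup F] [NormedSpace 𝕜 F] [CompleteSpace F]
    (G : B → F) (hG : AnalyticAt 𝕜 G 0) (hG0 : G 0 = 0)
    (k : ℕ) (hk : 1 ≤ k) (zbar : ℕ → B) (D : IterationData 𝕜 B F)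
    (hreg : IsRegularWith G k zbar D) :
    (∃ (M L : (Fin (k + 1) → B) ≃L[𝕜] (Fin (k + 1) → B)) (I₀ : Fin (k + 1) → B)
        (nc₀ : 𝕜 → D.Param k → D.CoParam k) (Z₀ : 𝕜 → D.Param k → ℕ → B),
      (IsSolutionFamily G k zbar D I₀ M L nc₀ Z₀ ∧ HasDetExpansion G k D Z₀) ∧
      (∀ H : B → F, AnalyticAt 𝕜 H 0 → H =O[𝓝 0] (fun z => ‖z‖ ^ (2 * k + 1)) →
        IsRegularWith (fun z => G z + H z) k zbar D ∧
        Xbar 𝕜 (fun z => G z + H z) k zbar (2 * k) = Xbar 𝕜 G k zbar (2 * k) ∧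
        ∃ (I : Fin (k + 1) → B) (nc : 𝕜 → D.Param k → D.CoParam k)
          (Z : 𝕜 → D.Param k → ℕ → B),
          IsSolutionFamily (fun z => G z + H z) k zbar D I M L nc Z ∧
          HasDetExpansion (fun z => G z + H z) k D Z) ∧
      (∀ H : B → F, AnalyticAt 𝕜 H 0 → H =O[𝓝 0] (fun z => ‖z‖ ^ (2 * k)) →
        Persists G H k zbar D Z₀)) ∧
    (∃ (G' : 𝕜 × 𝕜 → 𝕜) (zbar' : ℕ → 𝕜 × 𝕜) (D' : IterationData 𝕜 (𝕜 × 𝕜) 𝕜),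
      AnalyticAt 𝕜 G' 0 ∧ G' 0 = 0 ∧ IsRegularWith G' k zbar' D' ∧
      ∃ U ∈ 𝓝 (zbar' 1), ∀ l : ℕ, l ≤ 2 * k - 1 →
        ∃ H : 𝕜 × 𝕜 → 𝕜, AnalyticAt 𝕜 H 0 ∧
          H =O[𝓝 0] (fun z => ‖z‖ ^ l) ∧ ¬ H =O[𝓝 0] (fun z => ‖z‖ ^ (l + 1)) ∧
          ∀ c : 𝕜, c ≠ 0 → NoSolutionCurve 𝕜 (fun z => G' z + c • H z) U) := by
  have hD := hreg.iteration
  obtain ⟨Λ⟩ := IterationData.nonempty_liftSystem hD hreg.surjective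
  refine ⟨?_, tangentCurves 𝕜 k, powerTuple 𝕜 k, finalStepData (tangentFunctional 𝕜 k) k,
    analyticAt_tangentCurves 0, tangentCurves_zero hk, isRegularWith_tangentCurves hk,
    {z | z.1 ≠ 0}, ?_, fun l hl => ⟨destroyer 𝕜 k l, analyticAt_destroyer l 0,
      isBigO_destroyer hl, not_isBigO_destroyer hk l,
      fun c hc => noSolutionCurve_destroyer hk hl hc⟩⟩
  · obtain ⟨z, hz⟩ := Λ.exists_mem_Xbar hG hG0 hD hreg.solvable
    -- the parameters enter the curve through `n^c + n̄`, hence `L̂` is the identity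
    refine ⟨Λ.coeffEquiv, ContinuousLinearEquiv.refl 𝕜 _, fun i => z (2 * k + 1 - i),
      Λ.baseSolution G z, Λ.baseTuple G z,
      ⟨Λ.isSolutionFamily hk hG hG0 hD hz, Λ.hasDetExpansion hk hG hD hz.2⟩, ?_, ?_⟩
    · intro H hH hO
      have hreg' := hreg.add hk hG hG0 hH hO
      have hGH : AnalyticAt 𝕜 (fun z => G z + H z) 0 := hG.fun_add hH
      have hGH0 : G 0 + H 0 = 0 := by rw [hG0, isBigO_pow_succ_zero hO, add_zero]
      -- the same lifts serve for `G + H`, hence the same `M̂`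
      let Λ' := Λ.congr (linCoeff_add_eq hk hG hH hO zbar)
      obtain ⟨z', hz'⟩ := Λ'.exists_mem_Xbar hGH hGH0 hreg'.iteration hreg'.solvable
      exact ⟨hreg', Xbar_add_eq hG hG0 hH hO, fun i => z' (2 * k + 1 - i),
        Λ'.baseSolution (fun z => G z + H z) z', Λ'.baseTuple (fun z => G z + H z) z',
        Λ'.isSolutionFamily hk hGH hGH0 hreg'.iteration hz',
        Λ'.hasDetExpansion hk hGH hreg'.iteration hz'.2⟩
    · exact fun H hH hO => Λ.persists hk hG hG0 hH hO hD hz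
  · refine (isOpen_ne_fun continuous_fst continuous_const).mem_nhds ?_
    simp [powerTuple]

end
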